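/- **Setting.** Let $J^1=\mathbb R^3\times\mathbb R\times\mathbb R^3$ with coordinates $(x^i,u,u_i)$, and for $\theta_1\in J^1$ let $\mathcal C_{\theta_1}=\ker(du-\sum u_i\,dx^i)\subset T_{\theta_1}J^1$ be the $6$-dimensional contact plane, with symplectic form $\omega=\sum dx^i\wedge du_i$; $^\perp$ denotes the $\omega$-orthogonal in $\mathcal C_{\theta_1}$. A 3D Monge–Ampère equation $\mathcal E$ is an equation $$F:=A\det\|u_{ij}\|+\sum_{i\le j}B_{ij}u^\sharp_{ij}+\sum_{i\le j}C^{ij}u_{ij}+D=0,\qquad A,B_{ij},C^{ij},D\in C^\infty(J^1),$$ where $\|u^\sharp_{ij}\|$ is the cofactor matrix of the symmetric matrix $\|u_{ij}\|$. Its fibre $\mathcal E_{\theta_1}$ is the set of points $\theta_2=(\theta_1,u_{ij})$ satisfying it. The symbol at $\theta_2\in\mathcal E_{\theta_1}$ is the quadratic form $\sum_{i\le j}\frac{\partial F}{\partial u_{ij}}(\theta_2)\,\eta_i\eta_j$ on covectors $\eta\in(\mathbb R^3)^*$; $\theta_2$ is regular if the symbol is nonzero, elliptic if the symbol is definite, hyperbolic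 if the symbol takes both positive and negative values. *Contact cone structure.* For $\theta_2=(\theta_1,u_{ij})$ put $D_i=\partial_{x^i}+u_i\partial_u+\sum_j u_{ij}\partial_{u_j}$ and $H(\eta)=\{\sum\xi^iD_i\mid\sum\xi^i\eta_i=0\}$. For a smooth one-parameter family $\eta(t)$ of nonzero covectors annihilating the symbol at $\theta_2$, with $\eta(t),\eta'(t)$ linearly independent, let $v(t)=\lim_{\epsilon\to0}H(\eta(t))\cap H(\eta(t+\epsilon))$. Let $\mathcal V_{\theta_2}$ be the union of all the lines $v(t)$ over all such families and all $t$. The contact cone structure $\mathcal V_{\theta_1}\subset\mathcal C_{\theta_1}$ is the closure of the union of the $\mathcal V_{\theta_2}$ over all regular $\theta_2\in\mathcal E_{\theta_1}$. *Cocharacteristic variety.* Let $(y^1,\dots,y^6)=(x^1,x^2,x^3,u_1,u_2,u_3)$ and let $\Phi$ be the effective $3$-form (i.e. $\omega^{ij}\Phi_{ijk}=0$) in the $dy^a$ whose substitution $du_i\to\sum_j u_{ij}dx^j$ gives $F\,dx^1\wedge dx^2\wedge dx^3$. The cocharacteristic variety of $\mathcal E$ at $\theta_1$ is the zero locus in $\mathcal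 C_{\theta_1}$ of the quadratic form $\sum\omega^{i_1j_1}\omega^{i_2j_2}\Phi_{a i_1i_2}\Phi_{b j_1j_2}\,dy^a\,dy^b$, where $(\omega^{ij})$ is the inverse of the matrix of $\omega$. **Theorem.** Let $\mathcal E$ be a 3D Monge–Ampère equation and let $\theta_2\in\mathcal E_{\theta_1}$ be a regular, non-elliptic point. 1. If the symbol of $\mathcal E$ is nondegenerate at $\theta_2$, then the contact cone structure of $\mathcal E$ at $\theta_1$ is equal to the cocharacteristic variety of $\mathcal E$ at $\theta_1$. 2. If the symbol of $\mathcal E$ has rank $2$ at all points of $\mathcal E_{\theta_1}$ in a neighbourhood of $\theta_2$ and is hyperbolic at $\theta_2$, then the contact cone structure of $\mathcal E$ at $\theta_1$ is the union $D\cup D^\perp$ of two distinct, mutually symplectic-orthogonal $3$-dimensional subspaces of $\mathcal C_{\theta_1}$, and the cocharacteristic variety of $\mathcal E$ at $\theta_1$ is the linear span of $D\cup D^\perp$. 3. If the symbol of $\mathcal E$ has rank $1$ at all points of $\mathcal E_{\theta_1}$ in a neighbourhood of $\theta_2$, then the contact cone structure of $\mathcal E$ at $\theta_1$ is a Lagrangian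 subspace of $\mathcal C_{\theta_1}$, and the cocharacteristic variety of $\mathcal E$ at $\theta_1$ is trivial, i.e. it is the whole of $\mathcal C_{\theta_1}$. -/

import Mathlib

open Set Filter Topology
open scoped ContDiff

namespace MA3

/-- The first jet space `J¹` of functions of three variables, with coordinates
`(x^i, u, u_i)`. It is a vector space, so it also serves as each of its tangent spaces:
a tangent vector is written `(dx^i, du, du_i)`. -/
abbrev J1 : Type := (Fin 3 → ℝ) × ℝ × (Fin 3 → ℝ)

/-- Square matrices of size three; the points of `J²` over `θ₁` are the pairs `(θ₁, U)` with
`U = ‖u_ij‖` symmetric. -/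
abbrev Mat3 : Type := Matrix (Fin 3) (Fin 3) ℝ

/-! ### The contact plane and its symplectic form -/

/-- The contact form `du - ∑ u_i dx^i` at the point `θ₁`. -/
noncomputable def contactForm (θ₁ : J1) : J1 →ₗ[ℝ] ℝ where
  toFun v := v.2.1 - ∑ i, θ₁.2.2 i * v.1 i
  map_add' v w := by
    simp only [Prod.snd_add, Prod.fst_add, Pi.add_apply, mul_add, Finset.sum_add_distrib]
    ring
  map_smul' c v := by
    simp only [Prod.smul_snd, Prod.smul_fst, Pi.smul_apply, smul_eq_mul, RingHom.id_apply,
      mul_sub, Finset.mul_sum]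
    congr 1
    exact Finset.sum_congr rfl fun i _ => by ring

/-- The contact plane at `θ₁`: the six-dimensional kernel of the contact form. -/
noncomputable def contactPlane (θ₁ : J1) : Submodule ℝ J1 := LinearMap.ker (contactForm θ₁)

/-- The two-form `∑ dx^i ∧ du_i`, which is symplectic on each contact plane. -/
def symp (v w : J1) : ℝ := ∑ i, (v.1 i * w.2.2 i - v.2.2 i * w.1 i)

/-- The symplectic orthogonal, inside the contact plane at `θ₁`, of a subspace. -/
def sympOrth (θ₁ : J1) (D : Submodule ℝ J1) : Submodule ℝ J1 where
  carrier := {v | v ∈ contactPlane θ₁ ∧ ∀ w ∈ D, symp v w = 0}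
  zero_mem' := ⟨Submodule.zero_mem _, fun w _ => by simp [symp]⟩
  add_mem' := by
    rintro a b ⟨ha, ha'⟩ ⟨hb, hb'⟩
    refine ⟨Submodule.add_mem _ ha hb, fun w hw => ?_⟩
    have h : symp (a + b) w = symp a w + symp b w := by
      simp only [symp, Prod.snd_add, Prod.fst_add, Pi.add_apply, ← Finset.sum_add_distrib]
      exact Finset.sum_congr rfl fun i _ => by ring
    rw [h, ha' w hw, hb' w hw, add_zero]
  smul_mem' := by
    rintro c a ⟨ha, ha'⟩
    refine ⟨Submodule.smul_mem _ c ha, fun w hw => ?_⟩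
    have h : symp (c • a) w = c * symp a w := by
      simp only [symp, Prod.smul_snd, Prod.smul_fst, Pi.smul_apply, smul_eq_mul, Finset.mul_sum]
      exact Finset.sum_congr rfl fun i _ => by ring
    rw [h, ha' w hw, mul_zero]

/-- Lagrangian subspaces of the contact plane: isotropic of dimension three. -/
def IsLagrangian (θ₁ : J1) (D : Submodule ℝ J1) : Prop :=
  D ≤ contactPlane θ₁ ∧ Module.finrank ℝ D = 3 ∧ ∀ v ∈ D, ∀ w ∈ D, symp v w = 0

/-! ### Integral elements and characteristic hyperplanes -/

/-- The truncated total derivative `∂_{x^i} + u_i ∂_u + ∑ u_ij ∂_{u_j}` at `θ₂ = (θ₁, U)`. -/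
def totalDeriv (θ₁ : J1) (U : Mat3) (i : Fin 3) : J1 := (Pi.single i 1, θ₁.2.2 i, U i)

/-- The hyperplane `{∑ ξ^i D_i | ∑ ξ^i η_i = 0}` of the integral element `L_{θ₂}`,
`θ₂ = (θ₁, U)`, corresponding to the line spanned by the rank-one vertical vector
`∑_{i ≤ j} η_i η_j ∂_{u_ij}`. -/
def hyperplaneOf (θ₁ : J1) (U : Mat3) (η : Fin 3 → ℝ) : Set J1 :=
  {v | ∃ ξ : Fin 3 → ℝ, ∑ i, ξ i * η i = 0 ∧ v = ∑ i, ξ i • totalDeriv θ₁ U i}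

/-- The limit, as `ε → 0`, of `H(η(t)) ∩ H(η(t + ε))`: the vectors that are limits of vectors
chosen in these intersections. For a curve of covectors `η` with `η(t)`, `η'(t)` linearly
independent, these intersections are lines for small `ε ≠ 0`, and so is the limit. -/
def generatrix (θ₁ : J1) (U : Mat3) (η : ℝ → Fin 3 → ℝ) (t : ℝ) : Set J1 :=
  {v | ∃ w : ℝ → J1, Tendsto w (𝓝[≠] 0) (𝓝 v) ∧
    ∀ᶠ ε in 𝓝[≠] (0 : ℝ),
      w ε ∈ hyperplaneOf θ₁ U (η t) ∩ hyperplaneOf θ₁ U (η (t + ε))}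

/-! ### Second order equations: symbol and contact cone structure

The functions `F` below have as arguments a point `θ₁` of `J¹` and the Hessian matrix `U`; only
symmetric `U` matter. -/

/-- The direction `∂_{u_ij}` in the space of symmetric matrices. -/
def hessDir (i j : Fin 3) : Mat3 :=
  if i = j then Matrix.single i i 1 else Matrix.single i j 1 + Matrix.single j i 1

/-- The partial derivative `∂F/∂u_ij` at `(θ₁, U)`. -/
noncomputable def partialHess (F : J1 → Mat3 → ℝ) (θ₁ : J1) (U : Mat3) (i j : Fin 3) : ℝ :=
  deriv (fun t : ℝ => F θ₁ (U + t • hessDir i j)) 0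

/-- The matrix `(2 - δ_ij)⁻¹ ∂F/∂u_ij` of the symbol of `F = 0` at `(θ₁, U)`. -/
noncomputable def symbolMatrix (F : J1 → Mat3 → ℝ) (θ₁ : J1) (U : Mat3) : Mat3 :=
  Matrix.of fun i j => partialHess F θ₁ U i j / (if i = j then 1 else 2)

/-- The quadratic form with matrix `S` on covectors. -/
def quadForm (S : Mat3) (η : Fin 3 → ℝ) : ℝ := ∑ i, ∑ j, S i j * η i * η j

/-- Ellipticity: the symbol is (positive or negative) definite. -/
def IsElliptic (S : Mat3) : Prop :=
  (∀ η : Fin 3 → ℝ, η ≠ 0 → 0 < quadForm S η) ∨ (∀ η : Fin 3 → ℝ, η ≠ 0 → quadForm S η < 0)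

/-- Hyperbolicity: the symbol takes values of both signs. -/
def IsHyperbolic (S : Mat3) : Prop :=
  (∃ η : Fin 3 → ℝ, 0 < quadForm S η) ∧ (∃ η : Fin 3 → ℝ, quadForm S η < 0)

/-- The fibre over `θ₁` of the equation `F = 0`. -/
def fiber (F : J1 → Mat3 → ℝ) (θ₁ : J1) : Set Mat3 := {U | U.IsSymm ∧ F θ₁ U = 0}

/-- A smooth one-parameter family of characteristic rank-one lines for the symbol `S`, given by
the covectors `η(t)` that define the lines: `η(t) ≠ 0`, `S(η(t)) = 0`, and the
line spanned by `η(t)` moves with nonzero velocity. -/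
def IsCharFamily (S : Mat3) (η : ℝ → Fin 3 → ℝ) : Prop :=
  ContDiff ℝ ∞ η ∧
    ∀ t, η t ≠ 0 ∧ quadForm S (η t) = 0 ∧ LinearIndependent ℝ ![η t, deriv η t]

/-- The cone in `L_{θ₂}`, `θ₂ = (θ₁, U)`, swept by the generatrices of all families of
characteristic lines at `θ₂`. -/
def coneAt (F : J1 → Mat3 → ℝ) (θ₁ : J1) (U : Mat3) : Set J1 :=
  {v | ∃ η : ℝ → Fin 3 → ℝ, IsCharFamily (symbolMatrix F θ₁ U) η ∧
    ∃ t : ℝ, v ∈ generatrix θ₁ U η t}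

/-- The contact cone structure at `θ₁` of the equation `F = 0`: the closure of the union of the
cones `coneAt` over all regular points (those with nonzero symbol) of the equation over `θ₁`.
The closure only adds the directions, such as vertical ones, which the integral elements
`L_{θ₂}` approach without containing them. -/
def contactCone (F : J1 → Mat3 → ℝ) (θ₁ : J1) : Set J1 :=
  closure (⋃ U ∈ {U | U ∈ fiber F θ₁ ∧ symbolMatrix F θ₁ U ≠ 0}, coneAt F θ₁ U)

/-! ### Monge-Ampère equations and the cocharacteristic variety -/

/-- The smooth coefficients of a Monge-Ampère equation
`A det U + ∑_{i ≤ j} B_ij U^♯_ij + ∑_{i ≤ j} C^ij U_ij + D = 0`, where `U^♯` is the cofactor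
matrix. Only the `B i j` and `C i j` with `i ≤ j` are used. -/
structure MongeAmpere where
  A : J1 → ℝ
  B : Fin 3 → Fin 3 → J1 → ℝ
  C : Fin 3 → Fin 3 → J1 → ℝ
  D : J1 → ℝ
  smooth_A : ContDiff ℝ ∞ A
  smooth_B : ∀ i j, ContDiff ℝ ∞ (B i j)
  smooth_C : ∀ i j, ContDiff ℝ ∞ (C i j)
  smooth_D : ContDiff ℝ ∞ D

namespace MongeAmpere

/-- The left-hand side of the Monge-Ampère equation. -/
noncomputable def F (E : MongeAmpere) (θ₁ : J1) (U : Mat3) : ℝ :=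
  E.A θ₁ * U.det
    + (∑ i, ∑ j, if i ≤ j then E.B i j θ₁ * U.adjugate.transpose i j else 0)
    + (∑ i, ∑ j, if i ≤ j then E.C i j θ₁ * U i j else 0)
    + E.D θ₁

/-- The components `Φ_ijk`, `i < j < k`, of the effective 3-form `Φ` whose restriction to
`L_{θ₂}` is `F(θ₂) dx¹ ∧ dx² ∧ dx³`, in the coordinates
`(y^0, …, y^5) = (x^1, x^2, x^3, u_1, u_2, u_3)` (indices start from `0`). Off-diagonal
coefficients enter by halves, because the sums in `F` run over `i ≤ j` only. -/
noncomputable def phiSorted (E : MongeAmpere) (θ₁ : J1) : Fin 6 → Fin 6 → Fin 6 → ℝ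
  | 3, 4, 5 => E.A θ₁
  | 0, 4, 5 => E.B 0 0 θ₁
  | 0, 3, 5 => -(E.B 0 1 θ₁ / 2)
  | 1, 4, 5 => E.B 0 1 θ₁ / 2
  | 0, 3, 4 => E.B 0 2 θ₁ / 2
  | 2, 4, 5 => E.B 0 2 θ₁ / 2
  | 1, 3, 5 => -E.B 1 1 θ₁
  | 2, 3, 5 => -(E.B 1 2 θ₁ / 2)
  | 1, 3, 4 => E.B 1 2 θ₁ / 2
  | 2, 3, 4 => E.B 2 2 θ₁
  | 1, 2, 3 => E.C 0 0 θ₁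
  | 1, 2, 4 => E.C 0 1 θ₁ / 2
  | 0, 2, 3 => -(E.C 0 1 θ₁ / 2)
  | 0, 1, 3 => E.C 0 2 θ₁ / 2
  | 1, 2, 5 => E.C 0 2 θ₁ / 2
  | 0, 2, 4 => -E.C 1 1 θ₁
  | 0, 1, 4 => E.C 1 2 θ₁ / 2
  | 0, 2, 5 => -(E.C 1 2 θ₁ / 2)
  | 0, 1, 5 => E.C 2 2 θ₁
  | 0, 1, 2 => E.D θ₁
  | _, _, _ => 0

/-- The components `Φ_ijk` of the effective 3-form for arbitrary indices, by antisymmetry. -/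
noncomputable def phi (E : MongeAmpere) (θ₁ : J1) (i j k : Fin 6) : ℝ :=
  E.phiSorted θ₁ i j k + E.phiSorted θ₁ j k i + E.phiSorted θ₁ k i j
    - E.phiSorted θ₁ j i k - E.phiSorted θ₁ i k j - E.phiSorted θ₁ k j i

end MongeAmpere

/-- The matrix of `∑ dx^i ∧ du_i` in the coordinates `y`. -/
def omegaMat : Matrix (Fin 6) (Fin 6) ℝ :=
  !![0, 0, 0, 1, 0, 0; 0, 0, 0, 0, 1, 0; 0, 0, 0, 0, 0, 1;
     -1, 0, 0, 0, 0, 0; 0, -1, 0, 0, 0, 0; 0, 0, -1, 0, 0, 0]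

/-- The components `ω^ij` of the inverse matrix. -/
def omegaInv : Matrix (Fin 6) (Fin 6) ℝ :=
  !![0, 0, 0, -1, 0, 0; 0, 0, 0, 0, -1, 0; 0, 0, 0, 0, 0, -1;
     1, 0, 0, 0, 0, 0; 0, 1, 0, 0, 0, 0; 0, 0, 1, 0, 0, 0]

theorem omegaMat_mul_omegaInv : omegaMat * omegaInv = 1 := by
  ext i j
  fin_cases i <;> fin_cases j <;>
    simp [omegaMat, omegaInv, Matrix.mul_apply, Fin.sum_univ_succ]

/-- The coordinates `(dy^0, …, dy^5) = (dx^1, dx^2, dx^3, du_1, du_2, du_3)` of a vector. -/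
def yCoord (v : J1) : Fin 6 → ℝ := ![v.1 0, v.1 1, v.1 2, v.2.2 0, v.2.2 1, v.2.2 2]

namespace MongeAmpere

/-- The Kushner-Lychagin-Rubtsov quadratic form
`ω^{i₁j₁} ω^{i₂j₂} Φ_{a i₁ i₂} Φ_{b j₁ j₂} dy^a dy^b`. -/
noncomputable def klr (E : MongeAmpere) (θ₁ v : J1) : ℝ :=
  ∑ a, ∑ b, (∑ i₁, ∑ j₁, ∑ i₂, ∑ j₂,
    omegaInv i₁ j₁ * omegaInv i₂ j₂ * E.phi θ₁ a i₁ i₂ * E.phi θ₁ b j₁ j₂)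
      * yCoord v a * yCoord v b

/-- The cocharacteristic variety at `θ₁`: the zero locus of the KLR form in the contact plane. -/
def cochar (E : MongeAmpere) (θ₁ : J1) : Set J1 :=
  {v | v ∈ contactPlane θ₁ ∧ E.klr θ₁ v = 0}

/-- The symbol of the Monge-Ampère equation at `θ₂ = (θ₁, U)`. -/
noncomputable def symbol (E : MongeAmpere) (θ₁ : J1) (U : Mat3) : Mat3 := symbolMatrix E.F θ₁ U

end MongeAmpere

end MA3

namespace MA3

open Matrix

/-! Over a fixed `θ₁` the equation is a cubic `F(U) = a det U + tr(b adj U) + tr(c U) + d`. Its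
Taylor expansion at `U` has coefficients `(a, T U, S U, F U)`, where `S U` is the symbol. Up to a
constant the KLR form is an explicit quadratic form `kap` in coordinates `(x, p)` of the contact
plane, and translating the Hessian by `U` acts on it by the symplectic shear `p ↦ p + Ux` (`klr_eq`,
`kap_shift`). Hence, on the integral element of a point `U` of the equation, `kap` restricts to the
quadratic form `adj (S U)`. The generatrix of a family `η` is spanned by `η × η'`, and `adj S`
evaluated there is the Gram determinant of `S` on `η, η'`, which vanishes because `S(η, η) = S(η,
η') = 0`. So the contact cone always lies in the cocharacteristic variety (`closure_cone_subset`).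
If `S U₀` is nondegenerate, every null vector of `adj S` is a generatrix direction
(`mem_dualCone_of_det_ne_zero`). Conversely, through a generic zero `v` of `kap` passes an integral
element that solves the equation and has nondegenerate symbol (`mem_cone_of_genericity`). Genericity
is a polynomial condition on `v`; joining any zero to a good one by a conic inside the quadric `kap
= 0` shows that good zeros are dense (`kap_zeros_subset_closure_cone`). Non-ellipticity supplies the
first good zero. If the symbol is degenerate near `U₀`, curves on the equation through `U₀`
determine enough coefficients to give a normal form (`eq_normTwo`, `eq_normOne`). Up to a symplectic
change of coordinates, `F(U)` is then, up to a nonzero factor, the restriction to the integral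
element of a decomposable 3-form, in two ways for rank two. The equation says that the integral
element meets the kernel of that form, and these kernels are `D` and `D^⊥`, or the Lagrangian plane.
In particular the symbol is degenerate on the whole fibre, not only near `U₀`, which matters because
the cone is a union over the whole fibre. A cone vector over a degenerate point satisfies quadratic
relations that place it in a kernel (`IsFlatPoint.rel` and its companions). Conversely every vector
of a kernel is a limit of cone vectors (`mem_closure_degCone`). -/

abbrev V3 : Type := Fin 3 → ℝ

theorem symm_eq {U : Mat3} (h : U.IsSymm) :
    ∃ a b c d e f : ℝ, U = !![a, b, c; b, d, e; c, e, f] := by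
  refine ⟨U 0 0, U 0 1, U 0 2, U 1 1, U 1 2, U 2 2, ?_⟩
  ext i j
  fin_cases i <;> fin_cases j <;> simp [h.apply 0 1, h.apply 0 2, h.apply 1 2]

theorem symm_mk (a b c d e f : ℝ) : (!![a, b, c; b, d, e; c, e, f] : Mat3).IsSymm := by
  ext i j
  fin_cases i <;> fin_cases j <;> simp

theorem vec_eq (x : V3) : ∃ a b c : ℝ, x = ![a, b, c] :=
  ⟨x 0, x 1, x 2, by ext i; fin_cases i <;> simp⟩

/-- The bilinear form with matrix `S`. -/
def bil (S : Mat3) (x y : V3) : ℝ := x ⬝ᵥ (S *ᵥ y)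

theorem quadForm_eq (S : Mat3) (x : V3) : quadForm S x = bil S x x := by
  simp only [quadForm, bil, dotProduct, mulVec, Fin.sum_univ_three]
  ring

/-- The polarization of the adjugate. -/
def cross (X Y : Mat3) : Mat3 := adjugate (X + Y) - adjugate X - adjugate Y

/-- The coefficients of a Monge-Ampère equation at one point of `J¹`, those of the adjugate and
of the linear term being arranged in matrices. -/
@[ext] structure MAData where
  a : ℝ
  b : Mat3
  c : Mat3
  d : ℝ

/-! ### Pointwise coefficients: Taylor expansion and covariance of the KLR form. -/

namespace MAData

def F (M : MAData) (U : Mat3) : ℝ :=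
  M.a * U.det + trace (M.b * adjugate U) + trace (M.c * U) + M.d

def T (M : MAData) (U : Mat3) : Mat3 := M.b + M.a • U

def S (M : MAData) (U : Mat3) : Mat3 := M.a • adjugate U + cross M.b U + M.c

/-- The coefficients after the translation of the Hessian by `U`. -/
def shift (M : MAData) (U : Mat3) : MAData := ⟨M.a, M.T U, M.S U, M.F U⟩

/-- The Kushner-Lychagin-Rubtsov form, up to a factor. -/
def kap (M : MAData) (x p : V3) : ℝ :=
  bil (adjugate M.c) x x - M.d * bil M.b x x - 2 * (p ⬝ᵥ (M.c *ᵥ (M.b *ᵥ x)))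
    + (trace (M.c * M.b) - M.a * M.d) * (p ⬝ᵥ x) + bil (adjugate M.b) p p - M.a * bil M.c p p

/-- The exact Taylor expansion of a cubic. It moves any point `U` of the equation to the zero
matrix, where `d = 0` and the symbol is `c`. -/
theorem F_shift (M : MAData) (U V : Mat3) : (M.shift U).F V = M.F (U + V) := by
  simp only [F, shift, T, S, cross, det_fin_three, adjugate_fin_three, trace_fin_three,
    Matrix.mul_apply, Fin.sum_univ_three, Matrix.add_apply, Matrix.sub_apply, Matrix.smul_apply,
    of_apply, cons_val', cons_val_zero, cons_val_one, cons_val, smul_eq_mul]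
  ring

theorem S_shift (M : MAData) (U V : Mat3) : (M.shift U).S V = M.S (U + V) := by
  ext i j
  fin_cases i <;> fin_cases j <;>
  simp [shift, T, S, cross, adjugate_fin_three] <;>
  ring

theorem T_shift (M : MAData) (U V : Mat3) : (M.shift U).T V = M.T (U + V) := by
  simp [shift, T, add_assoc]

theorem shift_shift (M : MAData) (U V : Mat3) : (M.shift U).shift V = M.shift (U + V) := by
  ext1
  · rfl
  · exact T_shift ..
  · exact S_shift ..
  · exact F_shift ..

theorem S_isSymm (M : MAData) (hb : M.b.IsSymm) (hc : M.c.IsSymm) {U : Mat3} (hU : U.IsSymm) :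
    (M.S U).IsSymm := by
  simp only [S, cross, IsSymm, transpose_add, transpose_sub, transpose_smul,
    adjugate_transpose, hb.eq, hc.eq, hU.eq]

theorem T_isSymm (M : MAData) (hb : M.b.IsSymm) {U : Mat3} (hU : U.IsSymm) :
    (M.T U).IsSymm := by
  simp only [T, IsSymm, transpose_add, transpose_smul, hb.eq, hU.eq]

-- The KLR form depends only on `ω` and the effective form, and the shear `p ↦ p + Ux` is
-- symplectic. With `q = 0` and `F U = 0`, only the term `adj (S U)` survives on the left.
set_option maxHeartbeats 4000000 in
theorem kap_shift (M : MAData) (hb : M.b.IsSymm) (hc : M.c.IsSymm) {U : Mat3} (hU : U.IsSymm)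
    (x q : V3) : (M.shift U).kap x q = M.kap x (q + U *ᵥ x) := by
  obtain ⟨a, b, c, d⟩ := M
  obtain ⟨b0, b1, b2, b3, b4, b5, rfl⟩ := symm_eq hb
  obtain ⟨c0, c1, c2, c3, c4, c5, rfl⟩ := symm_eq hc
  obtain ⟨u0, u1, u2, u3, u4, u5, rfl⟩ := symm_eq hU
  obtain ⟨x0, x1, x2, rfl⟩ := vec_eq x
  obtain ⟨p0, p1, p2, rfl⟩ := vec_eq q
  simp only [kap, bil, F, shift, T, S, cross, det_fin_three, adjugate_fin_three, trace_fin_three,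
    Matrix.mul_apply, Fin.sum_univ_three, Matrix.add_apply, Matrix.sub_apply, Matrix.smul_apply,
    of_apply, cons_val', cons_val_zero, cons_val_one, cons_val, smul_eq_mul, dotProduct, mulVec,
    Pi.add_apply]
  ring

end MAData

/-! ### Comparison of the symbol and of the KLR form with the pointwise coefficients. -/

namespace MongeAmpere

/-- The coefficients of the equation at `θ`. -/
noncomputable def data (E : MongeAmpere) (θ : J1) : MAData where
  a := E.A θ
  b := !![E.B 0 0 θ, E.B 0 1 θ / 2, E.B 0 2 θ / 2;
          E.B 0 1 θ / 2, E.B 1 1 θ, E.B 1 2 θ / 2;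
          E.B 0 2 θ / 2, E.B 1 2 θ / 2, E.B 2 2 θ]
  c := !![E.C 0 0 θ, E.C 0 1 θ / 2, E.C 0 2 θ / 2;
          E.C 0 1 θ / 2, E.C 1 1 θ, E.C 1 2 θ / 2;
          E.C 0 2 θ / 2, E.C 1 2 θ / 2, E.C 2 2 θ]
  d := E.D θ

theorem data_b_isSymm (E : MongeAmpere) (θ : J1) : (E.data θ).b.IsSymm := symm_mk ..

theorem data_c_isSymm (E : MongeAmpere) (θ : J1) : (E.data θ).c.IsSymm := symm_mk ..

theorem F_eq (E : MongeAmpere) (θ : J1) {U : Mat3} (hU : U.IsSymm) :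
    E.F θ U = (E.data θ).F U := by
  obtain ⟨u0, u1, u2, u3, u4, u5, rfl⟩ := symm_eq hU
  simp [F, MAData.F, data, det_fin_three, adjugate_fin_three, trace_fin_three,
    Fin.sum_univ_three]
  ring

theorem hessDir_isSymm (i j : Fin 3) : (hessDir i j).IsSymm := by
  rw [hessDir]
  split_ifs with h
  · ext k l; fin_cases i <;> fin_cases k <;> fin_cases l <;> simp [Matrix.single]
  · rw [IsSymm, transpose_add, transpose_single, transpose_single, add_comm]

theorem partialHess_eq (E : MongeAmpere) (θ : J1) {U : Mat3} (hU : U.IsSymm) (i j : Fin 3) :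
    partialHess E.F θ U i j = trace ((E.data θ).S U * hessDir i j) := by
  set N := (E.data θ).shift U with hN
  -- Expanding around `U` gives a cubic polynomial in `t`, so the derivative at `0` is the
  -- coefficient of `t`.
  have key : (fun t : ℝ => E.F θ (U + t • hessDir i j)) = fun t =>
      t ^ 3 * (N.a * (hessDir i j).det) + t ^ 2 * trace (N.b * adjugate (hessDir i j))
        + t * trace (N.c * hessDir i j) + N.d := by
    funext t
    have hs : (U + t • hessDir i j).IsSymm := hU.add ((hessDir_isSymm i j).smul t)
    rw [F_eq E θ hs, ← MAData.F_shift, ← hN, MAData.F, det_smul, adjugate_smul, Matrix.mul_smul,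
      Matrix.mul_smul, trace_smul, trace_smul]
    simp only [Fintype.card_fin, smul_eq_mul, Nat.add_one_sub_one]
    ring
  rw [partialHess, key]
  have h : HasDerivAt (fun t : ℝ => t ^ 3 * (N.a * (hessDir i j).det)
      + t ^ 2 * trace (N.b * adjugate (hessDir i j)) + t * trace (N.c * hessDir i j) + N.d)
      (trace (N.c * hessDir i j)) 0 := by
    have := (((((hasDerivAt_id (0 : ℝ)).pow 3).mul_const (N.a * (hessDir i j).det)).add
      (((hasDerivAt_id (0 : ℝ)).pow 2).mul_const (trace (N.b * adjugate (hessDir i j))))).add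
      ((hasDerivAt_id (0 : ℝ)).mul_const (trace (N.c * hessDir i j)))).add_const N.d
    refine this.congr_deriv ?_
    simp
  exact h.deriv

theorem symbol_eq (E : MongeAmpere) (θ : J1) {U : Mat3} (hU : U.IsSymm) :
    symbolMatrix E.F θ U = (E.data θ).S U := by
  have hs := (E.data θ).S_isSymm (E.data_b_isSymm θ) (E.data_c_isSymm θ) hU
  ext i j
  rw [symbolMatrix, of_apply, partialHess_eq E θ hU]
  rw [hessDir]
  split_ifs with h
  · subst h
    simp [trace_mul_single]
  · rw [Matrix.mul_add, trace_add, trace_mul_single, trace_mul_single, hs.apply i j]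
    simp

theorem sum_omegaInv (f : Fin 6 → Fin 6 → ℝ) :
    ∑ i, ∑ j, omegaInv i j * f i j
      = f 3 0 - f 0 3 + (f 4 1 - f 1 4) + (f 5 2 - f 2 5) := by
  simp [omegaInv, Fin.sum_univ_succ]
  ring

/-- The contraction of the effective form with a vector. -/
noncomputable def contr (E : MongeAmpere) (θ : J1) (y : Fin 6 → ℝ) (i j : Fin 6) : ℝ :=
  ∑ a, E.phi θ a i j * y a

theorem contr_antisymm (E : MongeAmpere) (θ : J1) (y : Fin 6 → ℝ) (i j : Fin 6) :
    E.contr θ y i j = - E.contr θ y j i := by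
  simp only [contr, ← Finset.sum_neg_distrib, phi]
  exact Finset.sum_congr rfl fun a _ => by ring

theorem sum_sum_sum_mul {ι κ : Type*} [Fintype ι] [Fintype κ] (w : κ → ℝ) (P Q : ι → κ → ℝ)
    (y : ι → ℝ) : ∑ a, ∑ b, (∑ k, w k * P a k * Q b k) * y a * y b
      = ∑ k, w k * ((∑ a, P a k * y a) * ∑ b, Q b k * y b) := by
  calc _ = ∑ a, ∑ k, ∑ b, w k * ((P a k * y a) * (Q b k * y b)) := by
        refine Finset.sum_congr rfl fun a _ => ?_
        rw [Finset.sum_comm]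
        refine Finset.sum_congr rfl fun b _ => ?_
        rw [Finset.sum_mul, Finset.sum_mul]
        exact Finset.sum_congr rfl fun k _ => by ring
    _ = _ := by
        rw [Finset.sum_comm]
        refine Finset.sum_congr rfl fun k _ => ?_
        rw [Finset.sum_mul_sum]
        simp only [Finset.mul_sum]

/-- The KLR form at `v` is the full `ω`-contraction of the 2-form `ι_v Φ` with itself. Contracting
`v` first leaves only the 15 components of this 2-form to compute. -/
theorem klr_eq_sum (E : MongeAmpere) (θ v : J1) :
    E.klr θ v = ∑ i₁, ∑ j₁, omegaInv i₁ j₁ * ∑ i₂, ∑ j₂, omegaInv i₂ j₂ *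
      (E.contr θ (yCoord v) i₁ i₂ * E.contr θ (yCoord v) j₁ j₂) := by
  have h := sum_sum_sum_mul (κ := Fin 6 × Fin 6 × Fin 6 × Fin 6)
    (fun k => omegaInv k.1 k.2.1 * omegaInv k.2.2.1 k.2.2.2)
    (fun a k => E.phi θ a k.1 k.2.2.1) (fun a k => E.phi θ a k.2.1 k.2.2.2) (yCoord v)
  simp only [Fintype.sum_prod_type] at h
  rw [klr, h]
  simp only [contr, Finset.mul_sum _ _ (omegaInv _ _), mul_assoc]

set_option maxHeartbeats 4000000 in
theorem klr_eq (E : MongeAmpere) (θ v : J1) :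
    E.klr θ v = -4 * (E.data θ).kap v.1 v.2.2 := by
  rw [klr_eq_sum]
  set ψ := E.contr θ (yCoord v) with hψ
  have anti : ∀ i j, ψ i j = - ψ j i := E.contr_antisymm θ (yCoord v)
  have diag : ∀ i, ψ i i = 0 := fun i => by linarith [anti i i]
  simp only [sum_omegaInv]
  have hs : ∀ i j, ψ i j = E.phi θ 0 i j * v.1 0 + E.phi θ 1 i j * v.1 1 + E.phi θ 2 i j * v.1 2
      + E.phi θ 3 i j * v.2.2 0 + E.phi θ 4 i j * v.2.2 1 + E.phi θ 5 i j * v.2.2 2 := by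
    intro i j
    rw [hψ, contr, Fin.sum_univ_six]
    rfl
  have h01 := hs 0 1
  have h02 := hs 0 2
  have h03 := hs 0 3
  have h04 := hs 0 4
  have h05 := hs 0 5
  have h12 := hs 1 2
  have h13 := hs 1 3
  have h14 := hs 1 4
  have h15 := hs 1 5
  have h23 := hs 2 3
  have h24 := hs 2 4
  have h25 := hs 2 5
  have h34 := hs 3 4
  have h35 := hs 3 5
  have h45 := hs 4 5
  simp only [phi, phiSorted] at h01 h02 h03 h04 h05 h12 h13 h14 h15 h23 h24 h25 h34 h35 h45
  rw [anti 1 0, anti 2 0, anti 3 0, anti 4 0, anti 5 0, anti 2 1, anti 3 1, anti 4 1, anti 5 1,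
    anti 3 2, anti 4 2, anti 5 2, anti 4 3, anti 5 3, anti 5 4, diag, diag, diag, diag, diag, diag,
    h01, h02, h03, h04, h05, h12, h13, h14, h15, h23, h24, h25, h34, h35, h45]
  simp only [MAData.kap, data, bil, adjugate_fin_three, trace_fin_three,
    Matrix.mul_apply, Fin.sum_univ_three,
    of_apply, cons_val', cons_val_zero, cons_val_one, cons_val, dotProduct, mulVec]
  ring

end MongeAmpere

/-! ### Bilinear forms in dimension three -/

theorem bil_comm {S : Mat3} (hS : S.IsSymm) (x y : V3) : bil S x y = bil S y x := by
  rw [bil, bil, dotProduct_mulVec, ← mulVec_transpose, hS.eq, dotProduct_comm]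

theorem bil_add_left (S : Mat3) (x y z : V3) : bil S (x + y) z = bil S x z + bil S y z := by
  simp [bil]

theorem bil_add_right (S : Mat3) (x y z : V3) : bil S x (y + z) = bil S x y + bil S x z := by
  simp [bil, mulVec_add]

theorem bil_smul_left (S : Mat3) (r : ℝ) (x y : V3) : bil S (r • x) y = r * bil S x y := by
  simp [bil]

theorem bil_smul_right (S : Mat3) (r : ℝ) (x y : V3) : bil S x (r • y) = r * bil S x y := by
  simp [bil, mulVec_smul]

theorem mul_mul_transpose_apply (P S : Mat3) (i j : Fin 3) :
    (P * S * Pᵀ) i j = bil S (P i) (P j) := by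
  simp only [bil, mul_apply, transpose_apply, dotProduct, mulVec, Fin.sum_univ_three]
  ring

/-- The Gram determinant of three vectors. -/
theorem det_gram {S : Mat3} (hS : S.IsSymm) (x y z : V3) :
    S.det * (of ![x, y, z]).det ^ 2
      = bil S x x * bil S y y * bil S z z + 2 * bil S x y * bil S y z * bil S x z
        - bil S x x * bil S y z ^ 2 - bil S y y * bil S x z ^ 2 - bil S z z * bil S x y ^ 2 := by
  have h : ∀ P : Mat3, S.det * P.det ^ 2
      = bil S (P 0) (P 0) * bil S (P 1) (P 1) * bil S (P 2) (P 2)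
        + 2 * bil S (P 0) (P 1) * bil S (P 1) (P 2) * bil S (P 0) (P 2)
        - bil S (P 0) (P 0) * bil S (P 1) (P 2) ^ 2 - bil S (P 1) (P 1) * bil S (P 0) (P 2) ^ 2
        - bil S (P 2) (P 2) * bil S (P 0) (P 1) ^ 2 := by
    intro P
    have h1 : (P * S * Pᵀ).det = S.det * P.det ^ 2 := by
      rw [det_mul, det_mul, det_transpose]
      ring
    rw [← h1, det_fin_three]
    simp only [mul_mul_transpose_apply]
    rw [bil_comm hS (P 1) (P 0), bil_comm hS (P 2) (P 0), bil_comm hS (P 2) (P 1)]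
    ring
  exact h (of ![x, y, z])

theorem dot_self_ne {x : V3} (h : x ≠ 0) : x ⬝ᵥ x ≠ 0 := fun h' => h (dotProduct_self_eq_zero.1 h')

theorem eq_smul_cross {x y ξ : V3} (h : LinearIndependent ℝ ![x, y]) (hx : ξ ⬝ᵥ x = 0)
    (hy : ξ ⬝ᵥ y = 0) : ∃ r : ℝ, ξ = r • (x ⨯₃ y) := by
  have hn : x ⨯₃ y ≠ 0 := (crossProduct_ne_zero_iff_linearIndependent).2 h
  set n := x ⨯₃ y with hnd
  have h1 := dot_self_ne hn
  refine ⟨(ξ ⬝ᵥ n) / (n ⬝ᵥ n), ?_⟩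
  -- The double product `n × (ξ × n)` is expanded once by the triple product formula, and once after
  -- noting that `ξ × (x × y) = 0`.
  have h2 : (n ⬝ᵥ n) • ξ = (ξ ⬝ᵥ n) • n := by
    have h3 : n ⨯₃ (ξ ⨯₃ n) = (n ⬝ᵥ n) • ξ - (ξ ⬝ᵥ n) • n := by
      ext i
      fin_cases i <;> simp [cross_apply, dotProduct, Fin.sum_univ_three] <;> ring
    have h4 : ξ ⨯₃ n = (ξ ⬝ᵥ y) • x - (ξ ⬝ᵥ x) • y := by
      rw [hnd]
      ext i
      fin_cases i <;> simp [cross_apply, dotProduct, Fin.sum_univ_three] <;> ring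
    rw [h4, hx, hy] at h3
    simp at h3
    exact (sub_eq_zero.1 h3.symm)
  rw [div_eq_inv_mul, mul_smul, ← h2, smul_smul, inv_mul_cancel₀ h1, one_smul]

theorem eq_add_of_dot_cross {x y m : V3} (h : LinearIndependent ℝ ![x, y])
    (hm : m ⬝ᵥ (x ⨯₃ y) = 0) : ∃ r s : ℝ, m = r • x + s • y := by
  have hn : x ⨯₃ y ≠ 0 := (crossProduct_ne_zero_iff_linearIndependent).2 h
  set n := x ⨯₃ y with hnd
  have h1 := dot_self_ne hn
  have h2 : (n ⬝ᵥ n) • m = ((n ⨯₃ m) ⬝ᵥ y) • x + (-((n ⨯₃ m) ⬝ᵥ x)) • y := by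
    have h3 : n ⨯₃ (n ⨯₃ m) = (m ⬝ᵥ n) • n - (n ⬝ᵥ n) • m := by
      ext i
      fin_cases i <;> simp [cross_apply, dotProduct, Fin.sum_univ_three] <;> ring
    have h4 : n ⨯₃ (n ⨯₃ m) = ((n ⨯₃ m) ⬝ᵥ x) • y - ((n ⨯₃ m) ⬝ᵥ y) • x := by
      generalize n ⨯₃ m = k
      rw [hnd]
      ext i
      fin_cases i <;> simp [cross_apply, dotProduct, Fin.sum_univ_three] <;> ring
    rw [hm, zero_smul, zero_sub] at h3
    rw [eq_neg_of_add_eq_zero_left (a := (n ⬝ᵥ n) • m) (b := n ⨯₃ (n ⨯₃ m)) (by rw [h3]; simp), h4]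
    simp
    abel
  refine ⟨(n ⬝ᵥ n)⁻¹ * ((n ⨯₃ m) ⬝ᵥ y), (n ⬝ᵥ n)⁻¹ * (-((n ⨯₃ m) ⬝ᵥ x)), ?_⟩
  rw [mul_smul, mul_smul, ← smul_add, ← h2, smul_smul, inv_mul_cancel₀ h1, one_smul]

/-! ### Families of characteristic covectors -/

/-- The directions `ξ` of the generatrices of the families of characteristic lines. -/
def dualCone (S : Mat3) : Set V3 :=
  {ξ | ∃ η : ℝ → V3, IsCharFamily S η ∧ ∃ t r : ℝ, ξ = r • (η t ⨯₃ deriv η t)}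

theorem hasDerivAt_bil (S : Mat3) {f g : ℝ → V3} {f' g' : V3} {t : ℝ} (hf : HasDerivAt f f' t)
    (hg : HasDerivAt g g' t) :
    HasDerivAt (fun s => bil S (f s) (g s)) (bil S f' (g t) + bil S (f t) g') t := by
  rw [hasDerivAt_pi] at hf hg
  have h : ∀ i j, HasDerivAt (fun s => S i j * (f s i * g s j))
      (S i j * (f' i * g t j + f t i * g' j)) t := fun i j =>
    ((hf i).mul (hg j)).const_mul _
  have h2 : ∀ x y : V3, bil S x y = ∑ i, ∑ j, S i j * (x i * y j) := by
    intro x y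
    simp only [bil, dotProduct, mulVec, Fin.sum_univ_three]
    ring
  simp only [h2]
  rw [← Finset.sum_add_distrib]
  simp only [← Finset.sum_add_distrib, ← mul_add]
  exact HasDerivAt.fun_sum fun i _ => HasDerivAt.fun_sum fun j _ => h i j

section Family

variable {S : Mat3} {η : ℝ → V3}

theorem IsCharFamily.hasDerivAt (h : IsCharFamily S η) (t : ℝ) :
    HasDerivAt η (deriv η t) t :=
  ((h.1.differentiable (by simp)) t).hasDerivAt

theorem IsCharFamily.hasDerivAt_deriv (h : IsCharFamily S η) (t : ℝ) :
    HasDerivAt (deriv η) (deriv (deriv η) t) t := by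
  have : ContDiff ℝ 1 (deriv η) := (h.1.of_le (m := 1 + 1) (by norm_cast)).deriv'
  exact ((this.differentiable (by simp)) t).hasDerivAt

theorem IsCharFamily.bil_self (h : IsCharFamily S η) (t : ℝ) : bil S (η t) (η t) = 0 := by
  rw [← quadForm_eq]
  exact (h.2 t).2.1

theorem IsCharFamily.bil_deriv (h : IsCharFamily S η) (hS : S.IsSymm) (t : ℝ) :
    bil S (η t) (deriv η t) = 0 := by
  have h1 := hasDerivAt_bil S (h.hasDerivAt t) (h.hasDerivAt t)
  have h2 : (fun s => bil S (η s) (η s)) = fun _ => 0 := funext h.bil_self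
  rw [h2] at h1
  have h3 := h1.unique (hasDerivAt_const t (0 : ℝ))
  rw [bil_comm hS (deriv η t)] at h3
  linarith

theorem IsCharFamily.bil_deriv_deriv (h : IsCharFamily S η) (hS : S.IsSymm) (t : ℝ) :
    bil S (deriv η t) (deriv η t) = - bil S (η t) (deriv (deriv η) t) := by
  have h1 := hasDerivAt_bil S (h.hasDerivAt t) (h.hasDerivAt_deriv t)
  have h2 : (fun s => bil S (η s) (deriv η s)) = fun _ => 0 := funext (h.bil_deriv hS)
  rw [h2] at h1
  have h3 := h1.unique (hasDerivAt_const t (0 : ℝ))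
  linarith

/-- `adj S` is the form induced by `S` on bivectors, identified with vectors by the cross product;
`S = 1` is Lagrange's identity. -/
theorem bil_adjugate_cross {S : Mat3} (hS : S.IsSymm) (x y : V3) :
    bil (adjugate S) (x ⨯₃ y) (x ⨯₃ y) = bil S x x * bil S y y - bil S x y ^ 2 := by
  obtain ⟨c0, c1, c2, c3, c4, c5, rfl⟩ := symm_eq hS
  simp only [bil, adjugate_fin_three, Fin.sum_univ_three, cross_apply,
    of_apply, cons_val', cons_val_zero, cons_val_one, cons_val, dotProduct, mulVec]
  ring

theorem bil_adjugate_of_mem_dualCone (hS : S.IsSymm) {ξ : V3} (h : ξ ∈ dualCone S) :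
    bil (adjugate S) ξ ξ = 0 := by
  obtain ⟨η, hη, t, r, rfl⟩ := h
  rw [bil_smul_left, bil_smul_right, bil_adjugate_cross hS, hη.bil_self, hη.bil_deriv hS]
  ring

/-- The symbol `S` vanishes on the annihilator of `ξ`. -/
def VanishesOnPerp (S : Mat3) (ξ : V3) : Prop :=
  ∀ m n : V3, m ⬝ᵥ ξ = 0 → n ⬝ᵥ ξ = 0 → bil S m n = 0

/-- Differentiating `S(η, η) = 0` twice gives `S(η, η') = 0` and `S(η', η') = -S(η, η'')`. The Gram
determinant of `η, η', η''` is then `S(η, η'')³`, and it vanishes with `det S`. So `S` is zero on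
the span of `η, η'`, the annihilator of `ξ`. -/
theorem vanishesOnPerp_of_mem_dualCone (hS : S.IsSymm) (hdet : S.det = 0) {ξ : V3} (hξ : ξ ≠ 0)
    (h : ξ ∈ dualCone S) : VanishesOnPerp S ξ := by
  obtain ⟨η, hη, t, r, rfl⟩ := h
  have hr : r ≠ 0 := by
    rintro rfl
    simp at hξ
  have h11 := hη.bil_self t
  have h12 := hη.bil_deriv hS t
  have h22 : bil S (deriv η t) (deriv η t) = 0 := by
    have h := det_gram hS (η t) (deriv η t) (deriv (deriv η) t)
    rw [hdet, h11, h12, hη.bil_deriv_deriv hS t] at h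
    rw [hη.bil_deriv_deriv hS t]
    have : bil S (η t) (deriv (deriv η) t) ^ 3 = 0 := by linarith
    rw [pow_eq_zero_iff (by norm_num)] at this
    rw [this, neg_zero]
  have h21 : bil S (deriv η t) (η t) = 0 := by rw [bil_comm hS, h12]
  intro m n hm hn
  rw [dotProduct_smul, smul_eq_mul, mul_eq_zero, or_iff_right hr] at hm hn
  obtain ⟨a, b, rfl⟩ := eq_add_of_dot_cross (hη.2 t).2.2 hm
  obtain ⟨c, d, rfl⟩ := eq_add_of_dot_cross (hη.2 t).2.2 hn
  simp [bil_add_left, bil_add_right, bil_smul_left, bil_smul_right, h11, h12, h21, h22]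

end Family

theorem ne_zero_of_linearIndependent {x y : V3} (h : LinearIndependent ℝ ![x, y]) : x ≠ 0 := by
  simpa using h.ne_zero 0

/-- Two covectors spanning the annihilator of a nonzero vector. -/
theorem exists_cross_eq {ξ : V3} (hξ : ξ ≠ 0) :
    ∃ m n : V3, m ⬝ᵥ ξ = 0 ∧ n ⬝ᵥ ξ = 0 ∧ LinearIndependent ℝ ![m, n] ∧
      ∃ r : ℝ, ξ = r • (m ⨯₃ n) := by
  obtain ⟨k, hk⟩ : ∃ k : V3, ξ ⨯₃ k ≠ 0 := by
    by_contra! h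
    apply hξ
    have h0 := h ![1, 0, 0]
    have h1 := h ![0, 1, 0]
    have h00 := congrFun h0 1
    have h01 := congrFun h0 2
    have h10 := congrFun h1 2
    simp [cross_apply] at h00 h01 h10
    ext i
    fin_cases i <;> simp [h00, h01, h10]
  have hd : ∀ l : V3, (ξ ⨯₃ l) ⬝ᵥ ξ = 0 := fun l => by
    rw [dotProduct_comm, dot_self_cross]
  have hli : LinearIndependent ℝ ![ξ ⨯₃ k, ξ ⨯₃ (ξ ⨯₃ k)] := by
    rw [← crossProduct_ne_zero_iff_linearIndependent]
    have h : (ξ ⨯₃ k) ⨯₃ (ξ ⨯₃ (ξ ⨯₃ k)) = ((ξ ⨯₃ k) ⬝ᵥ (ξ ⨯₃ k)) • ξ := by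
      ext i
      fin_cases i <;> simp [cross_apply, dotProduct, Fin.sum_univ_three] <;> ring
    rw [h]
    exact smul_ne_zero (dot_self_ne hk) hξ
  refine ⟨_, _, hd k, hd _, hli, ?_⟩
  exact eq_smul_cross hli (by rw [dotProduct_comm]; exact hd _)
    (by rw [dotProduct_comm]; exact hd _)

/-- A straight line `m + t n` in the annihilator of `ξ` is a characteristic family. -/
theorem mem_dualCone_of_vanishesOnPerp {S : Mat3} {ξ : V3} (hξ : ξ ≠ 0)
    (h : VanishesOnPerp S ξ) : ξ ∈ dualCone S := by
  obtain ⟨m, n, hm, hn, hli, r, hr⟩ := exists_cross_eq hξ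
  have hder : ∀ t : ℝ, HasDerivAt (fun t : ℝ => m + t • n) n t := fun t => by
    simpa using ((hasDerivAt_id t).smul_const n).const_add m
  have hder' : ∀ t : ℝ, deriv (fun t : ℝ => m + t • n) t = n := fun t => (hder t).deriv
  have hli' : ∀ t : ℝ, LinearIndependent ℝ ![m + t • n, n] := fun t => by
    rw [← crossProduct_ne_zero_iff_linearIndependent] at hli ⊢
    simpa using hli
  refine ⟨fun t => m + t • n, ⟨by fun_prop, fun t => ⟨?_, ?_, ?_⟩⟩, 0, r, ?_⟩
  · exact ne_zero_of_linearIndependent (hli' t)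
  · rw [quadForm_eq]
    exact h _ _ (by simp [hm, hn]) (by simp [hm, hn])
  · rw [hder']
    exact hli' t
  · rw [hder', hr]
    simp

theorem bil_adjugate_mulVec {S : Mat3} (hS : S.IsSymm) (x y : V3) :
    bil (adjugate S) (S *ᵥ x) (S *ᵥ y) = S.det * bil S x y := by
  rw [bil, mulVec_mulVec, adjugate_mul, smul_mulVec, one_mulVec, dotProduct_smul, smul_eq_mul,
    bil_comm hS, bil, dotProduct_comm]

/-- A frame of a nondegenerate form adapted to a null vector: the other outer vector is null and
the middle vector is orthogonal to both. -/
theorem exists_null_frame {S : Mat3} (hS : S.IsSymm) (hdet : S.det ≠ 0) {x : V3} (hx : x ≠ 0)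
    (hxx : bil S x x = 0) :
    ∃ w z : V3, bil S x w = 0 ∧ bil S w z = 0 ∧ bil S z z = 0 ∧ bil S w w ≠ 0 ∧
      2 * bil S x z + bil S w w = 0 ∧ ∃ r : ℝ, S *ᵥ x = r • (x ⨯₃ w) := by
  have hSx : S *ᵥ x ≠ 0 := fun h => hx (by
    have := congrArg (fun v => (adjugate S) *ᵥ v) h
    simp only [mulVec_mulVec, adjugate_mul, smul_mulVec, one_mulVec, mulVec_zero] at this
    exact (smul_eq_zero.1 this).resolve_left hdet)
  have hb : bil S x (S *ᵥ x) ≠ 0 := by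
    rw [bil_comm hS]
    exact dot_self_ne hSx
  obtain ⟨z, hzz, hxz⟩ : ∃ z : V3, bil S z z = 0 ∧ bil S x z ≠ 0 := by
    -- The second null vector on the line through `Sx` in the direction of the null vector `x`.
    refine ⟨S *ᵥ x + (-(bil S (S *ᵥ x) (S *ᵥ x)) / (2 * bil S x (S *ᵥ x))) • x, ?_, ?_⟩
    · simp only [bil_add_left, bil_add_right, bil_smul_left, bil_smul_right, hxx]
      rw [bil_comm hS (S *ᵥ x) x]
      field_simp
      ring
    · simpa only [bil_add_right, bil_smul_right, hxx, mul_zero, add_zero] using hb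
  set w := (S *ᵥ x) ⨯₃ (S *ᵥ z) with hw
  have hxw : bil S x w = 0 := by
    rw [bil_comm hS, bil, dotProduct_comm, hw, dot_self_cross]
  have hwz : bil S w z = 0 := by
    rw [bil, dotProduct_comm, hw, dot_cross_self]
  have hcross : x ⨯₃ w = bil S x z • (S *ᵥ x) := by
    have h : x ⨯₃ w = (x ⬝ᵥ (S *ᵥ z)) • (S *ᵥ x) - (x ⬝ᵥ (S *ᵥ x)) • (S *ᵥ z) := by
      rw [hw]
      generalize S *ᵥ x = u
      generalize S *ᵥ z = v
      ext i
      fin_cases i <;> simp [cross_apply, dotProduct, Fin.sum_univ_three] <;> ring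
    rw [h]
    change bil S x z • _ - bil S x x • _ = _
    rw [hxx, zero_smul, sub_zero]
  have hww : bil S w w ≠ 0 := by
    intro h0
    have h := bil_adjugate_cross hS x w
    rw [hcross, hxx, hxw, bil_smul_left, bil_smul_right, bil_adjugate_mulVec hS, hxx] at h
    have hd := det_gram hS x w z
    rw [hxx, hxw, hwz, h0, hzz] at hd
    have hne : (of ![x, w, z]).det ≠ 0 := by
      have h3 : (of ![x, w, z]).det = z ⬝ᵥ (x ⨯₃ w) := by
        rw [det_fin_three]
        simp [cross_apply, dotProduct, Fin.sum_univ_three]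
        ring
      rw [h3, hcross, dotProduct_smul, smul_eq_mul]
      change _ * bil S z x ≠ 0
      rw [bil_comm hS z x]
      exact mul_ne_zero hxz hxz
    have : S.det * (of ![x, w, z]).det ^ 2 = 0 := by rw [hd]; ring
    exact mul_ne_zero hdet (pow_ne_zero 2 hne) this
  -- Rescaling `z` to achieve `2 S(x, z) + S(w, w) = 0` makes the whole conic `x + t w + t² z` null.
  refine ⟨w, (-(bil S w w) / (2 * bil S x z)) • z, hxw, ?_, ?_, hww, ?_, (bil S x z)⁻¹, ?_⟩
  · rw [bil_smul_right, hwz, mul_zero]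
  · rw [bil_smul_right, bil_smul_left, hzz, mul_zero, mul_zero]
  · rw [bil_smul_right]
    field_simp
    ring
  · rw [hcross, smul_smul, inv_mul_cancel₀ hxz, one_smul]

/-- The null conic `x + t w + t² z` of an adapted frame is a characteristic family, and at `t = 0`
its generatrix `x × w` is proportional to `Sx`. -/
theorem mulVec_mem_dualCone {S : Mat3} (hS : S.IsSymm) (hdet : S.det ≠ 0) {x : V3} (hx : x ≠ 0)
    (hxx : bil S x x = 0) : S *ᵥ x ∈ dualCone S := by
  obtain ⟨w, z, hxw, hwz, hzz, hww, hxz, r, hr⟩ := exists_null_frame hS hdet hx hxx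
  have hxz' : bil S x z ≠ 0 := fun h => hww (by rw [h] at hxz; linarith)
  have hwx : bil S w x = 0 := by rw [bil_comm hS, hxw]
  have hzw : bil S z w = 0 := by rw [bil_comm hS, hwz]
  have hzx : bil S z x = bil S x z := bil_comm hS _ _
  have hder : ∀ t : ℝ, HasDerivAt (fun t : ℝ => x + t • w + t ^ 2 • z) (w + (2 * t) • z) t :=
    fun t => by
      have := (((hasDerivAt_id t).smul_const w).const_add x).add
        (((hasDerivAt_id t).pow 2).smul_const z)
      exact this.congr_deriv (by simp)
  have hder' : ∀ t : ℝ, deriv (fun t : ℝ => x + t • w + t ^ 2 • z) t = w + (2 * t) • z :=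
    fun t => (hder t).deriv
  have hli : ∀ t : ℝ, LinearIndependent ℝ ![x + t • w + t ^ 2 • z, w + (2 * t) • z] := by
    intro t
    rw [LinearIndependent.pair_iff]
    intro a b hab
    have h1 := congrArg (bil S x) hab
    have h2 := congrArg (bil S w) hab
    have h3 := congrArg (bil S z) hab
    have h0 : ∀ v, bil S v 0 = 0 := fun v => by simp [bil]
    simp only [bil_add_right, bil_smul_right, hxx, hxw, hwx, hwz, hzw, hzz, hzx, h0] at h1 h2 h3
    have ha : a = 0 := by
      have : a * bil S x z = 0 := by linarith
      exact (mul_eq_zero.1 this).resolve_right hxz'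
    subst ha
    have : b * bil S w w = 0 := by linarith
    exact ⟨rfl, (mul_eq_zero.1 this).resolve_right hww⟩
  refine ⟨fun t => x + t • w + t ^ 2 • z, ⟨by fun_prop, fun t => ⟨?_, ?_, ?_⟩⟩, 0, r, ?_⟩
  · exact ne_zero_of_linearIndependent (hli t)
  · rw [quadForm_eq]
    simp only [bil_add_left, bil_add_right, bil_smul_left, bil_smul_right, hxx, hxw, hwx, hwz, hzw,
      hzz, hzx]
    linear_combination t ^ 2 * hxz
  · rw [hder']
    exact hli t
  · rw [hder', hr]
    simp

/-- Duality of nondegenerate conics: writing `ξ = Sx`, one has `adj S (ξ, ξ) = det S · S(x, x)`, so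
`x` is null. -/
theorem mem_dualCone_of_det_ne_zero {S : Mat3} (hS : S.IsSymm) (hdet : S.det ≠ 0) {ξ : V3}
    (hξ : ξ ≠ 0) (h : bil (adjugate S) ξ ξ = 0) : ξ ∈ dualCone S := by
  have hx : S *ᵥ ((S.det)⁻¹ • (adjugate S *ᵥ ξ)) = ξ := by
    rw [mulVec_smul, mulVec_mulVec, mul_adjugate, smul_mulVec, one_mulVec, smul_smul,
      inv_mul_cancel₀ hdet, one_smul]
  set x := (S.det)⁻¹ • (adjugate S *ᵥ ξ)
  rw [← hx] at h ⊢
  rw [bil_adjugate_mulVec hS] at h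
  refine mulVec_mem_dualCone hS hdet ?_ ((mul_eq_zero.1 h).resolve_left hdet)
  intro h0
  rw [h0, mulVec_zero] at hx
  exact hξ hx.symm

/-! ### The contact cone and the cocharacteristic variety in coordinates `(x, p)`. -/

/-- The coordinates `(x, p)` on the contact plane at `θ`. -/
def lift (θ : J1) : V3 × V3 →ₗ[ℝ] J1 where
  toFun v := (v.1, θ.2.2 ⬝ᵥ v.1, v.2)
  map_add' v w := by simp
  map_smul' c v := by simp

theorem lift_injective (θ : J1) : Function.Injective (lift θ) := by
  intro v w h
  have h1 : (lift θ v).1 = (lift θ w).1 := by rw [h]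
  have h2 : (lift θ v).2.2 = (lift θ w).2.2 := by rw [h]
  exact Prod.ext h1 h2

theorem mem_contactPlane_iff {θ v : J1} : v ∈ contactPlane θ ↔ v = lift θ (v.1, v.2.2) := by
  rw [contactPlane, LinearMap.mem_ker]
  change v.2.1 - θ.2.2 ⬝ᵥ v.1 = 0 ↔ v = (v.1, θ.2.2 ⬝ᵥ v.1, v.2.2)
  rw [sub_eq_zero]
  constructor
  · intro h
    exact Prod.ext rfl (Prod.ext h rfl)
  · intro h
    rw [h]

theorem lift_mem (θ : J1) (v : V3 × V3) : lift θ v ∈ contactPlane θ := by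
  rw [mem_contactPlane_iff]
  rfl

/-- The embedding of the integral element with Hessian `U`. -/
def incl (θ : J1) (U : Mat3) (x : V3) : J1 := lift θ (x, U *ᵥ x)

theorem continuous_incl (θ : J1) (U : Mat3) : Continuous (incl θ U) := by
  have h : Continuous (lift θ) := (lift θ).continuous_of_finiteDimensional
  unfold incl
  fun_prop

theorem sum_totalDeriv (θ : J1) {U : Mat3} (hU : U.IsSymm) (x : V3) :
    ∑ i, x i • totalDeriv θ U i = incl θ U x := by
  simp only [Fin.sum_univ_three, totalDeriv, incl, lift, LinearMap.coe_mk, AddHom.coe_mk]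
  refine Prod.ext ?_ (Prod.ext ?_ ?_)
  · ext i
    fin_cases i <;> simp
  · simp [dotProduct, Fin.sum_univ_three]
    ring
  · ext i
    simp [mulVec, dotProduct, Fin.sum_univ_three, hU.apply i]
    ring

theorem mem_hyperplaneOf {θ : J1} {U : Mat3} (hU : U.IsSymm) {η : V3} {v : J1} :
    v ∈ hyperplaneOf θ U η ↔ v = incl θ U v.1 ∧ v.1 ⬝ᵥ η = 0 := by
  constructor
  · rintro ⟨x, hx, h⟩
    rw [sum_totalDeriv θ hU] at h
    subst h
    exact ⟨rfl, hx⟩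
  · rintro ⟨h1, h2⟩
    exact ⟨v.1, h2, by rw [sum_totalDeriv θ hU]; exact h1⟩

/-- A vector of both hyperplanes annihilates `η(t)` and the difference quotient of `η`, so a limit
annihilates `η(t)` and `η'`. Conversely, the cross product of `η(t)` with the difference quotient is
an explicit approximating family. -/
theorem mem_generatrix_iff {θ : J1} {U : Mat3} (hU : U.IsSymm) {η : ℝ → V3} {t : ℝ} {η' : V3}
    (hη : HasDerivAt η η' t) (hli : LinearIndependent ℝ ![η t, η']) {v : J1} :
    v ∈ generatrix θ U η t ↔ ∃ r : ℝ, v = incl θ U (r • (η t ⨯₃ η')) := by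
  have hslope : Tendsto (fun ε => ε⁻¹ • (η (t + ε) - η t)) (𝓝[≠] 0) (𝓝 η') :=
    hη.tendsto_slope_zero
  constructor
  · rintro ⟨w, hw, hev⟩
    have hw1 : Tendsto (fun ε => (w ε).1) (𝓝[≠] 0) (𝓝 v.1) :=
      (continuous_fst.tendsto v).comp hw
    have h1 : v = incl θ U v.1 := by
      refine tendsto_nhds_unique hw ?_
      refine (((continuous_incl θ U).tendsto v.1).comp hw1).congr' ?_
      filter_upwards [hev] with ε hε
      exact ((mem_hyperplaneOf hU).1 hε.1).1.symm
    have h2 : v.1 ⬝ᵥ η t = 0 := by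
      have hc : Continuous fun x : V3 => x ⬝ᵥ η t := by fun_prop
      refine tendsto_nhds_unique ((hc.tendsto v.1).comp hw1) ?_
      refine tendsto_const_nhds.congr' ?_
      filter_upwards [hev] with ε hε
      exact ((mem_hyperplaneOf hU).1 hε.1).2.symm
    have h3 : v.1 ⬝ᵥ η' = 0 := by
      have hc : Continuous fun x : V3 × V3 => x.1 ⬝ᵥ x.2 := by fun_prop
      refine tendsto_nhds_unique ((hc.tendsto (v.1, η')).comp (hw1.prodMk_nhds hslope)) ?_
      refine tendsto_const_nhds.congr' ?_
      filter_upwards [hev] with ε hε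
      have e1 := ((mem_hyperplaneOf hU).1 hε.1).2
      have e2 := ((mem_hyperplaneOf hU).1 hε.2).2
      simp [dotProduct_sub, e1, e2]
    obtain ⟨r, hr⟩ := eq_smul_cross hli h2 h3
    exact ⟨r, by rw [← hr]; exact h1⟩
  · rintro ⟨r, rfl⟩
    refine ⟨fun ε => incl θ U (r • (η t ⨯₃ (ε⁻¹ • (η (t + ε) - η t)))), ?_, ?_⟩
    · have hc : Continuous fun x : V3 => incl θ U (r • (η t ⨯₃ x)) := by
        have : Continuous fun x : V3 => η t ⨯₃ x :=
          (crossProduct (η t)).continuous_of_finiteDimensional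
        exact (continuous_incl θ U).comp (this.const_smul r)
      exact (hc.tendsto η').comp hslope
    · refine Eventually.of_forall fun ε => ⟨?_, ?_⟩
      · rw [mem_hyperplaneOf hU]
        refine ⟨rfl, ?_⟩
        change (r • (η t ⨯₃ (ε⁻¹ • (η (t + ε) - η t)))) ⬝ᵥ η t = 0
        rw [smul_dotProduct, dotProduct_comm, dot_self_cross, smul_zero]
      · rw [mem_hyperplaneOf hU]
        refine ⟨rfl, ?_⟩
        change (r • (η t ⨯₃ (ε⁻¹ • (η (t + ε) - η t)))) ⬝ᵥ η (t + ε) = 0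
        simp [dotProduct_comm _ (η (t + ε)), cross_self]

theorem coneAt_eq {F : J1 → Mat3 → ℝ} {θ : J1} {U : Mat3} (hU : U.IsSymm) :
    coneAt F θ U = incl θ U '' dualCone (symbolMatrix F θ U) := by
  ext v
  constructor
  · rintro ⟨η, hη, t, hv⟩
    rw [mem_generatrix_iff hU (hη.hasDerivAt t) (hη.2 t).2.2] at hv
    obtain ⟨r, rfl⟩ := hv
    exact ⟨_, ⟨η, hη, t, r, rfl⟩, rfl⟩
  · rintro ⟨x, ⟨η, hη, t, r, rfl⟩, rfl⟩
    refine ⟨η, hη, t, ?_⟩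
    rw [mem_generatrix_iff hU (hη.hasDerivAt t) (hη.2 t).2.2]
    exact ⟨r, rfl⟩

/-- The union of the cones of a Monge-Ampère equation at its regular points. -/
def MAData.cone (M : MAData) : Set (V3 × V3) :=
  {v | ∃ U : Mat3, U.IsSymm ∧ M.F U = 0 ∧ M.S U ≠ 0 ∧ v.1 ∈ dualCone (M.S U) ∧ v.2 = U *ᵥ v.1}

theorem isClosedEmbedding_lift (θ : J1) : IsClosedEmbedding (lift θ) :=
  LinearMap.isClosedEmbedding_of_injective (LinearMap.ker_eq_bot.2 (lift_injective θ))

theorem contactCone_eq (E : MongeAmpere) (θ : J1) :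
    contactCone E.F θ = lift θ '' closure (E.data θ).cone := by
  rw [contactCone, ← (isClosedEmbedding_lift θ).closure_image_eq]
  congr 1
  ext v
  simp only [mem_iUnion, mem_ofPred_eq, fiber, mem_image, MAData.cone]
  constructor
  · rintro ⟨U, ⟨⟨hU, hF⟩, hS⟩, hv⟩
    rw [coneAt_eq hU, E.symbol_eq θ hU] at hv
    rw [E.symbol_eq θ hU] at hS
    rw [E.F_eq θ hU] at hF
    obtain ⟨x, hx, rfl⟩ := hv
    exact ⟨(x, U *ᵥ x), ⟨U, hU, hF, hS, hx, rfl⟩, rfl⟩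
  · rintro ⟨⟨x, p⟩, ⟨U, hU, hF, hS, hx, hp⟩, rfl⟩
    change p = U *ᵥ x at hp
    subst hp
    refine ⟨U, ⟨⟨hU, ?_⟩, ?_⟩, ?_⟩
    · rwa [E.F_eq θ hU]
    · rwa [E.symbol_eq θ hU]
    · rw [coneAt_eq hU, E.symbol_eq θ hU]
      exact ⟨x, hx, rfl⟩

theorem cochar_eq (E : MongeAmpere) (θ : J1) :
    E.cochar θ = lift θ '' {v | (E.data θ).kap v.1 v.2 = 0} := by
  ext v
  simp only [MongeAmpere.cochar, mem_ofPred_eq, mem_image, E.klr_eq]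
  constructor
  · rintro ⟨h1, h2⟩
    rw [mem_contactPlane_iff] at h1
    exact ⟨(v.1, v.2.2), by simpa using h2, h1.symm⟩
  · rintro ⟨w, hw, rfl⟩
    refine ⟨lift_mem θ w, ?_⟩
    change -4 * (E.data θ).kap w.1 w.2 = 0
    rw [hw, mul_zero]

theorem MAData.kap_of_cone {M : MAData} (hb : M.b.IsSymm) (hc : M.c.IsSymm) {v : V3 × V3}
    (hv : v ∈ M.cone) : M.kap v.1 v.2 = 0 := by
  obtain ⟨U, hU, hF, -, hx, hp⟩ := hv
  -- After translation to `U` the vector becomes `(x, 0)` and `d = 0`, so only `adj (S U) (x, x)` is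
  -- left.
  have h := M.kap_shift hb hc hU v.1 0
  rw [zero_add, ← hp] at h
  rw [← h]
  have h2 := bil_adjugate_of_mem_dualCone (M.S_isSymm hb hc hU) hx
  rw [kap, shift]
  simp only [h2, hF]
  simp [bil]

theorem MAData.continuous_kap (M : MAData) : Continuous fun v : V3 × V3 => M.kap v.1 v.2 := by
  unfold kap bil
  fun_prop

theorem MAData.closure_cone_subset {M : MAData} (hb : M.b.IsSymm) (hc : M.c.IsSymm) :
    closure M.cone ⊆ {v | M.kap v.1 v.2 = 0} :=
  closure_minimal (fun _ hv => M.kap_of_cone hb hc hv)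
    (isClosed_eq M.continuous_kap continuous_const)

/-! ### Nondegenerate symbol: the cone is dense in the quadric. -/

namespace MAData

/-- The polar form of `kap`. -/
def kapB (M : MAData) (v w : V3 × V3) : ℝ :=
  2 * bil (adjugate M.c) v.1 w.1 - 2 * M.d * bil M.b v.1 w.1
    - 2 * (v.2 ⬝ᵥ (M.c *ᵥ (M.b *ᵥ w.1)) + w.2 ⬝ᵥ (M.c *ᵥ (M.b *ᵥ v.1)))
    + (trace (M.c * M.b) - M.a * M.d) * (v.2 ⬝ᵥ w.1 + w.2 ⬝ᵥ v.1)
    + 2 * bil (adjugate M.b) v.2 w.2 - 2 * M.a * bil M.c v.2 w.2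

def kapQ (M : MAData) (v : V3 × V3) : ℝ := M.kap v.1 v.2

theorem kapQ_add (M : MAData) (hb : M.b.IsSymm) (hc : M.c.IsSymm) (v w : V3 × V3) :
    M.kapQ (v + w) = M.kapQ v + M.kapQ w + M.kapB v w := by
  simp only [kapQ, kap, kapB, Prod.fst_add, Prod.snd_add, bil_add_left, bil_add_right, mulVec_add,
    dotProduct_add, add_dotProduct]
  rw [bil_comm hb w.1 v.1, bil_comm hc w.2 v.2, bil_comm hc.adjugate w.1 v.1,
    bil_comm hb.adjugate w.2 v.2]
  ring

theorem kapQ_smul (M : MAData) (r : ℝ) (v : V3 × V3) : M.kapQ (r • v) = r ^ 2 * M.kapQ v := by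
  simp only [kapQ, kap, Prod.smul_fst, Prod.smul_snd, bil_smul_left, bil_smul_right, mulVec_smul,
    dotProduct_smul, smul_dotProduct, smul_eq_mul]
  ring

theorem kapB_add_left (M : MAData) (u v w : V3 × V3) :
    M.kapB (u + v) w = M.kapB u w + M.kapB v w := by
  simp only [kapB, Prod.fst_add, Prod.snd_add, bil_add_left, mulVec_add,
    dotProduct_add, add_dotProduct]
  ring

theorem kapB_smul_left (M : MAData) (r : ℝ) (v w : V3 × V3) :
    M.kapB (r • v) w = r * M.kapB v w := by
  simp only [kapB, Prod.smul_fst, Prod.smul_snd, bil_smul_left, mulVec_smul,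
    dotProduct_smul, smul_dotProduct, smul_eq_mul]
  ring

theorem kapB_comm (M : MAData) (hb : M.b.IsSymm) (hc : M.c.IsSymm) (v w : V3 × V3) :
    M.kapB v w = M.kapB w v := by
  have h1 := M.kapQ_add hb hc v w
  have h2 := M.kapQ_add hb hc w v
  rw [add_comm w v] at h2
  linarith

theorem kapB_smul_right (M : MAData) (hb : M.b.IsSymm) (hc : M.c.IsSymm) (r : ℝ)
    (v w : V3 × V3) : M.kapB v (r • w) = r * M.kapB v w := by
  rw [M.kapB_comm hb hc, kapB_smul_left, M.kapB_comm hb hc]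

theorem kapB_self (M : MAData) (v : V3 × V3) : M.kapB v v = 2 * M.kapQ v := by
  simp only [kapB, kapQ, kap]
  ring

/-- Two zeros of the form `kap` are joined by a conic of zeros. -/
theorem exists_conic {M : MAData} (hb : M.b.IsSymm) (hc : M.c.IsSymm) {v v₀ y : V3 × V3}
    (hv : M.kapQ v = 0) (hv₀ : M.kapQ v₀ = 0) (hy : M.kapQ y ≠ 0) (hyv : M.kapB y v₀ = 0) :
    ∃ (z : V3 × V3) (r : ℝ), r ≠ 0 ∧
      ∀ t : ℝ, M.kapQ ((1 - t) ^ 2 • v + (t * (1 - t)) • z + (t ^ 2 * r) • v₀) = 0 := by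
  by_cases h : M.kapB v v₀ = 0
  · refine ⟨0, 1, one_ne_zero, fun t => ?_⟩
    rw [smul_zero, add_zero, M.kapQ_add hb hc, kapQ_smul, kapQ_smul, hv, hv₀, kapB_smul_left,
      M.kapB_smul_right hb hc, h]
    ring
  · set s := M.kapB y v / M.kapB v v₀ with hs
    set z := y + (-s) • v₀ with hz
    have hzv : M.kapB z v = 0 := by
      rw [hz, kapB_add_left, kapB_smul_left, M.kapB_comm hb hc v₀, hs]
      field_simp
      ring
    have hzv₀ : M.kapB z v₀ = 0 := by
      rw [hz, kapB_add_left, kapB_smul_left, hyv, kapB_self, hv₀]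
      ring
    have hzz : M.kapQ z = M.kapQ y := by
      rw [hz, M.kapQ_add hb hc, kapQ_smul, M.kapB_smul_right hb hc, hyv, hv₀]
      ring
    refine ⟨z, -(M.kapQ y) / M.kapB v v₀, div_ne_zero (neg_ne_zero.2 hy) h, fun t => ?_⟩
    rw [M.kapQ_add hb hc, M.kapQ_add hb hc, kapQ_smul, kapQ_smul, kapQ_smul, hv, hv₀, hzz,
      kapB_add_left, kapB_smul_left, kapB_smul_left, kapB_smul_left, M.kapB_smul_right hb hc,
      M.kapB_smul_right hb hc, M.kapB_smul_right hb hc, M.kapB_comm hb hc v z, hzv, hzv₀]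
    field_simp
    ring

/-- The symbol, homogenized. -/
def Shom (M : MAData) (l : ℝ) (X : Mat3) : Mat3 :=
  M.a • adjugate X + l • cross M.b X + l ^ 2 • M.c

/-- The left-hand side of the equation, homogenized. -/
def Fhom (M : MAData) (l : ℝ) (X : Mat3) : ℝ :=
  M.a * X.det + l * trace (M.b * adjugate X) + l ^ 2 * trace (M.c * X) + l ^ 3 * M.d

/-- Homogenizing clears denominators: the conditions on an interpolating matrix become polynomial in
`(x, p)`, hence analytic along curves, even where `x = 0`. -/
theorem Shom_smul (M : MAData) (l : ℝ) (X : Mat3) : M.Shom l (l • X) = l ^ 2 • M.S X := by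
  ext i j
  fin_cases i <;> fin_cases j <;>
  simp [Shom, S, cross, adjugate_fin_three] <;>
  ring

theorem Fhom_smul (M : MAData) (l : ℝ) (X : Mat3) : M.Fhom l (l • X) = l ^ 3 * M.F X := by
  simp only [Fhom, F, det_smul, adjugate_smul, Matrix.mul_smul, trace_smul, Fintype.card_fin,
    smul_eq_mul, Nat.add_one_sub_one]
  ring

/-- The adjugate and the determinant of a rank one matrix vanish, so a Monge-Ampère equation is
affine along rank one directions, with the symbol as slope. -/
theorem F_add_vecMulVec (M : MAData) (U : Mat3) (r : ℝ) (m : V3) :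
    M.F (U + r • vecMulVec m m) = M.F U + r * bil (M.S U) m m := by
  rw [← F_shift]
  simp only [F, shift, bil, det_fin_three, adjugate_fin_three, trace_fin_three,
    Matrix.mul_apply, Fin.sum_univ_three, Matrix.smul_apply, vecMulVec_apply,
    of_apply, cons_val', cons_val_zero, cons_val_one, cons_val, smul_eq_mul, dotProduct, mulVec]
  ring

end MAData

/-- The numerator, over `(x ⬝ᵥ x) ^ 2`, of a symmetric matrix that maps `x` to `p`. -/
def interpNum (x p : V3) : Mat3 :=
  (x ⬝ᵥ x) • (vecMulVec p x + vecMulVec x p) - (p ⬝ᵥ x) • vecMulVec x x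

theorem interpNum_isSymm (x p : V3) : (interpNum x p).IsSymm := by
  ext i j
  simp [interpNum, vecMulVec_apply]
  ring

theorem interpNum_mulVec (x p : V3) : interpNum x p *ᵥ x = (x ⬝ᵥ x) ^ 2 • p := by
  simp only [interpNum, sub_mulVec, add_mulVec, smul_mulVec, vecMulVec_mulVec]
  ext i
  simp [dotProduct_comm p x]
  ring

theorem vecMulVec_self_isSymm (m : V3) : (vecMulVec m m).IsSymm := by
  ext i j
  simp [vecMulVec_apply]
  ring

theorem bil_smul_mat (r : ℝ) (S : Mat3) (x y : V3) : bil (r • S) x y = r * bil S x y := by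
  simp [bil, smul_mulVec]

namespace MAData

/-- The coefficient of the rank one correction `m mᵀ`, `m = x × n`. -/
def corrCoeff (M : MAData) (n : V3) (v : V3 × V3) : ℝ :=
  bil (M.Shom ((v.1 ⬝ᵥ v.1) ^ 2) (interpNum v.1 v.2)) (v.1 ⨯₃ n) (v.1 ⨯₃ n)

/-- The numerator, over `corrCoeff * (x ⬝ᵥ x) ^ 2`, of a point of the equation that maps `x`
to `p`. -/
def pointNum (M : MAData) (n : V3) (v : V3 × V3) : Mat3 :=
  M.corrCoeff n v • interpNum v.1 v.2
    - M.Fhom ((v.1 ⬝ᵥ v.1) ^ 2) (interpNum v.1 v.2) • vecMulVec (v.1 ⨯₃ n) (v.1 ⨯₃ n)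

/-- If this does not vanish at a zero `v` of `kap`, then `v` is in the cone. -/
def genericity (M : MAData) (n : V3) (v : V3 × V3) : ℝ :=
  (v.1 ⬝ᵥ v.1) * M.corrCoeff n v *
    (M.Shom (M.corrCoeff n v * (v.1 ⬝ᵥ v.1) ^ 2) (M.pointNum n v)).det

/-- Take a symmetric `X` with `Xx = p` and solve `F(X + r m mᵀ) = 0` for `r`, an affine equation;
since `m ⊥ x`, the sum still maps `x` to `p`. At the resulting point the symbol is nondegenerate and
`kap = 0` says that `x` is null for its adjugate. -/
theorem mem_cone_of_genericity {M : MAData} (hb : M.b.IsSymm) (hc : M.c.IsSymm) {n : V3}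
    {v : V3 × V3} (hv : M.kapQ v = 0) (hg : M.genericity n v ≠ 0) : v ∈ M.cone := by
  obtain ⟨x, p⟩ := v
  rw [genericity, mul_ne_zero_iff, mul_ne_zero_iff] at hg
  obtain ⟨⟨hN, hk⟩, hdet⟩ := hg
  set k := M.corrCoeff n (x, p) with hkd
  dsimp only at hN hdet
  set l := (x ⬝ᵥ x) ^ 2 with hl
  have hl0 : l ≠ 0 := pow_ne_zero 2 hN
  set m := x ⨯₃ n with hm
  have hmx : m ⬝ᵥ x = 0 := by rw [dotProduct_comm, hm, dot_self_cross]
  set X := l⁻¹ • interpNum x p with hX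
  have hXl : interpNum x p = l • X := by rw [hX, smul_smul, mul_inv_cancel₀ hl0, one_smul]
  have hXs : X.IsSymm := (interpNum_isSymm x p).smul _
  have hXx : X *ᵥ x = p := by
    rw [hX, smul_mulVec, interpNum_mulVec, ← hl, smul_smul, inv_mul_cancel₀ hl0, one_smul]
  have hk1 : k = l ^ 2 * bil (M.S X) m m := by
    rw [hkd, corrCoeff]
    dsimp only
    rw [← hl, ← hm, hXl, Shom_smul, bil_smul_mat]
  have hB : bil (M.S X) m m ≠ 0 := by
    intro h0
    rw [h0, mul_zero] at hk1
    exact hk hk1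
  set U := X + (-(M.F X) / bil (M.S X) m m) • vecMulVec m m with hU
  have hUs : U.IsSymm := hXs.add ((vecMulVec_self_isSymm m).smul _)
  have hUx : U *ᵥ x = p := by
    rw [hU, add_mulVec, hXx, smul_mulVec, vecMulVec_mulVec, hmx]
    simp
  have hFU : M.F U = 0 := by
    rw [hU, F_add_vecMulVec]
    field_simp
    ring
  have hP : M.pointNum n (x, p) = (k * l) • U := by
    rw [pointNum]
    dsimp only
    rw [← hkd, ← hl, ← hm, hXl, Fhom_smul, hU, smul_add, sub_eq_add_neg, ← neg_smul]
    simp only [smul_smul]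
    congr 2
    rw [hk1]
    field_simp
  have hdetU : (M.S U).det ≠ 0 := by
    intro h0
    apply hdet
    rw [hP, Shom_smul, det_smul, h0, mul_zero]
  have hx : x ≠ 0 := by
    rintro rfl
    simp at hN
  have hS := M.S_isSymm hb hc hUs
  refine ⟨U, hUs, hFU, fun h => hdetU (by rw [h]; simp), ?_, hUx.symm⟩
  refine mem_dualCone_of_det_ne_zero hS hdetU hx ?_
  have h := M.kap_shift hb hc hUs x 0
  rw [zero_add, hUx] at h
  change M.kap x p = 0 at hv
  rw [hv, kap, shift] at h
  simp only [hFU] at h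
  simpa [bil] using h

section Analytic

variable {l : ℝ → ℝ} {X : ℝ → Mat3} {x y : ℝ → V3}

theorem contDiff_det (hX : ∀ i j, ContDiff ℝ ω fun t => X t i j) :
    ContDiff ℝ ω fun t => (X t).det := by
  simp only [det_fin_three]
  fun_prop

theorem contDiff_Shom (M : MAData) (hl : ContDiff ℝ ω l)
    (hX : ∀ i j, ContDiff ℝ ω fun t => X t i j) (i j : Fin 3) :
    ContDiff ℝ ω fun t => M.Shom (l t) (X t) i j := by
  simp only [Shom, cross, Matrix.add_apply, Matrix.sub_apply, Matrix.smul_apply, smul_eq_mul]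
  have ha : ∀ {Y : ℝ → Mat3} (_ : ∀ i j, ContDiff ℝ ω fun t => Y t i j),
      ContDiff ℝ ω fun t => adjugate (Y t) i j := by
    intro Y hY
    simp only [adjugate_fin_three]
    fin_cases i <;> fin_cases j <;> simp <;> fun_prop
  have h1 := ha hX
  have h2 := ha (Y := fun t => M.b + X t) (by simp only [Matrix.add_apply]; fun_prop)
  fun_prop

theorem contDiff_Fhom (M : MAData) (hl : ContDiff ℝ ω l)
    (hX : ∀ i j, ContDiff ℝ ω fun t => X t i j) :
    ContDiff ℝ ω fun t => M.Fhom (l t) (X t) := by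
  simp only [Fhom, det_fin_three, adjugate_fin_three, trace_fin_three,
    Matrix.mul_apply, Fin.sum_univ_three, of_apply, cons_val', cons_val_zero, cons_val_one,
    cons_val]
  fun_prop

theorem contDiff_bil (hX : ∀ i j, ContDiff ℝ ω fun t => X t i j) (hx : ContDiff ℝ ω x)
    (hy : ContDiff ℝ ω y) : ContDiff ℝ ω fun t => bil (X t) (x t) (y t) := by
  rw [contDiff_pi] at hx hy
  simp only [bil, dotProduct, mulVec, Fin.sum_univ_three]
  fun_prop

theorem contDiff_dot (hx : ContDiff ℝ ω x) (hy : ContDiff ℝ ω y) :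
    ContDiff ℝ ω fun t => x t ⬝ᵥ y t := by
  rw [contDiff_pi] at hx hy
  simp only [dotProduct, Fin.sum_univ_three]
  fun_prop

theorem contDiff_genericity (M : MAData) (n : V3) {v : ℝ → V3 × V3} (hv : ContDiff ℝ ω v) :
    ContDiff ℝ ω fun t => M.genericity n (v t) := by
  have h1 : ContDiff ℝ ω fun t => (v t).1 := hv.fst
  have h2 : ContDiff ℝ ω fun t => (v t).2 := hv.snd
  have hm : ContDiff ℝ ω fun t => (v t).1 ⨯₃ n :=
    ((crossProduct.flip n).toContinuousLinearMap.contDiff (n := ω)).comp h1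
  have hN := contDiff_dot h1 h1
  have hl : ContDiff ℝ ω fun t => ((v t).1 ⬝ᵥ (v t).1) ^ 2 := hN.pow 2
  have hd := contDiff_dot h2 h1
  have hX : ∀ i j, ContDiff ℝ ω fun t => interpNum (v t).1 (v t).2 i j := by
    intro i j
    have e1 := contDiff_pi.1 h1
    have e2 := contDiff_pi.1 h2
    simp only [interpNum, Matrix.add_apply, Matrix.sub_apply, Matrix.smul_apply, smul_eq_mul,
      vecMulVec_apply]
    fun_prop
  have hk : ContDiff ℝ ω fun t => M.corrCoeff n (v t) :=
    contDiff_bil (M.contDiff_Shom hl hX) hm hm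
  have hF := M.contDiff_Fhom hl hX
  have hP : ∀ i j, ContDiff ℝ ω fun t => M.pointNum n (v t) i j := by
    intro i j
    have e := contDiff_pi.1 hm
    have e' := hX i j
    simp only [pointNum, Matrix.sub_apply, Matrix.smul_apply, smul_eq_mul,
      vecMulVec_apply]
    fun_prop
  have hD := contDiff_det (M.contDiff_Shom (hk.mul hl) hP)
  exact (hN.mul hk).mul hD

end Analytic

end MAData

theorem eventually_ne_zero_of_contDiff {f : ℝ → ℝ} (hf : ContDiff ℝ ω f) {s : ℝ} (hs : f s ≠ 0)
    (t : ℝ) : ∀ᶠ u in 𝓝[≠] t, f u ≠ 0 := by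
  by_contra h
  have hf' : AnalyticOnNhd ℝ f univ := contDiff_omega_iff_analyticOnNhd.1 hf
  have h0 : f = fun _ => 0 :=
    hf'.eq_of_frequently_eq (z₀ := t) (fun _ _ => analyticAt_const) h
  exact hs (congrFun h0 s)

namespace MAData

/-- The zero matrix is a point of the equation with nondegenerate symbol `c`, so `(cη, 0)` is a
generic zero. A conic in the quadric joins `v` to a multiple of it, and analyticity makes the points
of the conic near `v` generic. -/
theorem kap_zeros_subset_closure_cone {M : MAData} (hb : M.b.IsSymm) (hc : M.c.IsSymm)
    (hd : M.d = 0) (hdet : M.c.det ≠ 0) {η : V3} (hη : η ≠ 0) (hnull : bil M.c η η = 0) :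
    {v | M.kapQ v = 0} ⊆ closure M.cone := by
  intro v hv
  obtain ⟨w, z, hηw, hwz, hzz, hww, hηz, s, hs⟩ := exists_null_frame hc hdet hη hnull
  set x := M.c *ᵥ η with hx
  have hxw : x ⬝ᵥ w = 0 := by
    rw [dotProduct_comm]
    change bil M.c w η = 0
    rw [bil_comm hc, hηw]
  have hx0 : x ≠ 0 := fun h => hη (by
    have := congrArg (fun v => (adjugate M.c) *ᵥ v) h
    simp only [hx, mulVec_mulVec, adjugate_mul, smul_mulVec, one_mulVec, mulVec_zero] at this
    exact (smul_eq_zero.1 this).resolve_left hdet)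
  have hxx := dot_self_ne hx0
  have hv₀ : M.kapQ (x, 0) = 0 := by
    simp only [kapQ, kap, hd]
    rw [hx, bil_adjugate_mulVec hc, hnull]
    simp [bil]
  have hy : M.kapQ (M.c *ᵥ w, 0) ≠ 0 := by
    simp only [kapQ, kap, hd]
    rw [bil_adjugate_mulVec hc]
    simpa [bil] using ⟨hdet, hww⟩
  have hyv : M.kapB (M.c *ᵥ w, 0) (x, 0) = 0 := by
    simp only [kapB, hd]
    rw [hx, bil_adjugate_mulVec hc, bil_comm hc, hηw]
    simp [bil]
  obtain ⟨z', r, hr, hconic⟩ := exists_conic hb hc hv hv₀ hy hyv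
  set γ : ℝ → V3 × V3 := fun t => (1 - t) ^ 2 • v + (t * (1 - t)) • z' + (t ^ 2 * r) • (x, 0)
    with hγ
  have hsm : ContDiff ℝ ω γ := by fun_prop
  have hγ0 : γ 0 = v := by simp [hγ]
  have hγ1 : γ 1 = (r • x, 0) := by simp [hγ]
  -- At the end `(r x, 0)` both the interpolating matrix and its correction are zero. Since `x ⊥ w`,
  -- the choice `n = x × w` makes the correction vector a nonzero multiple of `w`, where `c(w, w) ≠
  -- 0`.
  have hg1 : M.genericity (x ⨯₃ w) (γ 1) ≠ 0 := by
    have hcross : (r • x) ⨯₃ (x ⨯₃ w) = (-(r * (x ⬝ᵥ x))) • w := by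
      have : x ⨯₃ (x ⨯₃ w) = (x ⬝ᵥ w) • x - (x ⬝ᵥ x) • w := by
        ext i
        fin_cases i <;> simp [cross_apply, dotProduct, Fin.sum_univ_three] <;> ring
      rw [LinearMap.map_smul₂, this, hxw]
      module
    have hI : interpNum (r • x) 0 = 0 := by
      simp [interpNum]
    have hS0 : ∀ l, M.Shom l 0 = l ^ 2 • M.c := fun l => by simp [Shom, cross]
    have hF0 : ∀ l, M.Fhom l 0 = 0 := fun l => by simp [Fhom, hd]
    have hN : (r • x) ⬝ᵥ (r • x) ≠ 0 := dot_self_ne (smul_ne_zero hr hx0)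
    have hk : M.corrCoeff (x ⨯₃ w) (γ 1) ≠ 0 := by
      rw [corrCoeff, hγ1]
      dsimp only
      rw [hI, hS0, hcross, bil_smul_mat, bil_smul_left, bil_smul_right]
      have : r * (x ⬝ᵥ x) ≠ 0 := mul_ne_zero hr hxx
      exact mul_ne_zero (pow_ne_zero _ (pow_ne_zero _ hN)) (mul_ne_zero (neg_ne_zero.2 this)
        (mul_ne_zero (neg_ne_zero.2 this) hww))
    rw [genericity]
    have hP : M.pointNum (x ⨯₃ w) (γ 1) = 0 := by
      rw [pointNum, hγ1]
      dsimp only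
      rw [hI, hF0]
      simp
    rw [hP, hS0, det_smul]
    have hN' : (γ 1).1 ⬝ᵥ (γ 1).1 ≠ 0 := by rw [hγ1]; exact hN
    exact mul_ne_zero (mul_ne_zero hN' hk)
      (mul_ne_zero (pow_ne_zero _ (pow_ne_zero _ (mul_ne_zero hk (pow_ne_zero _ hN')))) hdet)
  have hev := eventually_ne_zero_of_contDiff (M.contDiff_genericity (x ⨯₃ w) hsm) hg1 0
  have ht : Tendsto γ (𝓝[≠] 0) (𝓝 v) := by
    rw [← hγ0]
    exact hsm.continuous.continuousAt.tendsto.mono_left nhdsWithin_le_nhds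
  refine mem_closure_of_tendsto ht ?_
  filter_upwards [hev] with t ht
  exact mem_cone_of_genericity hb hc (hconic t) ht

end MAData

namespace MAData

theorem mem_cone_shift {M : MAData} {U₀ : Mat3} (hU₀ : U₀.IsSymm) {v : V3 × V3}
    (h : v ∈ (M.shift U₀).cone) : (v.1, v.2 + U₀ *ᵥ v.1) ∈ M.cone := by
  obtain ⟨U, hU, hF, hS, hx, hp⟩ := h
  rw [F_shift] at hF
  rw [S_shift] at hS hx
  exact ⟨U₀ + U, hU₀.add hU, hF, hS, hx, by rw [hp, add_mulVec, add_comm]⟩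

theorem closure_cone_of_det_ne_zero {M : MAData} (hb : M.b.IsSymm) (hc : M.c.IsSymm) {U₀ : Mat3}
    (hU₀ : U₀.IsSymm) (hF : M.F U₀ = 0) (hdet : (M.S U₀).det ≠ 0) {η : V3} (hη : η ≠ 0)
    (hnull : bil (M.S U₀) η η = 0) : closure M.cone = {v | M.kapQ v = 0} := by
  refine (closure_cone_subset hb hc).antisymm fun v hv => ?_
  have hsub := kap_zeros_subset_closure_cone (M := M.shift U₀) (M.T_isSymm hb hU₀)
    (M.S_isSymm hb hc hU₀) hF hdet hη hnull
  have hv' : (v.1, v.2 - U₀ *ᵥ v.1) ∈ closure (M.shift U₀).cone := by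
    apply hsub
    change (M.shift U₀).kap _ _ = 0
    rw [M.kap_shift hb hc hU₀, sub_add_cancel]
    exact hv
  have hcont : Continuous fun w : V3 × V3 => (w.1, w.2 + U₀ *ᵥ w.1) := by fun_prop
  have h := image_closure_subset_closure_image hcont (mem_image_of_mem _ hv')
  simp only [sub_add_cancel] at h
  refine closure_mono ?_ h
  rintro _ ⟨w, hw, rfl⟩
  exact mem_cone_shift hU₀ hw

end MAData

theorem exists_null_of_not_isElliptic {S : Mat3} (h : ¬ IsElliptic S) :
    ∃ η : V3, η ≠ 0 ∧ bil S η η = 0 := by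
  rw [IsElliptic, not_or] at h
  obtain ⟨h1, h2⟩ := h
  push Not at h1 h2
  obtain ⟨u, hu, hu'⟩ := h1
  obtain ⟨v, hv, hv'⟩ := h2
  rw [quadForm_eq] at hu' hv'
  by_cases hli : LinearIndependent ℝ ![u, v]
  · have hc : Continuous fun t : ℝ => bil S (u + t • (v - u)) (u + t • (v - u)) := by
      unfold bil
      fun_prop
    have h0 : bil S (u + (0 : ℝ) • (v - u)) (u + (0 : ℝ) • (v - u)) ≤ 0 := by simpa using hu'
    have h1 : 0 ≤ bil S (u + (1 : ℝ) • (v - u)) (u + (1 : ℝ) • (v - u)) := by simpa using hv'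
    obtain ⟨t, -, ht⟩ := intermediate_value_Icc (zero_le_one' ℝ) hc.continuousOn ⟨h0, h1⟩
    refine ⟨_, ?_, ht⟩
    intro h
    rw [LinearIndependent.pair_iff] at hli
    have := hli (1 - t) t (by rw [← h]; module)
    linarith [this.1, this.2]
  · rw [← crossProduct_ne_zero_iff_linearIndependent, not_not] at hli
    have hvu : ∃ r : ℝ, v = r • u := by
      refine ⟨(u ⬝ᵥ v) / (u ⬝ᵥ u), ?_⟩
      have h3 : u ⨯₃ (u ⨯₃ v) = (u ⬝ᵥ v) • u - (u ⬝ᵥ u) • v := by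
        ext i
        fin_cases i <;> simp [cross_apply, dotProduct, Fin.sum_univ_three] <;> ring
      rw [hli, map_zero] at h3
      rw [div_eq_inv_mul, mul_smul, sub_eq_zero.1 h3.symm, smul_smul,
        inv_mul_cancel₀ (dot_self_ne hu), one_smul]
    obtain ⟨r, rfl⟩ := hvu
    refine ⟨u, hu, le_antisymm hu' ?_⟩
    rw [bil_smul_left, bil_smul_right] at hv'
    have hr : r ≠ 0 := by
      rintro rfl
      simp at hv
    have : 0 < r * r := mul_self_pos.2 hr
    nlinarith

theorem contactCone_eq_cochar (E : MongeAmpere) (θ : J1) {U₀ : Mat3} (hU₀ : U₀ ∈ fiber E.F θ)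
    (hne : ¬ IsElliptic (E.symbol θ U₀)) (hdet : (E.symbol θ U₀).det ≠ 0) :
    contactCone E.F θ = E.cochar θ := by
  have hF : (E.data θ).F U₀ = 0 := by rw [← E.F_eq θ hU₀.1]; exact hU₀.2
  rw [MongeAmpere.symbol, E.symbol_eq θ hU₀.1] at hne hdet
  obtain ⟨η, hη, hnull⟩ := exists_null_of_not_isElliptic hne
  rw [contactCone_eq, cochar_eq, MAData.closure_cone_of_det_ne_zero (E.data_b_isSymm θ)
    (E.data_c_isSymm θ) hU₀.1 hF hdet hη hnull]
  rfl

/-! ### Degenerate symbols: factorization and relations on the cone vectors. -/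

theorem mat_eq_zero_of_bil {E : Mat3} (h : ∀ x y, bil E x y = 0) : E = 0 := by
  ext i j
  have := h (Pi.single i 1) (Pi.single j 1)
  simpa [bil] using this

theorem VanishesOnPerp.exists_eq {S : Mat3} (hS : S.IsSymm) {ξ : V3} (hξ : ξ ≠ 0)
    (h : VanishesOnPerp S ξ) : ∃ n : V3, S = vecMulVec ξ n + vecMulVec n ξ := by
  have hN := dot_self_ne hξ
  refine ⟨(ξ ⬝ᵥ ξ)⁻¹ • (S *ᵥ ξ) - (bil S ξ ξ / (2 * (ξ ⬝ᵥ ξ) ^ 2)) • ξ, ?_⟩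
  set n := (ξ ⬝ᵥ ξ)⁻¹ • (S *ᵥ ξ) - (bil S ξ ξ / (2 * (ξ ⬝ᵥ ξ) ^ 2)) • ξ with hn
  rw [← sub_eq_zero]
  have hbil : ∀ x y, bil (S - (vecMulVec ξ n + vecMulVec n ξ)) x y
      = bil S x y - (x ⬝ᵥ ξ) * (n ⬝ᵥ y) - (x ⬝ᵥ n) * (ξ ⬝ᵥ y) := by
    intro x y
    simp [bil, sub_mulVec, add_mulVec, vecMulVec_mulVec]
    ring
  have hnd : ∀ y, n ⬝ᵥ y = (ξ ⬝ᵥ ξ)⁻¹ * bil S y ξ - (bil S ξ ξ / (2 * (ξ ⬝ᵥ ξ) ^ 2)) * (ξ ⬝ᵥ y) := by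
    intro y
    rw [hn, sub_dotProduct, smul_dotProduct, smul_dotProduct, dotProduct_comm (S *ᵥ ξ) y]
    rfl
  apply mat_eq_zero_of_bil
  intro x y
  -- Applying the vanishing to the orthogonal projections along `ξ` expresses `S` through `Sξ`
  -- alone; `n` is read off from this.
  have hx := h (x - ((x ⬝ᵥ ξ) / (ξ ⬝ᵥ ξ)) • ξ) (y - ((y ⬝ᵥ ξ) / (ξ ⬝ᵥ ξ)) • ξ)
    (by rw [sub_dotProduct, smul_dotProduct, smul_eq_mul]; field_simp; ring)
    (by rw [sub_dotProduct, smul_dotProduct, smul_eq_mul]; field_simp; ring)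
  simp only [sub_eq_add_neg, ← neg_smul, bil_add_left, bil_add_right, bil_smul_left,
    bil_smul_right] at hx
  rw [hbil, dotProduct_comm x n, hnd, hnd, dotProduct_comm ξ y, dotProduct_comm ξ x]
  rw [bil_comm hS ξ y] at hx
  rw [← hx]
  field_simp
  ring

namespace MAData

theorem shift_zero (M : MAData) : M.shift 0 = M := by
  ext1
  · rfl
  · simp [shift, T]
  · simp [shift, S, cross]
  · simp [shift, F]

theorem shift_shift_neg (M : MAData) (U : Mat3) : (M.shift U).shift (-U) = M := by
  rw [shift_shift, add_neg_cancel, shift_zero]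

theorem kapB_shift (M : MAData) (hb : M.b.IsSymm) (hc : M.c.IsSymm) {U : Mat3} (hU : U.IsSymm)
    (x q : V3) : (M.shift U).kapB (x, 0) (0, q) = M.kapB (x, U *ᵥ x) (0, q) := by
  have h1 := (M.shift U).kapQ_add (M.T_isSymm hb hU) (M.S_isSymm hb hc hU) (x, 0) (0, q)
  have h2 := M.kapQ_add hb hc (x, U *ᵥ x) (0, q)
  simp only [kapQ, M.kap_shift hb hc hU, Prod.mk_add_mk, add_zero, zero_add, mulVec_zero] at h1 h2
  rw [add_comm (U *ᵥ x) q] at h2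
  linarith

/-- The quadratic term of the equation at a point of its cone, when the form `kap` is degenerate
in the direction of this point. -/
theorem bil_T_eq_zero {M : MAData} (hb : M.b.IsSymm) (hc : M.c.IsSymm) {U : Mat3} (hU : U.IsSymm)
    (hF : M.F U = 0) (hS : M.S U ≠ 0) {ξ n : V3}
    (hSU : M.S U = vecMulVec ξ n + vecMulVec n ξ)
    (hpol : ∀ q, M.kapB (ξ, U *ᵥ ξ) (0, q) = 0) : bil (M.T U) ξ ξ = 0 := by
  have hn : n ≠ 0 := by
    rintro rfl
    simp at hSU
    exact hS hSU
  have hT := M.T_isSymm hb hU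
  -- With `d = 0` and `c = ξ nᵀ + n ξᵀ`, pairing against `q = n` isolates the value of the quadratic
  -- term on `ξ`.
  have key : (M.shift U).kapB (ξ, 0) (0, n) = -2 * (n ⬝ᵥ n) * bil (M.T U) ξ ξ := by
    simp only [kapB, shift, hF, hSU]
    obtain ⟨t0, t1, t2, t3, t4, t5, hT'⟩ := symm_eq hT
    rw [hT']
    simp [bil, dotProduct, mulVec, Fin.sum_univ_three, trace_fin_three, Matrix.mul_apply,
      vecMulVec_apply]
    ring
  rw [M.kapB_shift hb hc hU, hpol] at key
  have hnn := dot_self_ne hn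
  have h2 : (n ⬝ᵥ n) * bil (M.T U) ξ ξ = 0 := by linarith
  exact (mul_eq_zero.1 h2).resolve_left hnn

/-- `U` is a point of the equation at which the symbol is `2 ξ n` and the quadratic term
vanishes on `ξ`. -/
structure IsFlatPoint (M : MAData) (U : Mat3) (ξ n : V3) : Prop where
  hb : M.b.IsSymm
  hU : U.IsSymm
  hF : M.F U = 0
  hS : M.S U = vecMulVec ξ n + vecMulVec n ξ
  hT : bil (M.T U) ξ ξ = 0

section Relations

variable {M : MAData} {U : Mat3} {ξ n : V3}

-- With `p = Uξ`, this and the next two families of relations are quadratic in `(ξ, p)` and no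
-- longer involve `U` separately. Each follows by translating back from `U`: the left side becomes a
-- polynomial in `U` times `T(ξ, ξ)`, here with factor `det U`, then a diagonal cofactor, then a
-- diagonal entry.
set_option maxHeartbeats 2000000 in
theorem IsFlatPoint.rel (h : M.IsFlatPoint U ξ n) :
    bil M.c (U *ᵥ ξ) (U *ᵥ ξ) + M.d * (ξ ⬝ᵥ (U *ᵥ ξ)) = 0 := by
  have hTs := M.T_isSymm h.hb h.hU
  have hT := h.hT
  rw [← M.shift_shift_neg U]
  simp only [shift, h.hF, h.hS]
  obtain ⟨t0, t1, t2, t3, t4, t5, hT'⟩ := symm_eq hTs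
  obtain ⟨u0, u1, u2, u3, u4, u5, rfl⟩ := symm_eq h.hU
  obtain ⟨x0, x1, x2, rfl⟩ := vec_eq ξ
  obtain ⟨n0, n1, n2, rfl⟩ := vec_eq n
  rw [hT'] at hT ⊢
  simp only [bil, F, S, cross, det_fin_three, adjugate_fin_three, trace_fin_three,
    Matrix.mul_apply, Fin.sum_univ_three, Matrix.add_apply, Matrix.sub_apply, Matrix.smul_apply,
    Matrix.neg_apply, vecMulVec_apply,
    of_apply, cons_val', cons_val_zero, cons_val_one, cons_val, smul_eq_mul, dotProduct, mulVec]
    at hT ⊢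
  linear_combination (u0 * (u3 * u5 - u4 ^ 2) - u1 * (u1 * u5 - u2 * u4)
    + u2 * (u1 * u4 - u2 * u3)) * hT

set_option maxHeartbeats 2000000 in
theorem IsFlatPoint.rel_cov (h : M.IsFlatPoint U ξ n) (i : Fin 3) :
    M.d * ξ i ^ 2 + 2 * (M.c *ᵥ (U *ᵥ ξ)) i * ξ i - (ξ ⬝ᵥ (U *ᵥ ξ)) * M.c i i
      - bil M.b (Pi.single i 1 ⨯₃ (U *ᵥ ξ)) (Pi.single i 1 ⨯₃ (U *ᵥ ξ)) = 0 := by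
  have hTs := M.T_isSymm h.hb h.hU
  have hT := h.hT
  rw [← M.shift_shift_neg U]
  simp only [shift, h.hF, h.hS]
  obtain ⟨t0, t1, t2, t3, t4, t5, hT'⟩ := symm_eq hTs
  obtain ⟨u0, u1, u2, u3, u4, u5, rfl⟩ := symm_eq h.hU
  obtain ⟨x0, x1, x2, rfl⟩ := vec_eq ξ
  obtain ⟨n0, n1, n2, rfl⟩ := vec_eq n
  rw [hT'] at hT ⊢
  simp only [bil, F, S, T, cross, det_fin_three, adjugate_fin_three, trace_fin_three,
    Matrix.mul_apply, Fin.sum_univ_three, Matrix.add_apply, Matrix.sub_apply, Matrix.smul_apply,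
    Matrix.neg_apply, vecMulVec_apply, cross_apply,
    of_apply, cons_val', cons_val_zero, cons_val_one, cons_val, smul_eq_mul, dotProduct, mulVec]
    at hT ⊢
  fin_cases i
  · simp
    linear_combination (u3 * u5 - u4 ^ 2) * hT
  · simp
    linear_combination (u0 * u5 - u2 ^ 2) * hT
  · simp
    linear_combination (u0 * u3 - u1 ^ 2) * hT

set_option maxHeartbeats 2000000 in
theorem IsFlatPoint.rel_contra (h : M.IsFlatPoint U ξ n) (i : Fin 3) :
    M.a * (U *ᵥ ξ) i ^ 2 + 2 * (M.b *ᵥ ξ) i * (U *ᵥ ξ) i - (ξ ⬝ᵥ (U *ᵥ ξ)) * M.b i i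
      - bil M.c (Pi.single i 1 ⨯₃ ξ) (Pi.single i 1 ⨯₃ ξ) = 0 := by
  have hTs := M.T_isSymm h.hb h.hU
  have hT := h.hT
  rw [← M.shift_shift_neg U]
  simp only [shift, h.hF, h.hS]
  obtain ⟨t0, t1, t2, t3, t4, t5, hT'⟩ := symm_eq hTs
  obtain ⟨u0, u1, u2, u3, u4, u5, rfl⟩ := symm_eq h.hU
  obtain ⟨x0, x1, x2, rfl⟩ := vec_eq ξ
  obtain ⟨n0, n1, n2, rfl⟩ := vec_eq n
  rw [hT'] at hT ⊢
  simp only [bil, S, T, cross, adjugate_fin_three,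
    Fin.sum_univ_three, Matrix.add_apply, Matrix.sub_apply, Matrix.smul_apply,
    Matrix.neg_apply, vecMulVec_apply, cross_apply,
    of_apply, cons_val', cons_val_zero, cons_val_one, cons_val, smul_eq_mul, dotProduct, mulVec]
    at hT ⊢
  fin_cases i
  · simp
    linear_combination u0 * hT
  · simp
    linear_combination u3 * hT
  · simp
    linear_combination u5 * hT

end Relations

end MAData

/-! ### The cone over degenerate points, and flat vectors. -/

namespace MAData

/-- The part of the cone over the points where the symbol is degenerate. -/
def degCone (M : MAData) : Set (V3 × V3) :=
  {v | v.1 ≠ 0 ∧ ∃ U : Mat3, U.IsSymm ∧ M.F U = 0 ∧ M.S U ≠ 0 ∧ VanishesOnPerp (M.S U) v.1 ∧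
    U *ᵥ v.1 = v.2}

theorem degCone_subset_cone (M : MAData) : M.degCone ⊆ M.cone := by
  rintro v ⟨hv, U, hU, hF, hS, hP, hp⟩
  exact ⟨U, hU, hF, hS, mem_dualCone_of_vanishesOnPerp hv hP, hp.symm⟩

theorem cone_subset_degCone {M : MAData} (hb : M.b.IsSymm) (hc : M.c.IsSymm)
    (hdet : ∀ U : Mat3, U.IsSymm → M.F U = 0 → (M.S U).det = 0) :
    M.cone ⊆ M.degCone ∪ {0} := by
  rintro ⟨x, p⟩ ⟨U, hU, hF, hS, hx, hp⟩
  by_cases h : x = 0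
  · right
    dsimp only at hp
    rw [hp, h, mulVec_zero]
    rfl
  · left
    exact ⟨h, U, hU, hF, hS, vanishesOnPerp_of_mem_dualCone (M.S_isSymm hb hc hU)
      (hdet U hU hF) h hx, hp.symm⟩

theorem closure_cone_eq {M : MAData} (hb : M.b.IsSymm) (hc : M.c.IsSymm)
    (hdet : ∀ U : Mat3, U.IsSymm → M.F U = 0 → (M.S U).det = 0) (h0 : 0 ∈ closure M.degCone) :
    closure M.cone = closure M.degCone := by
  refine (closure_minimal ?_ isClosed_closure).antisymm (closure_mono M.degCone_subset_cone)
  refine (cone_subset_degCone hb hc hdet).trans (union_subset subset_closure ?_)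
  rintro _ rfl
  exact h0

/-- A vector such that the equation holds at all integral elements that contain it. -/
def IsFlat (M : MAData) (v : V3 × V3) : Prop :=
  v.1 ≠ 0 → ∀ U : Mat3, U.IsSymm → U *ᵥ v.1 = v.2 → M.F U = 0

/-- For `m ⊥ x`, adding `m mᵀ` to `U` keeps `Ux = p`, so `F` stays zero; its slope `S(m, m)` must
vanish, and polarization does the rest. -/
theorem mem_degCone_of_isFlat {M : MAData} (hb : M.b.IsSymm) (hc : M.c.IsSymm) {v : V3 × V3}
    (hv : v.1 ≠ 0) (h : M.IsFlat v) {U : Mat3} (hU : U.IsSymm) (hUv : U *ᵥ v.1 = v.2)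
    (hS : M.S U ≠ 0) : v ∈ M.degCone := by
  have hF := h hv U hU hUv
  have hq : ∀ m : V3, m ⬝ᵥ v.1 = 0 → bil (M.S U) m m = 0 := by
    intro m hm
    have h1 := h hv (U + (1 : ℝ) • vecMulVec m m) (hU.add ((vecMulVec_self_isSymm m).smul _))
      (by rw [add_mulVec, hUv, smul_mulVec, vecMulVec_mulVec, hm]; simp)
    rw [F_add_vecMulVec, hF] at h1
    linarith
  refine ⟨hv, U, hU, hF, hS, fun m n hm hn => ?_, hUv⟩
  have h1 := hq (m + n) (by rw [add_dotProduct, hm, hn, add_zero])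
  rw [bil_add_left, bil_add_right, bil_add_right, hq m hm, hq n hn,
    bil_comm (M.S_isSymm hb hc hU) n m] at h1
  linarith

/-- Flatness makes every interpolating matrix a point of the equation; only regularity can fail. At
`t = 1` the interpolating matrix is `0`, with symbol `c ≠ 0`, so by analyticity the symbol is
nonzero at points of the segment arbitrarily close to `v`. -/
theorem mem_closure_degCone {M : MAData} (hb : M.b.IsSymm) (hc : M.c.IsSymm) {v : V3 × V3}
    {x : V3} (hx : x ≠ 0) {i j : Fin 3} (hij : M.c i j ≠ 0)
    (h : ∀ t : ℝ, M.IsFlat ((1 - t) • v + t • (x, 0))) : v ∈ closure M.degCone := by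
  set γ : ℝ → V3 × V3 := fun t => (1 - t) • v + t • (x, 0) with hγ
  have hsm : ContDiff ℝ ω γ := by fun_prop
  have hγ0 : γ 0 = v := by simp [hγ]
  have hγ1 : γ 1 = (x, 0) := by simp [hγ]
  have hN := contDiff_dot hsm.fst hsm.fst
  have hX : ∀ i j, ContDiff ℝ ω fun t => interpNum (γ t).1 (γ t).2 i j := by
    intro i j
    have hd := contDiff_dot hsm.snd hsm.fst
    have e1 := contDiff_pi.1 hsm.fst
    have e2 := contDiff_pi.1 hsm.snd
    simp only [interpNum, Matrix.add_apply, Matrix.sub_apply, Matrix.smul_apply, smul_eq_mul,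
      vecMulVec_apply]
    fun_prop
  have hg := hN.mul (M.contDiff_Shom (hN.pow 2) hX i j)
  have hev := eventually_ne_zero_of_contDiff hg (s := 1) (by
    rw [hγ1]
    have : interpNum x 0 = 0 := by simp [interpNum]
    rw [this]
    have hS0 : ∀ l, M.Shom l 0 = l ^ 2 • M.c := fun l => by simp [Shom, cross]
    rw [hS0]
    exact mul_ne_zero (dot_self_ne hx)
      (mul_ne_zero (pow_ne_zero _ (pow_ne_zero _ (dot_self_ne hx))) hij)) 0
  have ht : Tendsto γ (𝓝[≠] 0) (𝓝 v) := by
    rw [← hγ0]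
    exact hsm.continuous.continuousAt.tendsto.mono_left nhdsWithin_le_nhds
  refine mem_closure_of_tendsto ht ?_
  filter_upwards [hev] with t ht
  obtain ⟨h1, h2⟩ := mul_ne_zero_iff.1 ht
  have hl : ((γ t).1 ⬝ᵥ (γ t).1) ^ 2 ≠ 0 := pow_ne_zero _ h1
  set l := ((γ t).1 ⬝ᵥ (γ t).1) ^ 2 with hld
  set X := l⁻¹ • interpNum (γ t).1 (γ t).2 with hXd
  refine mem_degCone_of_isFlat hb hc (U := X) (fun h0 => h1 (by rw [h0]; simp)) (h t)
    ((interpNum_isSymm _ _).smul _) ?_ ?_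
  · rw [hXd, smul_mulVec, interpNum_mulVec, ← hld, smul_smul, inv_mul_cancel₀ hl, one_smul]
  · intro h0
    apply h2
    have : interpNum (γ t).1 (γ t).2 = l • X := by rw [hXd, smul_smul, mul_inv_cancel₀ hl, one_smul]
    change M.Shom l _ i j = 0
    rw [this, Shom_smul, h0]
    simp

/-- On the equation `kap (x, Ux)` is `adj S (x, x)`. If this is a multiple of a square, `adj S` is a
multiple of `l lᵀ`, and its determinant `(det S)²` vanishes. -/
theorem det_S_eq_zero {M : MAData} (hb : M.b.IsSymm) (hc : M.c.IsSymm) {U : Mat3} (hU : U.IsSymm)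
    (hF : M.F U = 0) {r : ℝ} {l : V3} (h : ∀ x, M.kap x (U *ᵥ x) = r * (l ⬝ᵥ x) ^ 2) :
    (M.S U).det = 0 := by
  have hA : (adjugate (M.S U)).IsSymm := (M.S_isSymm hb hc hU).adjugate
  have hA' : ∀ x, bil (adjugate (M.S U)) x x = r * (l ⬝ᵥ x) ^ 2 := by
    intro x
    rw [← h x]
    have := M.kap_shift hb hc hU x 0
    rw [zero_add] at this
    rw [← this, kap, shift]
    simp only [hF]
    simp [bil]
  have heq : adjugate (M.S U) = r • vecMulVec l l := by
    rw [← sub_eq_zero]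
    apply mat_eq_zero_of_bil
    intro x y
    have h1 := hA' (x + y)
    rw [bil_add_left, bil_add_right, bil_add_right, hA', hA', bil_comm hA y x,
      dotProduct_add] at h1
    have h2 : bil (adjugate (M.S U) - r • vecMulVec l l) x y
        = bil (adjugate (M.S U)) x y - r * (l ⬝ᵥ x) * (l ⬝ᵥ y) := by
      simp [bil, sub_mulVec, smul_mulVec, vecMulVec_mulVec, dotProduct_comm x l]
      ring
    rw [h2]
    linarith
  have h3 : (adjugate (M.S U)).det = 0 := by
    rw [heq, det_fin_three]
    simp [vecMulVec_apply]
    ring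
  rw [det_adjugate] at h3
  exact eq_zero_of_pow_eq_zero h3

theorem exists_isFlatPoint {M : MAData} (hb : M.b.IsSymm) (hc : M.c.IsSymm) {v : V3 × V3}
    (hv : v ∈ M.degCone) (hpol : ∀ q, M.kapB v (0, q) = 0) :
    ∃ (U : Mat3) (n : V3), M.IsFlatPoint U v.1 n ∧ U *ᵥ v.1 = v.2 := by
  obtain ⟨hx, U, hU, hF, hS, hP, hp⟩ := hv
  obtain ⟨n, hn⟩ := hP.exists_eq (M.S_isSymm hb hc hU) hx
  refine ⟨U, n, ⟨hb, hU, hF, hn, bil_T_eq_zero hb hc hU hF hS hn ?_⟩, hp⟩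
  rw [hp]
  exact hpol

/-! ### Hyperbolic symbols of rank two -/

/-- The normal form of equations with symbol of rank two. -/
noncomputable def normTwo (b₁ b₂ b₄ b₅ : ℝ) : MAData where
  a := 4 * b₂ * b₄ - 2 * b₁ * b₅
  b := !![0, b₁, b₂; b₁, 0, b₄; b₂, b₄, b₅]
  c := !![0, 1 / 2, 0; 1 / 2, 0, 0; 0, 0, 0]
  d := 0

/-- The matrix of the shear which makes the coefficients of the equation constant. -/
def shearTwo (b₁ b₂ b₄ b₅ : ℝ) : Mat3 :=
  !![0, b₅, -2 * b₄; b₅, 0, -2 * b₂; -2 * b₄, -2 * b₂, 2 * b₁]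

def planeOne : Set (V3 × V3) := {v | v.1 1 = 0 ∧ v.1 2 = 0 ∧ v.2 1 = 0}

def planeTwo : Set (V3 × V3) := {v | v.1 0 = 0 ∧ v.1 2 = 0 ∧ v.2 0 = 0}

theorem normTwo_b_isSymm (b₁ b₂ b₄ b₅ : ℝ) : (normTwo b₁ b₂ b₄ b₅).b.IsSymm := symm_mk ..

theorem normTwo_c_isSymm (b₁ b₂ b₄ b₅ : ℝ) : (normTwo b₁ b₂ b₄ b₅).c.IsSymm := symm_mk ..

section Two

variable (b₁ b₂ b₄ b₅ : ℝ)

theorem kap_normTwo (x p : V3) : (normTwo b₁ b₂ b₄ b₅).kap x p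
    = -(1 / 4) * ((x - shearTwo b₁ b₂ b₄ b₅ *ᵥ p) 2) ^ 2 := by
  obtain ⟨x0, x1, x2, rfl⟩ := vec_eq x
  obtain ⟨p0, p1, p2, rfl⟩ := vec_eq p
  simp only [normTwo, shearTwo, kap, bil, adjugate_fin_three, trace_fin_three,
    Matrix.mul_apply, Fin.sum_univ_three, Pi.sub_apply,
    of_apply, cons_val', cons_val_zero, cons_val_one, cons_val, dotProduct, mulVec]
  ring

theorem kapB_normTwo (v w : V3 × V3) : (normTwo b₁ b₂ b₄ b₅).kapB v w
    = -(1 / 2) * (v.1 - shearTwo b₁ b₂ b₄ b₅ *ᵥ v.2) 2 * (w.1 - shearTwo b₁ b₂ b₄ b₅ *ᵥ w.2) 2 := by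
  have h := (normTwo b₁ b₂ b₄ b₅).kapQ_add (normTwo_b_isSymm ..) (normTwo_c_isSymm ..) v w
  simp only [kapQ, kap_normTwo, Prod.fst_add, Prod.snd_add, mulVec_add, Pi.sub_apply,
    Pi.add_apply] at h ⊢
  linear_combination -h

theorem det_S_normTwo {U : Mat3} (hU : U.IsSymm) (hF : (normTwo b₁ b₂ b₄ b₅).F U = 0) :
    ((normTwo b₁ b₂ b₄ b₅).S U).det = 0 := by
  refine det_S_eq_zero (normTwo_b_isSymm ..) (normTwo_c_isSymm ..) hU hF
    (r := -(1 / 4)) (l := (1 - shearTwo b₁ b₂ b₄ b₅ * U) 2) fun x => ?_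
  rw [kap_normTwo]
  congr 2
  rw [mulVec_mulVec]
  change _ = ((1 - shearTwo b₁ b₂ b₄ b₅ * U) *ᵥ x) 2
  rw [sub_mulVec, one_mulVec]

/-- The determinant is the restriction to the integral element of `dp₁ ∧ dx₁ ∧ dx₂` in sheared
coordinates (indices from `0`), a decomposable form with kernel `planeOne`. -/
theorem F_normTwo_left {U : Mat3} (hU : U.IsSymm) : (normTwo b₁ b₂ b₄ b₅).F U
    = (of ![U 1, (1 - shearTwo b₁ b₂ b₄ b₅ * U) 1, (1 - shearTwo b₁ b₂ b₄ b₅ * U) 2]).det := by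
  obtain ⟨u0, u1, u2, u3, u4, u5, rfl⟩ := symm_eq hU
  simp [normTwo, shearTwo, F, det_fin_three, adjugate_fin_three, trace_fin_three,
    Matrix.sub_apply]
  ring

/-- A second decomposable form, `dx₂ ∧ dx₀ ∧ dp₀` with kernel `planeTwo`, has the same restrictions
to integral elements. -/
theorem F_normTwo_right {U : Mat3} (hU : U.IsSymm) : (normTwo b₁ b₂ b₄ b₅).F U
    = (of ![(1 - shearTwo b₁ b₂ b₄ b₅ * U) 2, (1 - shearTwo b₁ b₂ b₄ b₅ * U) 0, U 0]).det := by
  obtain ⟨u0, u1, u2, u3, u4, u5, rfl⟩ := symm_eq hU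
  simp [normTwo, shearTwo, F, det_fin_three, adjugate_fin_three, trace_fin_three,
    Matrix.sub_apply]
  ring

end Two

end MAData

theorem det_eq_zero_of_rows {r₀ r₁ r₂ x : V3} (hx : x ≠ 0) (h₀ : r₀ ⬝ᵥ x = 0) (h₁ : r₁ ⬝ᵥ x = 0)
    (h₂ : r₂ ⬝ᵥ x = 0) : (of ![r₀, r₁, r₂]).det = 0 := by
  refine exists_mulVec_eq_zero_iff.1 ⟨x, hx, ?_⟩
  ext i
  fin_cases i
  · exact h₀
  · exact h₁
  · exact h₂

/-- The symplectic shear with matrix `-X`. -/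
def shear (X : Mat3) (v : V3 × V3) : V3 × V3 := (v.1 - X *ᵥ v.2, v.2)

theorem shear_fst_apply (X : Mat3) (v : V3 × V3) (i : Fin 3) :
    (shear X v).1 i = v.1 i - (X i 0 * v.2 0 + X i 1 * v.2 1 + X i 2 * v.2 2) := by
  simp [shear, mulVec, dotProduct, Fin.sum_univ_three]

theorem continuous_shear (X : Mat3) : Continuous (shear X) := by
  unfold shear
  fun_prop

theorem shear_segment (X : Mat3) (t : ℝ) (v : V3 × V3) (x : V3) :
    shear X ((1 - t) • v + t • (x, 0)) = (1 - t) • shear X v + t • (x, 0) := by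
  simp only [shear, Prod.fst_add, Prod.snd_add, Prod.smul_fst, Prod.smul_snd, mulVec_smul,
    smul_zero, add_zero]
  ext i <;> simp
  ring

theorem dot_row_shear {X U : Mat3} {v : V3 × V3} (h : U *ᵥ v.1 = v.2) (i : Fin 3) :
    (1 - X * U) i ⬝ᵥ v.1 = (shear X v).1 i := by
  change ((1 - X * U) *ᵥ v.1) i = _
  rw [sub_mulVec, one_mulVec, ← mulVec_mulVec, h]
  rfl

namespace MAData

theorem isClosed_planeOne : IsClosed planeOne :=
  (isClosed_eq (by fun_prop) continuous_const).inter
    ((isClosed_eq (by fun_prop) continuous_const).inter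
      (isClosed_eq (by fun_prop) continuous_const))

theorem isClosed_planeTwo : IsClosed planeTwo :=
  (isClosed_eq (by fun_prop) continuous_const).inter
    ((isClosed_eq (by fun_prop) continuous_const).inter
      (isClosed_eq (by fun_prop) continuous_const))

section Two

variable {b₁ b₂ b₄ b₅ : ℝ}

theorem isFlat_of_mem_planeOne {v : V3 × V3} (hv : shear (shearTwo b₁ b₂ b₄ b₅) v ∈ planeOne) :
    (normTwo b₁ b₂ b₄ b₅).IsFlat v := by
  intro hx U hU hp
  rw [F_normTwo_left _ _ _ _ hU]
  refine det_eq_zero_of_rows hx ?_ ?_ ?_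
  · change (U *ᵥ v.1) 1 = 0
    rw [hp]
    exact hv.2.2
  · rw [dot_row_shear hp]
    exact hv.1
  · rw [dot_row_shear hp]
    exact hv.2.1

theorem isFlat_of_mem_planeTwo {v : V3 × V3} (hv : shear (shearTwo b₁ b₂ b₄ b₅) v ∈ planeTwo) :
    (normTwo b₁ b₂ b₄ b₅).IsFlat v := by
  intro hx U hU hp
  rw [F_normTwo_right _ _ _ _ hU]
  refine det_eq_zero_of_rows hx ?_ ?_ ?_
  · rw [dot_row_shear hp]
    exact hv.2.1
  · rw [dot_row_shear hp]
    exact hv.1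
  · change (U *ᵥ v.1) 0 = 0
    rw [hp]
    exact hv.2.2

theorem degCone_normTwo_subset {v : V3 × V3} (hv : v ∈ (normTwo b₁ b₂ b₄ b₅).degCone) :
    shear (shearTwo b₁ b₂ b₄ b₅) v ∈ planeOne ∪ planeTwo := by
  have hb := normTwo_b_isSymm b₁ b₂ b₄ b₅
  have hc := normTwo_c_isSymm b₁ b₂ b₄ b₅
  have h0 := kap_of_cone hb hc (degCone_subset_cone _ hv)
  rw [kap_normTwo] at h0
  have h2 : (v.1 - shearTwo b₁ b₂ b₄ b₅ *ᵥ v.2) 2 = 0 := by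
    have : ((v.1 - shearTwo b₁ b₂ b₄ b₅ *ᵥ v.2) 2) ^ 2 = 0 := by linarith
    exact eq_zero_of_pow_eq_zero this
  -- `kap` is a multiple of the square of a linear form, so at a zero its polar form vanishes as
  -- well.
  obtain ⟨U, n, hfl, hp⟩ := exists_isFlatPoint hb hc hv fun q => by
    rw [kapB_normTwo, h2]
    ring
  have r0 := hfl.rel
  have r1 := hfl.rel_cov 0
  have r2 := hfl.rel_cov 1
  have r3 := hfl.rel_contra 2
  rw [hp] at r0 r1 r2 r3
  obtain ⟨x, p⟩ := v
  obtain ⟨x0, x1, x2, rfl⟩ := vec_eq x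
  obtain ⟨p0, p1, p2, rfl⟩ := vec_eq p
  have e0 : p0 * p1 = 0 := by
    simp [normTwo, bil, dotProduct, mulVec, Fin.sum_univ_three] at r0
    linarith
  have e1 : (x0 - (b₅ * p1 - 2 * b₄ * p2)) * p1 = 0 := by
    simp [normTwo, bil, cross_apply, dotProduct, mulVec, Fin.sum_univ_three] at r1
    linarith
  have e2 : (x1 - (b₅ * p0 - 2 * b₂ * p2)) * p0 = 0 := by
    simp [normTwo, bil, cross_apply, dotProduct, mulVec, Fin.sum_univ_three] at r2
    linarith
  have e3 : x2 - (-2 * b₄ * p0 - 2 * b₂ * p1 + 2 * b₁ * p2) = 0 := by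
    simp [shearTwo] at h2
    linarith
  have e4 : (x0 - (b₅ * p1 - 2 * b₄ * p2)) * (x1 - (b₅ * p0 - 2 * b₂ * p2)) = 0 := by
    simp [normTwo, bil, cross_apply, dotProduct, mulVec, Fin.sum_univ_three] at r3
    linear_combination r3 - b₅ * p2 * e3 + b₅ ^ 2 * e0
  set w := shear (shearTwo b₁ b₂ b₄ b₅) (![x0, x1, x2], ![p0, p1, p2]) with hw
  have s0 : w.1 0 = x0 - (b₅ * p1 - 2 * b₄ * p2) := by
    rw [hw, shear_fst_apply]
    simp [shearTwo]
    ring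
  have s1 : w.1 1 = x1 - (b₅ * p0 - 2 * b₂ * p2) := by
    rw [hw, shear_fst_apply]
    simp [shearTwo]
    ring
  have s2 : w.1 2 = 0 := by
    rw [hw, shear_fst_apply]
    simp [shearTwo]
    linarith
  -- `e0`, `e1`, `e2`, `e4` say that all products of an entry of the sheared pair `(x₀, p₀)` with
  -- one of `(x₁, p₁)` vanish, so one of the pairs is zero.
  by_cases h : x1 - (b₅ * p0 - 2 * b₂ * p2) = 0 ∧ p1 = 0
  · exact Or.inl ⟨s1.trans h.1, s2, h.2⟩
  · right
    have : x0 - (b₅ * p1 - 2 * b₄ * p2) = 0 ∧ p0 = 0 := by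
      rcases not_and_or.1 h with h | h
      · exact ⟨(mul_eq_zero.1 e4).resolve_right h, (mul_eq_zero.1 e2).resolve_left h⟩
      · exact ⟨(mul_eq_zero.1 e1).resolve_right h, (mul_eq_zero.1 e0).resolve_right h⟩
    exact ⟨s0.trans this.1, s2, this.2⟩

theorem closure_degCone_normTwo : closure (normTwo b₁ b₂ b₄ b₅).degCone
    = shear (shearTwo b₁ b₂ b₄ b₅) ⁻¹' (planeOne ∪ planeTwo) := by
  have hb := normTwo_b_isSymm b₁ b₂ b₄ b₅
  have hc := normTwo_c_isSymm b₁ b₂ b₄ b₅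
  refine (closure_minimal (fun v hv => degCone_normTwo_subset hv) ?_).antisymm ?_
  · exact (isClosed_planeOne.union isClosed_planeTwo).preimage (continuous_shear _)
  · rintro v (hv | hv)
    · refine mem_closure_degCone hb hc (x := ![1, 0, 0]) (i := 0) (j := 1) ?_ ?_ fun t => ?_
      · exact fun h => by simpa using congrFun h 0
      · simp [normTwo]
      · apply isFlat_of_mem_planeOne
        rw [shear_segment]
        obtain ⟨h1, h2, h3⟩ := hv
        exact ⟨by simp [h1], by simp [h2], by simp [h3]⟩
    · refine mem_closure_degCone hb hc (x := ![0, 1, 0]) (i := 0) (j := 1) ?_ ?_ fun t => ?_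
      · exact fun h => by simpa using congrFun h 1
      · simp [normTwo]
      · apply isFlat_of_mem_planeTwo
        rw [shear_segment]
        obtain ⟨h1, h2, h3⟩ := hv
        exact ⟨by simp [h1], by simp [h2], by simp [h3]⟩

end Two

/-! ### Symbols of rank one -/

/-- The normal form of equations with symbol of rank one. -/
noncomputable def normOne (s b₃ b₄ b₅ : ℝ) : MAData where
  a := (b₃ * b₅ - b₄ ^ 2) / s
  b := !![0, 0, 0; 0, b₃, b₄; 0, b₄, b₅]
  c := !![s, 0, 0; 0, 0, 0; 0, 0, 0]
  d := 0

/-- The matrix of the shear which makes the coefficients of the equation constant. -/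
noncomputable def shearOne (s b₃ b₄ b₅ : ℝ) : Mat3 :=
  !![0, 0, 0; 0, -b₅ / s, b₄ / s; 0, b₄ / s, -b₃ / s]

def planeLag : Set (V3 × V3) := {v | v.1 1 = 0 ∧ v.1 2 = 0 ∧ v.2 0 = 0}

theorem isClosed_planeLag : IsClosed planeLag :=
  (isClosed_eq (by fun_prop) continuous_const).inter
    ((isClosed_eq (by fun_prop) continuous_const).inter
      (isClosed_eq (by fun_prop) continuous_const))

theorem normOne_b_isSymm (s b₃ b₄ b₅ : ℝ) : (normOne s b₃ b₄ b₅).b.IsSymm := symm_mk ..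

theorem normOne_c_isSymm (s b₃ b₄ b₅ : ℝ) : (normOne s b₃ b₄ b₅).c.IsSymm := symm_mk ..

theorem kap_normOne {s : ℝ} (hs : s ≠ 0) {b₃ b₄ b₅ : ℝ} (x p : V3) :
    (normOne s b₃ b₄ b₅).kap x p = 0 := by
  obtain ⟨x0, x1, x2, rfl⟩ := vec_eq x
  obtain ⟨p0, p1, p2, rfl⟩ := vec_eq p
  simp only [normOne, kap, bil, adjugate_fin_three, trace_fin_three,
    Matrix.mul_apply, Fin.sum_univ_three,
    of_apply, cons_val', cons_val_zero, cons_val_one, cons_val, dotProduct, mulVec]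
  field_simp
  ring

theorem kapB_normOne {s : ℝ} (hs : s ≠ 0) {b₃ b₄ b₅ : ℝ} (v w : V3 × V3) :
    (normOne s b₃ b₄ b₅).kapB v w = 0 := by
  have h := (normOne s b₃ b₄ b₅).kapQ_add (normOne_b_isSymm ..) (normOne_c_isSymm ..) v w
  simp only [kapQ, kap_normOne hs] at h
  linarith

theorem det_S_normOne {s : ℝ} (hs : s ≠ 0) {b₃ b₄ b₅ : ℝ} {U : Mat3} (hU : U.IsSymm)
    (hF : (normOne s b₃ b₄ b₅).F U = 0) : ((normOne s b₃ b₄ b₅).S U).det = 0 :=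
  det_S_eq_zero (normOne_b_isSymm ..) (normOne_c_isSymm ..) hU hF
    (r := 0) (l := 0) fun x => by rw [kap_normOne hs, zero_mul]

theorem F_normOne {s : ℝ} (hs : s ≠ 0) {b₃ b₄ b₅ : ℝ} {U : Mat3} (hU : U.IsSymm) :
    (normOne s b₃ b₄ b₅).F U = s *
      (of ![U 0, (1 - shearOne s b₃ b₄ b₅ * U) 1, (1 - shearOne s b₃ b₄ b₅ * U) 2]).det := by
  obtain ⟨u0, u1, u2, u3, u4, u5, rfl⟩ := symm_eq hU
  simp [normOne, shearOne, F, det_fin_three, adjugate_fin_three, trace_fin_three,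
    Matrix.sub_apply]
  field_simp
  ring

theorem isFlat_of_mem_planeLag {s : ℝ} (hs : s ≠ 0) {b₃ b₄ b₅ : ℝ} {v : V3 × V3}
    (hv : shear (shearOne s b₃ b₄ b₅) v ∈ planeLag) : (normOne s b₃ b₄ b₅).IsFlat v := by
  intro hx U hU hp
  rw [F_normOne hs hU, det_eq_zero_of_rows hx ?_ ?_ ?_, mul_zero]
  · change (U *ᵥ v.1) 0 = 0
    rw [hp]
    exact hv.2.2
  · rw [dot_row_shear hp]
    exact hv.1
  · rw [dot_row_shear hp]
    exact hv.2.1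

theorem degCone_normOne_subset {s : ℝ} (hs : s ≠ 0) {b₃ b₄ b₅ : ℝ} {v : V3 × V3}
    (hv : v ∈ (normOne s b₃ b₄ b₅).degCone) : shear (shearOne s b₃ b₄ b₅) v ∈ planeLag := by
  have hb := normOne_b_isSymm s b₃ b₄ b₅
  have hc := normOne_c_isSymm s b₃ b₄ b₅
  obtain ⟨U, n, hfl, hp⟩ := exists_isFlatPoint hb hc hv fun q => kapB_normOne hs _ _
  have r0 := hfl.rel
  have r1 := hfl.rel_cov 0
  have r2 := hfl.rel_contra 1
  have r3 := hfl.rel_contra 2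
  rw [hp] at r0 r1 r2 r3
  obtain ⟨x, p⟩ := v
  obtain ⟨x0, x1, x2, rfl⟩ := vec_eq x
  obtain ⟨p0, p1, p2, rfl⟩ := vec_eq p
  have e0 : p0 = 0 := by
    simp [normOne, bil, hs, dotProduct, mulVec, Fin.sum_univ_three] at r0
    exact r0
  subst e0
  have e1 : s * (x1 * p1 + x2 * p2) + (b₃ * p2 ^ 2 - 2 * b₄ * p1 * p2 + b₅ * p1 ^ 2) = 0 := by
    simp [normOne, bil, cross_apply, dotProduct, mulVec, Fin.sum_univ_three] at r1
    linarith
  have e2 : x1 - (-b₅ / s * p1 + b₄ / s * p2) = 0 := by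
    simp [normOne, bil, cross_apply, dotProduct, mulVec, Fin.sum_univ_three] at r3
    -- Modulo `e1`, the diagonal relation is, up to sign, `s` times the square of a sheared
    -- coordinate.
    have : s * (x1 - (-b₅ / s * p1 + b₄ / s * p2)) ^ 2 = 0 := by
      field_simp at r3 ⊢
      linear_combination -r3 + b₅ * e1
    exact eq_zero_of_pow_eq_zero ((mul_eq_zero.1 this).resolve_left hs)
  have e3 : x2 - (b₄ / s * p1 + -b₃ / s * p2) = 0 := by
    simp [normOne, bil, cross_apply, dotProduct, mulVec, Fin.sum_univ_three] at r2
    have : s * (x2 - (b₄ / s * p1 + -b₃ / s * p2)) ^ 2 = 0 := by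
      field_simp at r2 ⊢
      linear_combination -r2 + b₃ * e1
    exact eq_zero_of_pow_eq_zero ((mul_eq_zero.1 this).resolve_left hs)
  refine ⟨?_, ?_, rfl⟩
  · rw [shear_fst_apply]
    simpa [shearOne] using e2
  · rw [shear_fst_apply]
    simpa [shearOne] using e3

theorem closure_degCone_normOne {s : ℝ} (hs : s ≠ 0) {b₃ b₄ b₅ : ℝ} :
    closure (normOne s b₃ b₄ b₅).degCone = shear (shearOne s b₃ b₄ b₅) ⁻¹' planeLag := by
  have hb := normOne_b_isSymm s b₃ b₄ b₅
  have hc := normOne_c_isSymm s b₃ b₄ b₅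
  refine (closure_minimal (fun v hv => degCone_normOne_subset hs hv) ?_).antisymm ?_
  · exact isClosed_planeLag.preimage (continuous_shear _)
  · intro v hv
    refine mem_closure_degCone hb hc (x := ![1, 0, 0]) (i := 0) (j := 0) ?_ ?_ fun t => ?_
    · exact fun h => by simpa using congrFun h 0
    · simpa [normOne] using hs
    · apply isFlat_of_mem_planeLag hs
      rw [shear_segment]
      obtain ⟨h1, h2, h3⟩ := hv
      exact ⟨by simp [h1], by simp [h2], by simp [h3]⟩

end MAData

/-! ### Change of linear frame. -/

/-- The equation in another linear frame. -/
def MAData.pull (M : MAData) (Q P : Mat3) : MAData where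
  a := M.a * Q.det ^ 2
  -- The factor comes from `adj (Qᵀ U Q) = (det Q)² P (adj U) Pᵀ`.
  b := Q.det ^ 2 • (Pᵀ * M.b * P)
  c := Q * M.c * Qᵀ
  d := M.d

theorem cross_smul_left (r : ℝ) (X Y : Mat3) : cross (r • X) Y = r • cross X Y := by
  ext i j
  fin_cases i <;> fin_cases j <;>
  simp [cross, adjugate_fin_three] <;>
  ring

theorem adjugate_eq_of_mul_eq_one {Q P : Mat3} (h : Q * P = 1) : adjugate Q = Q.det • P := by
  have h1 : adjugate Q * (Q * P) = Q.det • P := by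
    rw [← Matrix.mul_assoc, adjugate_mul, Matrix.smul_mul, Matrix.one_mul]
  rw [← h1, h, Matrix.mul_one]

theorem adjugate_conj {Q P : Mat3} (h : Q * P = 1) (U : Mat3) :
    adjugate (Qᵀ * U * Q) = Q.det ^ 2 • (P * adjugate U * Pᵀ) := by
  rw [adjugate_mul_distrib, adjugate_mul_distrib, ← adjugate_transpose,
    adjugate_eq_of_mul_eq_one h, transpose_smul, Matrix.smul_mul, Matrix.mul_smul, Matrix.mul_smul,
    smul_smul, Matrix.mul_assoc, sq]

theorem mul_conj {Q P : Mat3} (h : Q * P = 1) (X : Mat3) : Q * (P * X * Pᵀ) * Qᵀ = X := by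
  have h2 : Pᵀ * Qᵀ = 1 := by rw [← transpose_mul, h, transpose_one]
  calc Q * (P * X * Pᵀ) * Qᵀ = (Q * P) * X * (Pᵀ * Qᵀ) := by simp only [Matrix.mul_assoc]
    _ = X := by rw [h, h2, Matrix.one_mul, Matrix.mul_one]

theorem conj_conj {Q P : Mat3} (h : P * Q = 1) (X : Mat3) : Qᵀ * (Pᵀ * X * P) * Q = X := by
  have h2 : Qᵀ * Pᵀ = 1 := by rw [← transpose_mul, h, transpose_one]
  calc Qᵀ * (Pᵀ * X * P) * Q = (Qᵀ * Pᵀ) * X * (P * Q) := by simp only [Matrix.mul_assoc]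
    _ = X := by rw [h, h2, Matrix.one_mul, Matrix.mul_one]

theorem bil_conj (Q S : Mat3) (x y : V3) : bil (Q * S * Qᵀ) x y = bil S (Qᵀ *ᵥ x) (Qᵀ *ᵥ y) := by
  simp only [bil, ← mulVec_mulVec, dotProduct_mulVec x Q, mulVec_transpose]

namespace MAData

variable {Q P : Mat3}

theorem F_pull (M : MAData) (h : Q * P = 1) (U : Mat3) :
    (M.pull Q P).F U = M.F (Qᵀ * U * Q) := by
  have h1 : trace (Pᵀ * M.b * P * adjugate U) = trace (M.b * (P * adjugate U * Pᵀ)) := by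
    rw [Matrix.mul_assoc, Matrix.mul_assoc, trace_mul_comm]
    simp only [Matrix.mul_assoc]
  have h2 : trace (Q * M.c * Qᵀ * U) = trace (M.c * (Qᵀ * U * Q)) := by
    rw [Matrix.mul_assoc, Matrix.mul_assoc, trace_mul_comm]
    simp only [Matrix.mul_assoc]
  simp only [F, pull, adjugate_conj h, det_mul, det_transpose, Matrix.smul_mul, Matrix.mul_smul,
    trace_smul, h1, h2, smul_eq_mul]
  ring

theorem S_pull (M : MAData) (h : Q * P = 1) (U : Mat3) :
    (M.pull Q P).S U = Q * M.S (Qᵀ * U * Q) * Qᵀ := by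
  have hPQ : P * Q = 1 := mul_eq_one_comm.1 h
  have hb : M.b = Qᵀ * (Pᵀ * M.b * P) * Q := (conj_conj hPQ _).symm
  have hadd : M.b + Qᵀ * U * Q = Qᵀ * (Pᵀ * M.b * P + U) * Q := by
    rw [Matrix.mul_add, Matrix.add_mul, ← hb]
  have hcr : cross M.b (Qᵀ * U * Q) = Q.det ^ 2 • (P * cross (Pᵀ * M.b * P) U * Pᵀ) := by
    rw [cross, hadd, adjugate_conj h, adjugate_conj h]
    have hadj : adjugate M.b = Q.det ^ 2 • (P * adjugate (Pᵀ * M.b * P) * Pᵀ) := by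
      conv_lhs => rw [hb]
      exact adjugate_conj h _
    rw [hadj, cross]
    simp only [Matrix.mul_sub, Matrix.sub_mul, smul_sub]
  rw [S, S, hcr, adjugate_conj h, Matrix.mul_add, Matrix.mul_add, Matrix.add_mul, Matrix.add_mul]
  simp only [Matrix.mul_smul, Matrix.smul_mul, mul_conj h, pull, cross_smul_left, smul_smul]

theorem kap_pull (M : MAData) (h : Q * P = 1) (x p : V3) :
    (M.pull Q P).kap (Q *ᵥ x) (Pᵀ *ᵥ p) = Q.det ^ 2 * M.kap x p := by
  have hPQ : P * Q = 1 := mul_eq_one_comm.1 h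
  have hT : Qᵀ * Pᵀ = 1 := by rw [← transpose_mul, hPQ, transpose_one]
  have hT' : Pᵀ * Qᵀ = 1 := by rw [← transpose_mul, h, transpose_one]
  have hdet : Q.det * P.det = 1 := by rw [← det_mul, h, det_one]
  have hx : P *ᵥ (Q *ᵥ x) = x := by rw [mulVec_mulVec, hPQ, one_mulVec]
  have hp : Qᵀ *ᵥ (Pᵀ *ᵥ p) = p := by rw [mulVec_mulVec, hT, one_mulVec]
  have hdot : ∀ y, (Pᵀ *ᵥ p) ⬝ᵥ (Q *ᵥ y) = p ⬝ᵥ y := fun y => by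
    rw [mulVec_transpose, ← dotProduct_mulVec, mulVec_mulVec, hPQ, one_mulVec]
  have hc : adjugate (Q * M.c * Qᵀ) = Q.det ^ 2 • (Pᵀ * adjugate M.c * Pᵀᵀ) := by
    have := adjugate_conj (Q := Qᵀ) (P := Pᵀ) hT M.c
    rwa [transpose_transpose, det_transpose] at this
  have hb : adjugate (Q.det ^ 2 • (Pᵀ * M.b * P)) = Q.det ^ 2 • (Q * adjugate M.b * Qᵀ) := by
    rw [adjugate_smul, adjugate_conj hPQ, smul_smul]
    congr 1
    simp only [Fintype.card_fin]
    linear_combination Q.det ^ 2 * (Q.det * P.det + 1) * hdet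
  have htr : trace (Q * M.c * Qᵀ * (Pᵀ * M.b * P)) = trace (M.c * M.b) := by
    have : Q * M.c * Qᵀ * (Pᵀ * M.b * P) = Q * (M.c * M.b * P) := by
      calc Q * M.c * Qᵀ * (Pᵀ * M.b * P) = Q * M.c * (Qᵀ * Pᵀ) * (M.b * P) := by
            simp only [Matrix.mul_assoc]
        _ = Q * (M.c * M.b * P) := by
            rw [hT, Matrix.mul_one]
            simp only [Matrix.mul_assoc]
    rw [this, trace_mul_comm, Matrix.mul_assoc, hPQ, Matrix.mul_one]
  have e1 : bil (Pᵀ * adjugate M.c * Pᵀᵀ) (Q *ᵥ x) (Q *ᵥ x) = bil (adjugate M.c) x x := by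
    rw [bil_conj, transpose_transpose, hx]
  have e2 : bil (Pᵀ * M.b * P) (Q *ᵥ x) (Q *ᵥ x) = bil M.b x x := by
    have := bil_conj Pᵀ M.b (Q *ᵥ x) (Q *ᵥ x)
    rwa [transpose_transpose, hx] at this
  have e3 : bil (Q * adjugate M.b * Qᵀ) (Pᵀ *ᵥ p) (Pᵀ *ᵥ p) = bil (adjugate M.b) p p := by
    rw [bil_conj, hp]
  have e4 : bil (Q * M.c * Qᵀ) (Pᵀ *ᵥ p) (Pᵀ *ᵥ p) = bil M.c p p := by
    rw [bil_conj, hp]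
  have e5 : (Pᵀ *ᵥ p) ⬝ᵥ ((Q * M.c * Qᵀ) *ᵥ ((Pᵀ * M.b * P) *ᵥ (Q *ᵥ x)))
      = p ⬝ᵥ (M.c *ᵥ (M.b *ᵥ x)) := by
    simp only [← mulVec_mulVec, hx, hdot]
    rw [mulVec_mulVec _ Qᵀ, hT, one_mulVec]
  have hs : ∀ (r : ℝ) (S : Mat3) (y z : V3), bil (r • S) y z = r * bil S y z := fun r S y z => by
    rw [bil, smul_mulVec, dotProduct_smul, smul_eq_mul, bil]
  simp only [kap, pull, hc, hb, hs, e1, e2, e3, e4, smul_mulVec, mulVec_smul, dotProduct_smul,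
    e5, Matrix.mul_smul, trace_smul, htr, hdot, smul_eq_mul]
  ring

theorem mem_degCone_pull {M : MAData} (h : Q * P = 1) (v : V3 × V3) :
    v ∈ M.degCone ↔ (Q *ᵥ v.1, Pᵀ *ᵥ v.2) ∈ (M.pull Q P).degCone := by
  have hPQ : P * Q = 1 := mul_eq_one_comm.1 h
  have hQP' : Qᵀ * Pᵀ = 1 := by rw [← transpose_mul, hPQ, transpose_one]
  obtain ⟨x, p⟩ := v
  constructor
  · rintro ⟨hx, U, hU, hF, hS, hV, hp⟩
    dsimp only at hx hV hp
    have hS' : (M.pull Q P).S (Pᵀ * U * P) = Q * M.S U * Qᵀ := by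
      rw [S_pull M h, conj_conj hPQ]
    refine ⟨fun h0 => hx ?_, Pᵀ * U * P, ?_, ?_, ?_, ?_, ?_⟩
    · dsimp only at h0
      rw [← one_mulVec x, ← hPQ, ← mulVec_mulVec, h0, mulVec_zero]
    · rw [IsSymm, transpose_mul, transpose_mul, transpose_transpose, hU.eq, Matrix.mul_assoc]
    · rw [F_pull M h, conj_conj hPQ, hF]
    · rw [hS']
      intro h0
      apply hS
      rw [← mul_conj (Q := P) (P := Q) hPQ (M.S U), h0]
      simp
    · rw [hS']
      intro m n hm hn
      rw [bil_conj]
      refine hV _ _ ?_ ?_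
      · rw [mulVec_transpose, ← dotProduct_mulVec]
        exact hm
      · rw [mulVec_transpose, ← dotProduct_mulVec]
        exact hn
    · dsimp only
      rw [mulVec_mulVec, Matrix.mul_assoc, hPQ, Matrix.mul_one, ← mulVec_mulVec, hp]
  · rintro ⟨hx, U, hU, hF, hS, hV, hp⟩
    dsimp only at hx hV hp
    rw [F_pull M h] at hF
    rw [S_pull M h] at hS hV
    refine ⟨fun h0 => hx ?_, Qᵀ * U * Q, ?_, hF, fun h0 => hS ?_, ?_, ?_⟩
    · dsimp only at h0
      rw [h0, mulVec_zero]
    · rw [IsSymm, transpose_mul, transpose_mul, transpose_transpose, hU.eq, Matrix.mul_assoc]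
    · rw [h0]
      simp
    · intro m n hm hn
      dsimp only at hm hn
      have h1 : ∀ m, m ⬝ᵥ x = 0 → (Pᵀ *ᵥ m) ⬝ᵥ (Q *ᵥ x) = 0 := by
        intro m hm
        rw [mulVec_transpose, ← dotProduct_mulVec, mulVec_mulVec, hPQ, one_mulVec, hm]
      have h2 := hV _ _ (h1 m hm) (h1 n hn)
      rwa [bil_conj, mulVec_mulVec, mulVec_mulVec, hQP', one_mulVec, one_mulVec] at h2
    · dsimp only
      rw [← mulVec_mulVec, ← mulVec_mulVec, hp, mulVec_mulVec, hQP', one_mulVec]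

theorem mem_degCone_shift {M : MAData} {U₀ : Mat3} (hU₀ : U₀.IsSymm) (v : V3 × V3) :
    v ∈ M.degCone ↔ (v.1, v.2 - U₀ *ᵥ v.1) ∈ (M.shift U₀).degCone := by
  constructor
  · rintro ⟨hx, U, hU, hF, hS, hV, hp⟩
    refine ⟨hx, U - U₀, hU.sub hU₀, ?_, ?_, ?_, ?_⟩
    · rw [F_shift, add_sub_cancel, hF]
    · rwa [S_shift, add_sub_cancel]
    · rwa [S_shift, add_sub_cancel]
    · rw [sub_mulVec, hp]
  · rintro ⟨hx, U, hU, hF, hS, hV, hp⟩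
    rw [F_shift] at hF
    rw [S_shift] at hS hV
    exact ⟨hx, U₀ + U, hU₀.add hU, hF, hS, hV, by rw [add_mulVec, hp, add_sub_cancel]⟩

end MAData

/-! ### Normal forms deduced from degeneracy near a point. -/

theorem eq_zero_of_eventually_pow_mul {g : ℝ → ℝ} (hg : Continuous g) (k : ℕ)
    (h : ∀ᶠ t in 𝓝 (0 : ℝ), t ^ k * g t = 0) : g 0 = 0 := by
  have h1 : Tendsto g (𝓝[≠] 0) (𝓝 (g 0)) :=
    hg.continuousAt.tendsto.mono_left nhdsWithin_le_nhds
  refine tendsto_nhds_unique h1 (tendsto_const_nhds.congr' ?_)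
  filter_upwards [h.filter_mono nhdsWithin_le_nhds, self_mem_nhdsWithin] with t ht ht0
  exact ((mul_eq_zero.1 ht).resolve_left (pow_ne_zero k ht0)).symm

theorem eventually_curve {p : Mat3 → Prop} (hp : ∀ᶠ U in 𝓝 (0 : Mat3), p U)
    {γ : ℝ → Mat3} (hγ : ∀ i j, Continuous fun t => γ t i j) (h0 : γ 0 = 0) :
    ∀ᶠ t in 𝓝 (0 : ℝ), p (γ t) := by
  have h := (continuous_matrix hγ).tendsto 0
  rw [h0] at h
  exact h.eventually hp

namespace MAData

/-- Each missing coefficient is found by evaluating `det S = 0` along a curve on the equation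
through `0` and reading off the leading coefficient in `t`. -/
theorem eq_normTwo {N : MAData} (hb : N.b.IsSymm)
    (hc : N.c = !![0, 1 / 2, 0; 1 / 2, 0, 0; 0, 0, 0]) (hd : N.d = 0)
    (h : ∀ᶠ U in 𝓝 (0 : Mat3), U.IsSymm → N.F U = 0 → (N.S U).det = 0) :
    ∃ b₁ b₂ b₄ b₅, N = normTwo b₁ b₂ b₄ b₅ := by
  obtain ⟨a, b, c, d⟩ := N
  obtain ⟨b0, b1, b2, b3, b4, b5, rfl⟩ := symm_eq hb
  dsimp only at hc hd
  subst hc hd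
  have hb3 : b3 = 0 := by
    have h1 := eventually_curve (γ := fun t => !![t, 0, 0; 0, 0, 0; 0, 0, 0]) h
      (by intro i j; fin_cases i <;> fin_cases j <;> simp <;> fun_prop)
      (by ext i j; fin_cases i <;> fin_cases j <;> simp)
    refine eq_zero_of_eventually_pow_mul (g := fun _ => b3) continuous_const 1 ?_
    filter_upwards [h1] with t ht
    specialize ht (symm_mk ..)
      (by simp [F, det_fin_three, adjugate_fin_three, trace_fin_three])
    simp [S, cross, det_fin_three, adjugate_fin_three] at ht
    simp
    grind
  subst hb3
  have hb0 : b0 = 0 := by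
    have h1 := eventually_curve (γ := fun t => !![0, 0, 0; 0, t, 0; 0, 0, 0]) h
      (by intro i j; fin_cases i <;> fin_cases j <;> simp <;> fun_prop)
      (by ext i j; fin_cases i <;> fin_cases j <;> simp)
    refine eq_zero_of_eventually_pow_mul (g := fun _ => b0) continuous_const 1 ?_
    filter_upwards [h1] with t ht
    specialize ht (symm_mk ..)
      (by simp [F, det_fin_three, adjugate_fin_three, trace_fin_three])
    simp [S, cross, det_fin_three, adjugate_fin_three] at ht
    simp
    grind
  subst hb0
  have ha : a = 4 * b2 * b4 - 2 * b1 * b5 := by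
    -- The upper block has determinant exactly `t²`, and the off-diagonal entry `-b5 t²` cancels its
    -- contribution `b5 t²` to `F`.
    have h1 := eventually_curve (γ := fun t => !![t, -b5 * t ^ 2, 0;
        -b5 * t ^ 2, t * (1 + b5 ^ 2 * t ^ 2), 0; 0, 0, 0]) h
      (by intro i j; fin_cases i <;> fin_cases j <;> simp <;> fun_prop)
      (by ext i j; fin_cases i <;> fin_cases j <;> simp)
    have h2 := eq_zero_of_eventually_pow_mul (k := 2) (g := fun t =>
      (b5 * (t * (1 + b5 ^ 2 * t ^ 2))) * (b5 * t) * (a + 2 * b1 * b5)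
      + 2 * (1 / 2 + b5 * (b5 * t ^ 2)) * (-b4 * b5 * t - b2 * (1 + b5 ^ 2 * t ^ 2))
        * (-b2 * b5 * t - b4)
      - (b5 * (t * (1 + b5 ^ 2 * t ^ 2))) * (-b2 * b5 * t - b4) ^ 2
      - (b5 * t) * (-b4 * b5 * t - b2 * (1 + b5 ^ 2 * t ^ 2)) ^ 2
      - (a + 2 * b1 * b5) * (1 / 2 + b5 * (b5 * t ^ 2)) ^ 2) (by fun_prop) ?_
    · simp at h2
      linarith
    · filter_upwards [h1] with t ht
      specialize ht (symm_mk ..) (by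
        simp [F, det_fin_three, adjugate_fin_three, trace_fin_three]
        ring)
      rw [← ht]
      simp [S, cross, det_fin_three, adjugate_fin_three]
      ring
  subst ha
  exact ⟨b1, b2, b4, b5, by simp [normTwo]⟩

theorem eq_normOne {N : MAData} {s : ℝ} (hs : s ≠ 0) (hb : N.b.IsSymm)
    (hc : N.c = !![s, 0, 0; 0, 0, 0; 0, 0, 0]) (hd : N.d = 0)
    (h : ∀ᶠ U in 𝓝 (0 : Mat3), U.IsSymm → N.F U = 0 → adjugate (N.S U) = 0) :
    ∃ b₃ b₄ b₅, N = normOne s b₃ b₄ b₅ := by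
  obtain ⟨a, b, c, d⟩ := N
  obtain ⟨b0, b1, b2, b3, b4, b5, rfl⟩ := symm_eq hb
  dsimp only at hc hd
  subst hc hd
  have h1 := eventually_curve (γ := fun t => !![0, 0, 0; 0, t, 0; 0, 0, 0]) h
    (by intro i j; fin_cases i <;> fin_cases j <;> simp <;> fun_prop)
    (by ext i j; fin_cases i <;> fin_cases j <;> simp)
  have hb0 : b0 = 0 := by
    have h2 := eq_zero_of_eventually_pow_mul (k := 1)
      (g := fun t => (s + t * b5) * b0 - t * b2 ^ 2) (by fun_prop) ?_
    · simpa [hs] using h2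
    · filter_upwards [h1] with t ht
      specialize ht (symm_mk ..)
        (by simp [F, det_fin_three, adjugate_fin_three, trace_fin_three])
      have := congrFun (congrFun ht 1) 1
      simp [S, cross, adjugate_fin_three] at this
      linarith
  subst hb0
  have hb2 : b2 = 0 := by
    have h2 := eq_zero_of_eventually_pow_mul (k := 2) (g := fun t => b2 ^ 2) (by fun_prop) ?_
    · simpa using h2
    · filter_upwards [h1] with t ht
      specialize ht (symm_mk ..)
        (by simp [F, det_fin_three, adjugate_fin_three, trace_fin_three])
      have := congrFun (congrFun ht 1) 1
      simp [S, cross, adjugate_fin_three] at this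
      grind
  subst hb2
  have hb1 : b1 = 0 := by
    have h1 := eventually_curve (γ := fun t => !![0, 0, 0; 0, 0, 0; 0, 0, t]) h
      (by intro i j; fin_cases i <;> fin_cases j <;> simp <;> fun_prop)
      (by ext i j; fin_cases i <;> fin_cases j <;> simp)
    have h2 := eq_zero_of_eventually_pow_mul (k := 2) (g := fun t => b1 ^ 2) (by fun_prop) ?_
    · simpa using h2
    · filter_upwards [h1] with t ht
      specialize ht (symm_mk ..)
        (by simp [F, det_fin_three, adjugate_fin_three, trace_fin_three])
      have := congrFun (congrFun ht 2) 2
      simp [S, cross, adjugate_fin_three] at this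
      grind
  subst hb1
  have ha : a = (b3 * b5 - b4 ^ 2) / s := by
    -- The block determinant is `-t²`; the corner entry compensates `-b5 t²` so that the curve stays
    -- on the equation.
    have h1 := eventually_curve (γ := fun t => !![b5 * t ^ 2 / s, t, 0; t, 0, 0; 0, 0, 0]) h
      (by intro i j; fin_cases i <;> fin_cases j <;> simp <;> fun_prop)
      (by ext i j; fin_cases i <;> fin_cases j <;> simp)
    have h2 := eq_zero_of_eventually_pow_mul (k := 2)
      (g := fun t => s * (-a + b3 * b5 / s) - b4 ^ 2) (by fun_prop) ?_
    · field_simp at h2 ⊢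
      linarith
    · filter_upwards [h1] with t ht
      specialize ht (symm_mk ..) (by
        simp [F, det_fin_three, adjugate_fin_three, trace_fin_three]
        field_simp
        ring)
      have := congrFun (congrFun ht 1) 1
      simp [S, cross, adjugate_fin_three] at this
      field_simp at this ⊢
      linarith
  subst ha
  exact ⟨b3, b4, b5, by simp [normOne]⟩

end MAData

theorem det_eq_zero_of_rank_ne {S : Mat3} (h : S.rank ≠ 3) : S.det = 0 := by
  by_contra hd
  exact h (by simpa using rank_of_isUnit S ((isUnit_iff_isUnit_det S).2 (isUnit_iff_ne_zero.2 hd)))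

theorem adjugate_eq_zero_of_rank_eq_one {S : Mat3} (h : S.rank = 1) : adjugate S = 0 := by
  -- All columns are multiples of one vector, so the two by two minors vanish.
  obtain ⟨v, hv⟩ := finrank_le_one_iff.1 (le_of_eq h)
  have h1 : ∀ j, ∃ r : ℝ, ∀ i, S i j = r * v.1 i := by
    intro j
    obtain ⟨r, hr⟩ := hv ⟨S *ᵥ Pi.single j 1, _, rfl⟩
    refine ⟨r, fun i => ?_⟩
    have := congrFun (congrArg Subtype.val hr) i
    simpa using this.symm
  choose r hr using h1
  ext i j
  fin_cases i <;> fin_cases j <;> simp [adjugate_fin_three, hr] <;> ring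

theorem exists_right_inverse {f₀ f₁ f₂ : V3}
    (h : ∀ x : V3, x 0 • f₀ + x 1 • f₁ + x 2 • f₂ = 0 → x = 0) :
    ∃ P : Mat3, of ![f₀, f₁, f₂] * P = 1 := by
  have hd : (of ![f₀, f₁, f₂]).det ≠ 0 := by
    intro h0
    obtain ⟨x, hx, hx0⟩ := exists_vecMul_eq_zero_iff.2 h0
    refine hx (h x ?_)
    rw [← hx0]
    ext i
    simp [vecMul, dotProduct, Fin.sum_univ_three]
  exact ⟨_, mul_nonsing_inv _ (isUnit_iff_ne_zero.2 hd)⟩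

theorem bil_zero_right (S : Mat3) (x : V3) : bil S x 0 = 0 := by simp [bil]

theorem frame_mul_mul_transpose (S : Mat3) (f g k : V3) :
    of ![f, g, k] * S * (of ![f, g, k])ᵀ = !![bil S f f, bil S f g, bil S f k;
      bil S g f, bil S g g, bil S g k; bil S k f, bil S k g, bil S k k] := by
  ext i j
  rw [mul_mul_transpose_apply]
  fin_cases i <;> fin_cases j <;> rfl

/-- A frame adapted to an indefinite degenerate quadratic form. -/
theorem exists_frame_two {S : Mat3} (hS : S.IsSymm) (hdet : S.det = 0) {u v : V3}
    (hu : 0 < bil S u u) (hv : bil S v v < 0) :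
    ∃ Q P : Mat3, Q * P = 1 ∧ Q * S * Qᵀ = !![0, 1 / 2, 0; 1 / 2, 0, 0; 0, 0, 0] := by
  obtain ⟨k, hk, hSk⟩ := exists_mulVec_eq_zero_iff.2 hdet
  have hk' : ∀ x, bil S x k = 0 := fun x => by rw [bil, hSk, dotProduct_zero]
  have hk'' : ∀ x, bil S k x = 0 := fun x => by rw [bil_comm hS, hk']
  set A := bil S u u with hA
  set B := bil S u v with hB
  set C := bil S v v with hC
  have hvu : bil S v u = B := bil_comm hS v u
  have hΔ : 0 < B ^ 2 - A * C := by nlinarith [mul_pos hu (neg_pos.2 hv), sq_nonneg B]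
  obtain ⟨r, hr, hr2⟩ : ∃ r : ℝ, 0 < r ∧ r ^ 2 = B ^ 2 - A * C :=
    ⟨√(B ^ 2 - A * C), Real.sqrt_pos.2 hΔ, Real.sq_sqrt hΔ.le⟩
  have hC0 : C ≠ 0 := hv.ne
  -- The two null directions in the span of `u, v`: the roots of `A + 2Bs + Cs²`. Together with a
  -- kernel vector `k` they form the frame.
  set x := u + ((-B + r) / C) • v with hx
  set y := u + ((-B - r) / C) • v with hy
  have hexp : ∀ s t : ℝ, bil S (u + s • v) (u + t • v) = A + (s + t) * B + s * t * C := by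
    intro s t
    simp only [bil_add_left, bil_add_right, bil_smul_left, bil_smul_right, hvu, ← hA, ← hB, ← hC]
    ring
  have hxx : bil S x x = 0 := by
    rw [hx, hexp]
    field_simp
    linear_combination hr2
  have hyy : bil S y y = 0 := by
    rw [hy, hexp]
    field_simp
    linear_combination hr2
  have hxy : bil S x y * C = -2 * r ^ 2 := by
    rw [hx, hy, hexp]
    field_simp
    linear_combination 1 * hr2
  have hxy0 : bil S x y ≠ 0 := by
    intro h
    rw [h, zero_mul] at hxy
    have := pow_pos hr 2
    linarith
  set f := (2 * bil S x y)⁻¹ • x with hf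
  have hff : bil S f f = 0 := by rw [hf, bil_smul_left, bil_smul_right, hxx]; simp
  have hfy : bil S f y = 1 / 2 := by
    rw [hf, bil_smul_left]
    field_simp
  clear_value f
  have hyf : bil S y f = 1 / 2 := by rw [bil_comm hS, hfy]
  obtain ⟨P, hP⟩ := exists_right_inverse (f₀ := f) (f₁ := y) (f₂ := k) fun c hc => by
    have h1 := bil_zero_right S f
    have h0 := bil_zero_right S y
    rw [← hc, bil_add_right, bil_add_right, bil_smul_right, bil_smul_right, bil_smul_right,
      hk'] at h0 h1
    rw [hff, hfy] at h1
    rw [hyy, hyf] at h0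
    have e0 : c 0 = 0 := by linarith
    have e1 : c 1 = 0 := by linarith
    have e2 : c 2 = 0 := by simpa [e0, e1, hk] using hc
    ext i
    fin_cases i <;> assumption
  exact ⟨_, P, hP, by rw [frame_mul_mul_transpose, hff, hyy, hk', hk', hk', hk'', hk'', hfy, hyf]⟩

/-- A frame adapted to a quadratic form of rank one. -/
theorem exists_frame_one {S : Mat3} (hS : S.IsSymm) (h0 : S ≠ 0) (hadj : adjugate S = 0) :
    ∃ s : ℝ, s ≠ 0 ∧ ∃ Q P : Mat3, Q * P = 1 ∧ Q * S * Qᵀ = !![s, 0, 0; 0, 0, 0; 0, 0, 0] := by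
  obtain ⟨f, hf⟩ : ∃ f, bil S f f ≠ 0 := by
    by_contra! h
    refine h0 (mat_eq_zero_of_bil fun x y => ?_)
    have h1 := h (x + y)
    rw [bil_add_left, bil_add_right, bil_add_right, h, h, bil_comm hS y x] at h1
    linarith
  have hgram : ∀ x y, bil S x x * bil S y y = bil S x y ^ 2 := fun x y => by
    have h1 := bil_adjugate_cross hS x y
    rw [hadj] at h1
    simp [bil] at h1 ⊢
    linarith
  have hSf : S *ᵥ f ≠ 0 := fun h => hf (by rw [bil, h, dotProduct_zero])
  -- `m, n` span the `S`-orthogonal of `f`; since all Gram determinants of pairs vanish, `S` is zero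
  -- on it.
  obtain ⟨m, n, hm, hn, hli, -⟩ := exists_cross_eq hSf
  change bil S m f = 0 at hm
  change bil S n f = 0 at hn
  have hm' : bil S f m = 0 := by rw [bil_comm hS, hm]
  have hn' : bil S f n = 0 := by rw [bil_comm hS, hn]
  have hmm : bil S m m = 0 := by
    have h1 := hgram f m
    rw [hm'] at h1
    simpa [hf] using h1
  have hnn : bil S n n = 0 := by
    have h1 := hgram f n
    rw [hn'] at h1
    simpa [hf] using h1
  have hmn : bil S m n = 0 := by
    have h1 := hgram m n
    rw [hmm, zero_mul] at h1
    exact eq_zero_of_pow_eq_zero h1.symm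
  have hnm : bil S n m = 0 := by rw [bil_comm hS, hmn]
  obtain ⟨P, hP⟩ := exists_right_inverse (f₀ := f) (f₁ := m) (f₂ := n) fun c hc => by
    have h1 := bil_zero_right S f
    rw [← hc, bil_add_right, bil_add_right, bil_smul_right, bil_smul_right, bil_smul_right,
      hm', hn'] at h1
    have e0 : c 0 = 0 := by simpa [hf] using h1
    rw [e0, zero_smul, zero_add] at hc
    obtain ⟨e1, e2⟩ := LinearIndependent.pair_iff.1 hli _ _ hc
    ext i
    fin_cases i <;> assumption
  exact ⟨_, hf, _, P, hP, by rw [frame_mul_mul_transpose, hm, hn, hm', hn', hmm, hnn, hmn, hnm]⟩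

theorem tendsto_conj (U₀ Q : Mat3) :
    Tendsto (fun U : Mat3 => U₀ + Qᵀ * U * Q) (𝓝 0) (𝓝 U₀) := by
  have h : Continuous fun U : Mat3 => U₀ + Qᵀ * U * Q := by fun_prop
  simpa using h.tendsto 0

theorem conj_isSymm {U : Mat3} (hU : U.IsSymm) (Q : Mat3) : (Qᵀ * U * Q).IsSymm := by
  rw [IsSymm, transpose_mul, transpose_mul, transpose_transpose, hU.eq, Matrix.mul_assoc]

namespace MAData

theorem F_pull_shift (M : MAData) {Q P : Mat3} (h : Q * P = 1) (U₀ U : Mat3) :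
    ((M.shift U₀).pull Q P).F U = M.F (U₀ + Qᵀ * U * Q) := by rw [F_pull _ h, F_shift]

theorem S_pull_shift (M : MAData) {Q P : Mat3} (h : Q * P = 1) (U₀ U : Mat3) :
    ((M.shift U₀).pull Q P).S U = Q * M.S (U₀ + Qᵀ * U * Q) * Qᵀ := by rw [S_pull _ h, S_shift]

theorem pull_shift_b_isSymm {M : MAData} (hb : M.b.IsSymm) {U₀ : Mat3} (hU₀ : U₀.IsSymm)
    (Q P : Mat3) : ((M.shift U₀).pull Q P).b.IsSymm :=
  (conj_isSymm (M.T_isSymm hb hU₀) P).smul _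

theorem exists_eq_normTwo {M : MAData} (hb : M.b.IsSymm) (hc : M.c.IsSymm) {U₀ : Mat3}
    (hU₀ : U₀.IsSymm) (hF : M.F U₀ = 0)
    (h : ∀ᶠ U in 𝓝 U₀, U.IsSymm → M.F U = 0 → (M.S U).det = 0) {u v : V3}
    (hu : 0 < bil (M.S U₀) u u) (hv : bil (M.S U₀) v v < 0) :
    ∃ Q P : Mat3, Q * P = 1 ∧ ∃ b₁ b₂ b₄ b₅, (M.shift U₀).pull Q P = normTwo b₁ b₂ b₄ b₅ := by
  obtain ⟨Q, P, hQP, hS⟩ :=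
    exists_frame_two (M.S_isSymm hb hc hU₀) (h.self_of_nhds hU₀ hF) hu hv
  refine ⟨Q, P, hQP, eq_normTwo (pull_shift_b_isSymm hb hU₀ Q P) hS hF ?_⟩
  filter_upwards [(tendsto_conj U₀ Q).eventually h] with U hU hUs hUF
  rw [F_pull_shift _ hQP] at hUF
  rw [S_pull_shift _ hQP, det_mul, det_mul, hU (hU₀.add (conj_isSymm hUs Q)) hUF, mul_zero,
    zero_mul]

theorem exists_eq_normOne {M : MAData} (hb : M.b.IsSymm) (hc : M.c.IsSymm) {U₀ : Mat3}
    (hU₀ : U₀.IsSymm) (hF : M.F U₀ = 0)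
    (h : ∀ᶠ U in 𝓝 U₀, U.IsSymm → M.F U = 0 → adjugate (M.S U) = 0) (h0 : M.S U₀ ≠ 0) :
    ∃ Q P : Mat3, Q * P = 1 ∧ ∃ s, s ≠ 0 ∧ ∃ b₃ b₄ b₅,
      (M.shift U₀).pull Q P = normOne s b₃ b₄ b₅ := by
  obtain ⟨s, hs, Q, P, hQP, hS⟩ :=
    exists_frame_one (M.S_isSymm hb hc hU₀) h0 (h.self_of_nhds hU₀ hF)
  refine ⟨Q, P, hQP, s, hs, eq_normOne hs (pull_shift_b_isSymm hb hU₀ Q P) hS hF ?_⟩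
  filter_upwards [(tendsto_conj U₀ Q).eventually h] with U hU hUs hUF
  rw [F_pull_shift _ hQP] at hUF
  rw [S_pull_shift _ hQP, adjugate_mul_distrib, adjugate_mul_distrib,
    hU (hU₀.add (conj_isSymm hUs Q)) hUF, Matrix.zero_mul, Matrix.mul_zero]

/-- Carries degeneracy on the whole fibre from the normal form back to the original equation, which
was assumed degenerate only locally. -/
theorem det_S_of_pull {M : MAData} {Q P : Mat3} (hQP : Q * P = 1) {U₀ : Mat3} (hU₀ : U₀.IsSymm)
    (h : ∀ U : Mat3, U.IsSymm → ((M.shift U₀).pull Q P).F U = 0 →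
      (((M.shift U₀).pull Q P).S U).det = 0)
    {U : Mat3} (hU : U.IsSymm) (hF : M.F U = 0) : (M.S U).det = 0 := by
  have hdet : Q.det ≠ 0 := by
    intro h0
    have h1 := congrArg det hQP
    simp [h0] at h1
  have hc : U₀ + Qᵀ * (Pᵀ * (U - U₀) * P) * Q = U := by
    rw [conj_conj (mul_eq_one_comm.1 hQP), add_sub_cancel]
  have h1 := h (Pᵀ * (U - U₀) * P) (conj_isSymm (hU.sub hU₀) P) (by rw [F_pull_shift _ hQP, hc, hF])
  rw [S_pull_shift _ hQP, hc, det_mul, det_mul, det_transpose] at h1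
  simpa [hdet] using h1

end MAData

/-! ### Symplectic changes of coordinates. -/

/-- The symplectic form in the coordinates `(x, p)`. -/
def sympVV (v w : V3 × V3) : ℝ := v.1 ⬝ᵥ w.2 - v.2 ⬝ᵥ w.1

theorem symp_lift (θ : J1) (v w : V3 × V3) : symp (lift θ v) (lift θ w) = sympVV v w := by
  simp only [symp, sympVV, dotProduct, lift, LinearMap.coe_mk, AddHom.coe_mk, Fin.sum_univ_three]
  ring

theorem dotProduct_mulVec_comm {S : Mat3} (hS : S.IsSymm) (x y : V3) :
    x ⬝ᵥ (S *ᵥ y) = (S *ᵥ x) ⬝ᵥ y := by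
  rw [dotProduct_comm (S *ᵥ x)]
  exact bil_comm hS x y

/-- The change of coordinates by a translation of the Hessian and a linear frame. -/
def frameEquiv (U₀ Q P : Mat3) (h : Q * P = 1) : (V3 × V3) ≃ₗ[ℝ] (V3 × V3) where
  toFun v := (Q *ᵥ v.1, Pᵀ *ᵥ (v.2 - U₀ *ᵥ v.1))
  invFun w := (P *ᵥ w.1, Qᵀ *ᵥ w.2 + U₀ *ᵥ (P *ᵥ w.1))
  map_add' v w := by
    simp only [Prod.fst_add, Prod.snd_add, mulVec_add, Prod.mk_add_mk, mulVec_sub]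
    congr 1
    abel
  map_smul' c v := by
    simp only [Prod.smul_fst, Prod.smul_snd, mulVec_smul, Prod.smul_mk, mulVec_sub, smul_sub,
      RingHom.id_apply]
  left_inv v := by
    have hPQ : P * Q = 1 := mul_eq_one_comm.1 h
    have hT : Qᵀ * Pᵀ = 1 := by rw [← transpose_mul, hPQ, transpose_one]
    simp only [mulVec_mulVec, hPQ, hT, one_mulVec, sub_add_cancel]
  right_inv w := by
    have hT' : Pᵀ * Qᵀ = 1 := by rw [← transpose_mul, h, transpose_one]
    simp only [add_sub_cancel_right, mulVec_mulVec, h, hT', one_mulVec]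

/-- The shear as a linear equivalence. -/
def shearEquiv (X : Mat3) : (V3 × V3) ≃ₗ[ℝ] (V3 × V3) where
  toFun := shear X
  invFun w := (w.1 + X *ᵥ w.2, w.2)
  map_add' v w := by
    simp only [shear, Prod.fst_add, Prod.snd_add, mulVec_add, Prod.mk_add_mk]
    congr 1
    abel
  map_smul' c v := by
    simp only [shear, Prod.smul_fst, Prod.smul_snd, mulVec_smul, Prod.smul_mk, smul_sub,
      RingHom.id_apply]
  left_inv v := by simp [shear]
  right_inv w := by simp [shear]

theorem sympVV_frameEquiv {U₀ Q P : Mat3} (hU₀ : U₀.IsSymm) (h : Q * P = 1) (v w : V3 × V3) :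
    sympVV (frameEquiv U₀ Q P h v) (frameEquiv U₀ Q P h w) = sympVV v w := by
  have hPQ : P * Q = 1 := mul_eq_one_comm.1 h
  have hdot : ∀ x y, (Pᵀ *ᵥ x) ⬝ᵥ (Q *ᵥ y) = x ⬝ᵥ y := fun x y => by
    rw [mulVec_transpose, ← dotProduct_mulVec, mulVec_mulVec, hPQ, one_mulVec]
  change (Q *ᵥ v.1) ⬝ᵥ (Pᵀ *ᵥ (w.2 - U₀ *ᵥ w.1)) - (Pᵀ *ᵥ (v.2 - U₀ *ᵥ v.1)) ⬝ᵥ (Q *ᵥ w.1) = _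
  rw [dotProduct_comm (Q *ᵥ v.1), hdot, hdot, dotProduct_comm _ v.1, dotProduct_sub,
    sub_dotProduct, dotProduct_mulVec_comm hU₀, sympVV]
  ring

theorem sympVV_shearEquiv {X : Mat3} (hX : X.IsSymm) (v w : V3 × V3) :
    sympVV (shearEquiv X v) (shearEquiv X w) = sympVV v w := by
  change (v.1 - X *ᵥ v.2) ⬝ᵥ w.2 - v.2 ⬝ᵥ (w.1 - X *ᵥ w.2) = _
  rw [sub_dotProduct, dotProduct_sub, dotProduct_mulVec_comm hX, sympVV]
  ring

theorem preimage_closure_linearEquiv (e : (V3 × V3) ≃ₗ[ℝ] (V3 × V3)) (s : Set (V3 × V3)) :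
    e ⁻¹' closure s = closure (e ⁻¹' s) :=
  e.toContinuousLinearEquiv.toHomeomorph.preimage_closure s

/-! ### Coordinate subspaces -/

/-- The coordinate subspace `x₁ = x₂ = p₁ = 0`. -/
def subOne : Submodule ℝ (V3 × V3) where
  carrier := MAData.planeOne
  zero_mem' := ⟨rfl, rfl, rfl⟩
  add_mem' := by
    rintro v w ⟨h1, h2, h3⟩ ⟨k1, k2, k3⟩
    exact ⟨by simp [h1, k1], by simp [h2, k2], by simp [h3, k3]⟩
  smul_mem' := by
    rintro c v ⟨h1, h2, h3⟩
    exact ⟨by simp [h1], by simp [h2], by simp [h3]⟩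

/-- The coordinate subspace `x₀ = x₂ = p₀ = 0`. -/
def subTwo : Submodule ℝ (V3 × V3) where
  carrier := MAData.planeTwo
  zero_mem' := ⟨rfl, rfl, rfl⟩
  add_mem' := by
    rintro v w ⟨h1, h2, h3⟩ ⟨k1, k2, k3⟩
    exact ⟨by simp [h1, k1], by simp [h2, k2], by simp [h3, k3]⟩
  smul_mem' := by
    rintro c v ⟨h1, h2, h3⟩
    exact ⟨by simp [h1], by simp [h2], by simp [h3]⟩

/-- The coordinate subspace `x₁ = x₂ = p₀ = 0`. -/
def subLag : Submodule ℝ (V3 × V3) where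
  carrier := MAData.planeLag
  zero_mem' := ⟨rfl, rfl, rfl⟩
  add_mem' := by
    rintro v w ⟨h1, h2, h3⟩ ⟨k1, k2, k3⟩
    exact ⟨by simp [h1, k1], by simp [h2, k2], by simp [h3, k3]⟩
  smul_mem' := by
    rintro c v ⟨h1, h2, h3⟩
    exact ⟨by simp [h1], by simp [h2], by simp [h3]⟩

theorem finrank_subOne : Module.finrank ℝ subOne = 3 := by
  let e : subOne ≃ₗ[ℝ] V3 :=
    { toFun := fun v => ![v.1.1 0, v.1.2 0, v.1.2 2]
      invFun := fun c => ⟨(![c 0, 0, 0], ![c 1, 0, c 2]), rfl, rfl, rfl⟩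
      map_add' := fun v w => by ext i; fin_cases i <;> rfl
      map_smul' := fun c v => by ext i; fin_cases i <;> rfl
      left_inv := by
        rintro ⟨v, h1, h2, h3⟩
        refine Subtype.ext (Prod.ext ?_ ?_) <;> ext i <;> fin_cases i <;> simp [h1, h2, h3]
      right_inv := fun c => by ext i; fin_cases i <;> rfl }
  rw [e.finrank_eq, Module.finrank_fin_fun]

theorem finrank_subTwo : Module.finrank ℝ subTwo = 3 := by
  let e : subTwo ≃ₗ[ℝ] V3 :=
    { toFun := fun v => ![v.1.1 1, v.1.2 1, v.1.2 2]
      invFun := fun c => ⟨(![0, c 0, 0], ![0, c 1, c 2]), rfl, rfl, rfl⟩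
      map_add' := fun v w => by ext i; fin_cases i <;> rfl
      map_smul' := fun c v => by ext i; fin_cases i <;> rfl
      left_inv := by
        rintro ⟨v, h1, h2, h3⟩
        refine Subtype.ext (Prod.ext ?_ ?_) <;> ext i <;> fin_cases i <;> simp [h1, h2, h3]
      right_inv := fun c => by ext i; fin_cases i <;> rfl }
  rw [e.finrank_eq, Module.finrank_fin_fun]

theorem finrank_subLag : Module.finrank ℝ subLag = 3 := by
  let e : subLag ≃ₗ[ℝ] V3 :=
    { toFun := fun v => ![v.1.1 0, v.1.2 1, v.1.2 2]
      invFun := fun c => ⟨(![c 0, 0, 0], ![0, c 1, c 2]), rfl, rfl, rfl⟩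
      map_add' := fun v w => by ext i; fin_cases i <;> rfl
      map_smul' := fun c v => by ext i; fin_cases i <;> rfl
      left_inv := by
        rintro ⟨v, h1, h2, h3⟩
        refine Subtype.ext (Prod.ext ?_ ?_) <;> ext i <;> fin_cases i <;> simp [h1, h2, h3]
      right_inv := fun c => by ext i; fin_cases i <;> rfl }
  rw [e.finrank_eq, Module.finrank_fin_fun]

theorem mem_subTwo_iff {v : V3 × V3} : v ∈ subTwo ↔ ∀ w ∈ subOne, sympVV v w = 0 := by
  constructor
  · rintro ⟨h1, h2, h3⟩ w ⟨k1, k2, k3⟩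
    simp [sympVV, dotProduct, Fin.sum_univ_three, h1, h2, h3, k1, k2, k3]
  · intro h
    have h1 := h (0, ![1, 0, 0]) ⟨rfl, rfl, rfl⟩
    have h2 := h (0, ![0, 0, 1]) ⟨rfl, rfl, rfl⟩
    have h3 := h (![1, 0, 0], 0) ⟨rfl, rfl, rfl⟩
    simp [sympVV, dotProduct, Fin.sum_univ_three] at h1 h2 h3
    exact ⟨h1, h2, h3⟩

theorem subOne_ne_subTwo : subOne ≠ subTwo := by
  intro h
  have h1 : ((![1, 0, 0], 0) : V3 × V3) ∈ subOne := ⟨rfl, rfl, rfl⟩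
  rw [h] at h1
  exact one_ne_zero h1.1

theorem mem_sup_iff {v : V3 × V3} : v ∈ subOne ⊔ subTwo ↔ v.1 2 = 0 := by
  rw [Submodule.mem_sup]
  constructor
  · rintro ⟨y, hy, z, hz, rfl⟩
    simp [hy.2.1, hz.2.1]
  · intro h
    refine ⟨(![v.1 0, 0, 0], ![v.2 0, 0, v.2 2]), ⟨rfl, rfl, rfl⟩,
      (![0, v.1 1, 0], ![0, v.2 1, 0]), ⟨rfl, rfl, rfl⟩, Prod.ext ?_ ?_⟩ <;> ext i <;>
      fin_cases i <;> simp [h]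

theorem subLag_isotropic {v w : V3 × V3} (hv : v ∈ subLag) (hw : w ∈ subLag) :
    sympVV v w = 0 := by
  obtain ⟨h1, h2, h3⟩ := hv
  obtain ⟨k1, k2, k3⟩ := hw
  simp [sympVV, dotProduct, Fin.sum_univ_three, h1, h2, h3, k1, k2, k3]

/-! ### Transfer to the contact plane and conclusion. -/

/-- The parametrization of the contact plane by adapted coordinates. -/
def chart (θ : J1) (φ : (V3 × V3) ≃ₗ[ℝ] (V3 × V3)) : V3 × V3 →ₗ[ℝ] J1 :=
  lift θ ∘ₗ φ.symm.toLinearMap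

section Chart

variable {θ : J1} {φ : (V3 × V3) ≃ₗ[ℝ] (V3 × V3)}

theorem chart_injective : Function.Injective (chart θ φ) :=
  (lift_injective θ).comp φ.symm.injective

theorem chart_image (A : Set (V3 × V3)) : chart θ φ '' A = lift θ '' (φ ⁻¹' A) := by
  rw [← LinearEquiv.image_symm_eq_preimage, ← image_comp]
  rfl

theorem symp_chart (hφ : ∀ v w, sympVV (φ v) (φ w) = sympVV v w) (v w : V3 × V3) :
    symp (chart θ φ v) (chart θ φ w) = sympVV v w := by
  change symp (lift θ (φ.symm v)) (lift θ (φ.symm w)) = _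
  rw [symp_lift, ← hφ, φ.apply_symm_apply, φ.apply_symm_apply]

theorem map_chart_le (D : Submodule ℝ (V3 × V3)) : D.map (chart θ φ) ≤ contactPlane θ := by
  rintro _ ⟨v, -, rfl⟩
  exact lift_mem θ _

theorem exists_chart_eq {v : J1} (hv : v ∈ contactPlane θ) : ∃ w, chart θ φ w = v := by
  refine ⟨φ (v.1, v.2.2), ?_⟩
  change lift θ (φ.symm (φ _)) = v
  rw [φ.symm_apply_apply]
  exact (mem_contactPlane_iff.1 hv).symm

theorem finrank_map_chart (D : Submodule ℝ (V3 × V3)) :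
    Module.finrank ℝ (D.map (chart θ φ)) = Module.finrank ℝ D :=
  (Submodule.equivMapOfInjective _ chart_injective D).finrank_eq.symm

theorem sympOrth_map_chart (hφ : ∀ v w, sympVV (φ v) (φ w) = sympVV v w) :
    sympOrth θ (subOne.map (chart θ φ)) = subTwo.map (chart θ φ) := by
  ext v
  constructor
  · rintro ⟨hv, h⟩
    obtain ⟨v, rfl⟩ := exists_chart_eq (φ := φ) hv
    refine ⟨v, mem_subTwo_iff.2 fun w hw => ?_, rfl⟩
    rw [← symp_chart hφ]
    exact h _ ⟨w, hw, rfl⟩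
  · rintro ⟨v, hv, rfl⟩
    refine ⟨lift_mem θ _, ?_⟩
    rintro _ ⟨w, hw, rfl⟩
    rw [symp_chart hφ]
    exact mem_subTwo_iff.1 hv w hw

theorem isLagrangian_map_chart (hφ : ∀ v w, sympVV (φ v) (φ w) = sympVV v w) :
    IsLagrangian θ (subLag.map (chart θ φ)) := by
  refine ⟨map_chart_le _, by rw [finrank_map_chart, finrank_subLag], ?_⟩
  rintro _ ⟨v, hv, rfl⟩ _ ⟨w, hw, rfl⟩
  rw [symp_chart hφ]
  exact subLag_isotropic hv hw

end Chart

namespace MAData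

theorem preimage_degCone_pull {M : MAData} {U₀ Q P : Mat3} (hU₀ : U₀.IsSymm) (h : Q * P = 1) :
    closure M.degCone = frameEquiv U₀ Q P h ⁻¹' closure ((M.shift U₀).pull Q P).degCone := by
  rw [preimage_closure_linearEquiv]
  congr 1
  ext v
  rw [mem_degCone_shift hU₀, mem_degCone_pull h]
  rfl

theorem kap_frameEquiv {M : MAData} (hb : M.b.IsSymm) (hc : M.c.IsSymm) {U₀ Q P : Mat3}
    (hU₀ : U₀.IsSymm) (h : Q * P = 1) (v : V3 × V3) : M.kap v.1 v.2 = 0 ↔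
      ((M.shift U₀).pull Q P).kap (frameEquiv U₀ Q P h v).1 (frameEquiv U₀ Q P h v).2 = 0 := by
  have hdet : Q.det ≠ 0 := by
    intro h0
    have h1 := congrArg det h
    simp [h0] at h1
  change _ ↔ ((M.shift U₀).pull Q P).kap (Q *ᵥ v.1) (Pᵀ *ᵥ (v.2 - U₀ *ᵥ v.1)) = 0
  rw [kap_pull _ h, kap_shift _ hb hc hU₀, sub_add_cancel]
  simp [hdet]

theorem closure_cone_eq_of_pull {M : MAData} (hb : M.b.IsSymm) (hc : M.c.IsSymm)
    {U₀ Q P : Mat3} (hU₀ : U₀.IsSymm) (h : Q * P = 1)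
    (hdet : ∀ U : Mat3, U.IsSymm → ((M.shift U₀).pull Q P).F U = 0 →
      (((M.shift U₀).pull Q P).S U).det = 0)
    (h0 : 0 ∈ closure ((M.shift U₀).pull Q P).degCone) :
    closure M.cone = frameEquiv U₀ Q P h ⁻¹' closure ((M.shift U₀).pull Q P).degCone := by
  rw [← preimage_degCone_pull hU₀ h]
  refine closure_cone_eq hb hc (fun U hU hF => det_S_of_pull h hU₀ hdet hU hF) ?_
  rw [preimage_degCone_pull hU₀ h]
  simpa using h0

theorem shearTwo_isSymm (b₁ b₂ b₄ b₅ : ℝ) : (shearTwo b₁ b₂ b₄ b₅).IsSymm := symm_mk ..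

theorem shearOne_isSymm (s b₃ b₄ b₅ : ℝ) : (shearOne s b₃ b₄ b₅).IsSymm := symm_mk ..

/-- The chart composes translation to `U₀`, the adapted frame and the shear, all symplectic. In it
`kap` is a nonzero multiple of the square of the coordinate `x₂`, whose zero hyperplane is the sum
of the two planes. -/
theorem exists_chart_two {M : MAData} (hb : M.b.IsSymm) (hc : M.c.IsSymm) {U₀ : Mat3}
    (hU₀ : U₀.IsSymm) (hF : M.F U₀ = 0)
    (h : ∀ᶠ U in 𝓝 U₀, U.IsSymm → M.F U = 0 → (M.S U).det = 0) {u v : V3}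
    (hu : 0 < bil (M.S U₀) u u) (hv : bil (M.S U₀) v v < 0) :
    ∃ φ : (V3 × V3) ≃ₗ[ℝ] (V3 × V3), (∀ v w, sympVV (φ v) (φ w) = sympVV v w) ∧
      closure M.cone = φ ⁻¹' (subOne ∪ subTwo) ∧
      {v | M.kap v.1 v.2 = 0} = φ ⁻¹' ((subOne ⊔ subTwo : Submodule ℝ (V3 × V3)) : Set _) := by
  obtain ⟨Q, P, hQP, b₁, b₂, b₄, b₅, hN⟩ := exists_eq_normTwo hb hc hU₀ hF h hu hv
  refine ⟨(frameEquiv U₀ Q P hQP).trans (shearEquiv (shearTwo b₁ b₂ b₄ b₅)), fun v w => ?_, ?_, ?_⟩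
  · rw [LinearEquiv.trans_apply, LinearEquiv.trans_apply,
      sympVV_shearEquiv (shearTwo_isSymm ..), sympVV_frameEquiv hU₀]
  · rw [closure_cone_eq_of_pull hb hc hU₀ hQP, hN, closure_degCone_normTwo]
    · rfl
    · rw [hN]
      exact fun U hU hF => det_S_normTwo _ _ _ _ hU hF
    · rw [hN, closure_degCone_normTwo, mem_preimage]
      have : shear (shearTwo b₁ b₂ b₄ b₅) 0 = 0 := map_zero (shearEquiv _)
      rw [this]
      exact Or.inl subOne.zero_mem
  · ext v
    rw [mem_ofPred_eq, kap_frameEquiv hb hc hU₀ hQP, hN, kap_normTwo, mem_preimage, SetLike.mem_coe,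
      mem_sup_iff]
    change _ ↔ ((frameEquiv U₀ Q P hQP v).1 - shearTwo b₁ b₂ b₄ b₅ *ᵥ (frameEquiv U₀ Q P hQP v).2) 2
      = 0
    simp

theorem exists_chart_one {M : MAData} (hb : M.b.IsSymm) (hc : M.c.IsSymm) {U₀ : Mat3}
    (hU₀ : U₀.IsSymm) (hF : M.F U₀ = 0)
    (h : ∀ᶠ U in 𝓝 U₀, U.IsSymm → M.F U = 0 → adjugate (M.S U) = 0) (h0 : M.S U₀ ≠ 0) :
    ∃ φ : (V3 × V3) ≃ₗ[ℝ] (V3 × V3), (∀ v w, sympVV (φ v) (φ w) = sympVV v w) ∧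
      closure M.cone = φ ⁻¹' subLag ∧ ∀ v : V3 × V3, M.kap v.1 v.2 = 0 := by
  obtain ⟨Q, P, hQP, s, hs, b₃, b₄, b₅, hN⟩ := exists_eq_normOne hb hc hU₀ hF h h0
  refine ⟨(frameEquiv U₀ Q P hQP).trans (shearEquiv (shearOne s b₃ b₄ b₅)), fun v w => ?_, ?_, ?_⟩
  · rw [LinearEquiv.trans_apply, LinearEquiv.trans_apply,
      sympVV_shearEquiv (shearOne_isSymm ..), sympVV_frameEquiv hU₀]
  · rw [closure_cone_eq_of_pull hb hc hU₀ hQP, hN, closure_degCone_normOne hs]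
    · rfl
    · rw [hN]
      exact fun U hU hF => det_S_normOne hs hU hF
    · rw [hN, closure_degCone_normOne hs, mem_preimage]
      have : shear (shearOne s b₃ b₄ b₅) 0 = 0 := map_zero (shearEquiv _)
      rw [this]
      exact subLag.zero_mem
  · intro v
    rw [kap_frameEquiv hb hc hU₀ hQP, hN, kap_normOne hs]

end MAData

theorem contactCone_of_rank_two (E : MongeAmpere) (θ : J1) {U₀ : Mat3} (hU₀ : U₀ ∈ fiber E.F θ)
    (h : ∀ᶠ U in 𝓝 U₀, U ∈ fiber E.F θ → (E.symbol θ U).rank = 2)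
    (hyp : IsHyperbolic (E.symbol θ U₀)) :
    ∃ D : Submodule ℝ J1, D ≤ contactPlane θ ∧ Module.finrank ℝ D = 3 ∧
      Module.finrank ℝ (sympOrth θ D) = 3 ∧ D ≠ sympOrth θ D ∧
      contactCone E.F θ = (D : Set J1) ∪ (sympOrth θ D : Set J1) ∧
      E.cochar θ = (Submodule.span ℝ ((D : Set J1) ∪ (sympOrth θ D : Set J1)) : Set J1) := by
  obtain ⟨⟨u, hu⟩, v, hv⟩ := hyp
  rw [MongeAmpere.symbol, E.symbol_eq θ hU₀.1, quadForm_eq] at hu hv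
  obtain ⟨φ, hφ, h1, h2⟩ := MAData.exists_chart_two (E.data_b_isSymm θ) (E.data_c_isSymm θ)
    hU₀.1 (by rw [← E.F_eq θ hU₀.1]; exact hU₀.2) (by
      filter_upwards [h] with U hU hUs hUF
      rw [← E.symbol_eq θ hUs]
      apply det_eq_zero_of_rank_ne
      have := hU ⟨hUs, by rw [E.F_eq θ hUs]; exact hUF⟩
      rw [MongeAmpere.symbol] at this
      omega) hu hv
  have ho := sympOrth_map_chart (θ := θ) hφ
  refine ⟨subOne.map (chart θ φ), map_chart_le _, ?_, ?_, ?_, ?_, ?_⟩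
  · rw [finrank_map_chart, finrank_subOne]
  · rw [ho, finrank_map_chart, finrank_subTwo]
  · rw [ho]
    exact fun h => subOne_ne_subTwo (Submodule.map_injective_of_injective chart_injective h)
  · rw [ho, contactCone_eq, h1, ← chart_image, image_union]
    rfl
  · rw [ho, cochar_eq, h2, ← chart_image, Submodule.span_union, Submodule.span_eq,
      Submodule.span_eq, ← Submodule.map_sup]
    rfl

theorem contactCone_of_rank_one (E : MongeAmpere) (θ : J1) {U₀ : Mat3} (hU₀ : U₀ ∈ fiber E.F θ)
    (hreg : E.symbol θ U₀ ≠ 0)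
    (h : ∀ᶠ U in 𝓝 U₀, U ∈ fiber E.F θ → (E.symbol θ U).rank = 1) :
    (∃ D : Submodule ℝ J1, IsLagrangian θ D ∧ contactCone E.F θ = (D : Set J1)) ∧
      E.cochar θ = (contactPlane θ : Set J1) := by
  rw [MongeAmpere.symbol, E.symbol_eq θ hU₀.1] at hreg
  obtain ⟨φ, hφ, h1, h2⟩ := MAData.exists_chart_one (E.data_b_isSymm θ) (E.data_c_isSymm θ)
    hU₀.1 (by rw [← E.F_eq θ hU₀.1]; exact hU₀.2) (by
      filter_upwards [h] with U hU hUs hUF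
      rw [← E.symbol_eq θ hUs]
      exact adjugate_eq_zero_of_rank_eq_one (hU ⟨hUs, by rw [E.F_eq θ hUs]; exact hUF⟩)) hreg
  refine ⟨⟨subLag.map (chart θ φ), isLagrangian_map_chart hφ, ?_⟩, ?_⟩
  · rw [contactCone_eq, h1, ← chart_image]
    rfl
  · ext v
    rw [cochar_eq]
    simp only [h2, mem_image, mem_ofPred_eq, true_and, SetLike.mem_coe]
    constructor
    · rintro ⟨w, rfl⟩
      exact lift_mem θ w
    · intro hv
      exact ⟨_, (mem_contactPlane_iff.1 hv).symm⟩

end MA3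

theorem mainTheorem2 (E : MA3.MongeAmpere) (θ₁ : MA3.J1) (U₀ : MA3.Mat3)
    (hU₀ : U₀ ∈ MA3.fiber E.F θ₁)
    (hreg : E.symbol θ₁ U₀ ≠ 0)
    (hne : ¬ MA3.IsElliptic (E.symbol θ₁ U₀)) :
    ((E.symbol θ₁ U₀).det ≠ 0 →
      MA3.contactCone E.F θ₁ = E.cochar θ₁) ∧
    ((∀ᶠ U in 𝓝 U₀, U ∈ MA3.fiber E.F θ₁ → (E.symbol θ₁ U).rank = 2) →
      MA3.IsHyperbolic (E.symbol θ₁ U₀) →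
      ∃ D : Submodule ℝ MA3.J1,
        D ≤ MA3.contactPlane θ₁ ∧
        Module.finrank ℝ D = 3 ∧
        Module.finrank ℝ (MA3.sympOrth θ₁ D) = 3 ∧
        D ≠ MA3.sympOrth θ₁ D ∧
        MA3.contactCone E.F θ₁ = (D : Set MA3.J1) ∪ (MA3.sympOrth θ₁ D : Set MA3.J1) ∧
        E.cochar θ₁ = (Submodule.span ℝ
          ((D : Set MA3.J1) ∪ (MA3.sympOrth θ₁ D : Set MA3.J1)) : Set MA3.J1)) ∧
    ((∀ᶠ U in 𝓝 U₀, U ∈ MA3.fiber E.F θ₁ → (E.symbol θ₁ U).rank = 1) →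
      (∃ D : Submodule ℝ MA3.J1,
        MA3.IsLagrangian θ₁ D ∧ MA3.contactCone E.F θ₁ = (D : Set MA3.J1)) ∧
      E.cochar θ₁ = (MA3.contactPlane θ₁ : Set MA3.J1)) := by
  exact ⟨MA3.contactCone_eq_cochar E θ₁ hU₀ hne, MA3.contactCone_of_rank_two E θ₁ hU₀,
    MA3.contactCone_of_rank_one E θ₁ hU₀ hreg⟩
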